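/- Let $\Gamma$ be a discrete group and let $F\subset\Gamma$ be a finite subset with $F=F^{-1}$ and $1\in F$. Tensor products of $C^*$-algebras are minimal, $\lambda_s$ ($s\in\Gamma$) are the canonical unitaries in $C^*_{\mathrm{red}}\Gamma\subset\mathcal L(\ell^2\Gamma)$, and $\delta_\Gamma(\lambda_s)=\lambda_s\otimes\lambda_s$. **Algebras.** Let $P_F$ be the universal $C^*$-algebra with generators $p_s$, $s\in\Gamma$, and relations $p_s=0$ for $s\notin F$, $p_s^*=p_{s^{-1}}$ and $p_t=\sum_{s\in F}p_sp_{s^{-1}t}$ for all $t\in\Gamma$. Let $P_F^s$ be the universal $C^*$-algebra with the same generators and relations and the additional relations $p_{s_1}p_{s_2}\cdots p_{s_n}=0$ whenever $s_1s_2\cdots s_n\notin F$. Let $P_F^{\mathrm{red}}$ be the $C^*$-subalgebra of $P_F\otimes C^*_{\mathrm{red}}\Gamma$ generated by the elements $p_s\otimes\lambda_s$. Let $\mathcal E_F$ be the universal $C^*$-algebra with generators $h_s$, $s\in\Gamma$, and relations $h_s\ge 0$, $h_sh_t=0$ if $s^{-1}t\notin F$, and $\sum_s h_sh_t=h_t$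 for all $t$ (a finite sum by the preceding relation). Let $\mathcal E_F^s$ be its quotient by the additional relations $h_sh_{a_1}\cdots h_{a_n}h_t=0$ for all $a_1,\dots,a_n\in\Gamma$ if $s^{-1}t\notin F$. The group $\Gamma$ acts on $\mathcal E_F$ and on $\mathcal E_F^s$ by $g\cdot h_s=h_{gs}$; $\rtimes$ and $\rtimes_r$ denote the full and the reduced crossed product, and $u_s$ are the unitaries implementing the action. **Actions of $\hat\Gamma$.** An action of $\hat\Gamma$ on a $C^*$-algebra $A$ is a $*$-homomorphism $\delta:A\to A\otimes C^*_{\mathrm{red}}\Gamma$ which is nondegenerate (the hereditary subalgebra generated by its image is everything) and satisfies $(\delta\otimes 1)\delta=(1\otimes\delta_\Gamma)\delta$. Two $C^*$-algebras $A,B$ with actions of $\hat\Gamma$ are $\hat\Gamma$-equivariantly Morita equivalent if there is a $C^*$-algebra $E$ with an action of $\hat\Gamma$ which is a direct sum of closed invariant subspaces $A,X,Y,B$ that multiply (closed linear spans of products) and are permuted by the involution like the entries of matrices $\begin{pmatrix}A&X\\Y&B\end{pmatrix}$, where $A$ and $B$ are embedded equivariantly. **Theorem.** There are (unique) actions of $\hat\Gamma$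 on $P_F$ and $P_F^s$ with $p_s\mapsto p_s\otimes\lambda_s$, on $P_F^{\mathrm{red}}$ with $p_s\otimes\lambda_s\mapsto(p_s\otimes\lambda_s)\otimes\lambda_s$, and on the crossed products $\mathcal E_F\rtimes\Gamma$, $\mathcal E_F\rtimes_r\Gamma$, $\mathcal E_F^s\rtimes\Gamma$, $\mathcal E_F^s\rtimes_r\Gamma$ with $au_s\mapsto au_s\otimes\lambda_s$. For these actions: 1. $P_F$ is $\hat\Gamma$-equivariantly Morita equivalent to the full crossed product $\mathcal E_F\rtimes\Gamma$. 2. $P_F^{\mathrm{red}}$ is $\hat\Gamma$-equivariantly Morita equivalent to the reduced crossed product $\mathcal E_F\rtimes_r\Gamma$. 3. There is a $*$-isomorphism $\mathcal E_F^s\rtimes\Gamma\cong\mathcal E_F^s\rtimes_r\Gamma$ mapping $au_s$ to $au_s$, and $P_F^s$ is $\hat\Gamma$-equivariantly Morita equivalent to $\mathcal E_F^s\rtimes\Gamma$ and to $\mathcal E_F^s\rtimes_r\Gamma$. -/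

import Mathlib

universe u v w

noncomputable section

open UniformSpace CStarAlgebra

/-- Polynomials without constant term in noncommuting variables `x ∈ X` and their adjoints. -/
inductive StarTerm (X : Type u) : Type u
  | zero : StarTerm X
  | gen : X → StarTerm X
  | add : StarTerm X → StarTerm X → StarTerm X
  | smul : ℂ → StarTerm X → StarTerm X
  | mul : StarTerm X → StarTerm X → StarTerm X
  | star : StarTerm X → StarTerm X

namespace StarTerm

/-- The value of a polynomial at a family of elements of a C*-algebra. -/
def eval {X : Type u} {B : Type v} [NonUnitalCStarAlgebra B] (f : X → B) : StarTerm X → B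
  | zero => 0
  | gen x => f x
  | add p q => eval f p + eval f q
  | smul c p => c • eval f p
  | mul p q => eval f p * eval f q
  | star p => Star.star (eval f p)

/-- Renaming of the variables. -/
def rename {X : Type u} {Y : Type v} (r : X → Y) : StarTerm X → StarTerm Y
  | zero => zero
  | gen x => gen (r x)
  | add p q => add (rename r p) (rename r q)
  | smul c p => smul c (rename r p)
  | mul p q => mul (rename r p) (rename r q)
  | star p => star (rename r p)

theorem eval_rename {X : Type u} {Y : Type v} {B : Type w} [NonUnitalCStarAlgebra B]
    (r : X → Y) (f : Y → B) (p : StarTerm X) : eval f (rename r p) = eval (f ∘ r) p := by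
  induction p <;> simp_all [eval, rename]

end StarTerm

/-- A class of families `(b_x)_{x ∈ X}` of elements in C*-algebras, indexed by `ι`, whose norms are
bounded for every fixed `x`. -/
structure RepClass (X : Type u) where
  ι : Type (u + 1)
  alg : ι → Type u
  [inst : ∀ i, NonUnitalCStarAlgebra (alg i)]
  val : ∀ i, X → alg i
  bounded : ∀ x, ∃ C : ℝ, ∀ i, ‖val i x‖ ≤ C

attribute [instance] RepClass.inst

namespace RepClass

variable {X : Type u} (R : RepClass.{u} X)

theorem bounded_eval (p : StarTerm X) : ∃ C : ℝ, ∀ i, ‖p.eval (R.val i)‖ ≤ C := by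
  induction p with
  | zero => exact ⟨0, fun i => by simp [StarTerm.eval]⟩
  | gen x => exact R.bounded x
  | add p q hp hq =>
    obtain ⟨C, hC⟩ := hp
    obtain ⟨D, hD⟩ := hq
    exact ⟨C + D, fun i => (norm_add_le _ _).trans (add_le_add (hC i) (hD i))⟩
  | smul c p hp =>
    obtain ⟨C, hC⟩ := hp
    refine ⟨‖c‖ * C, fun i => ?_⟩
    simp only [StarTerm.eval, norm_smul]
    exact mul_le_mul_of_nonneg_left (hC i) (norm_nonneg _)
  | mul p q hp hq =>
    obtain ⟨C, hC⟩ := hp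
    obtain ⟨D, hD⟩ := hq
    exact ⟨C * D, fun i => (norm_mul_le _ _).trans
      (mul_le_mul (hC i) (hD i) (norm_nonneg _) ((norm_nonneg _).trans (hC i)))⟩
  | star p hp =>
    obtain ⟨C, hC⟩ := hp
    exact ⟨C, fun i => by simpa [StarTerm.eval] using hC i⟩

/-- Two polynomials are identified if they agree on all families of the class. -/
def setoid : Setoid (StarTerm X) where
  r p q := ∀ i, p.eval (R.val i) = q.eval (R.val i)
  iseqv := ⟨fun _ _ => rfl, fun h i => (h i).symm, fun h k i => (h i).trans (k i)⟩

/-- The *-algebra generated by the families of the class. -/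
def Poly : Type u := Quotient R.setoid

namespace Poly

variable {R}

/-- The value of a class of polynomials at the `i`-th family. -/
def ev (i : R.ι) : R.Poly → R.alg i := Quotient.lift (fun p => p.eval (R.val i)) fun _ _ h => h i

variable (R) in
/-- The class of a polynomial. -/
def mk (p : StarTerm X) : R.Poly := Quotient.mk R.setoid p

@[simp] theorem ev_mk (i : R.ι) (p : StarTerm X) : ev i (mk R p) = p.eval (R.val i) := rfl

theorem mk_surjective : Function.Surjective (mk R) := Quotient.mk_surjective

theorem ext {a b : R.Poly} (h : ∀ i, ev i a = ev i b) : a = b := by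
  induction a using Quotient.ind
  induction b using Quotient.ind
  exact Quotient.sound h

instance : Zero R.Poly := ⟨mk R .zero⟩
instance : Add R.Poly := ⟨Quotient.map₂ .add fun _ _ h _ _ k i => by simp [StarTerm.eval, h i, k i]⟩
instance : Mul R.Poly := ⟨Quotient.map₂ .mul fun _ _ h _ _ k i => by simp [StarTerm.eval, h i, k i]⟩
instance : SMul ℂ R.Poly :=
  ⟨fun c => Quotient.map (.smul c) fun _ _ h i => by simp [StarTerm.eval, h i]⟩
instance : Star R.Poly := ⟨Quotient.map .star fun _ _ h i => by simp [StarTerm.eval, h i]⟩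
instance : Neg R.Poly := ⟨fun a => (-1 : ℂ) • a⟩

@[simp] theorem ev_zero (i : R.ι) : ev i (0 : R.Poly) = 0 := rfl
@[simp] theorem ev_add (i : R.ι) (a b : R.Poly) : ev i (a + b) = ev i a + ev i b :=
  Quotient.inductionOn₂ a b fun _ _ => rfl
@[simp] theorem ev_mul (i : R.ι) (a b : R.Poly) : ev i (a * b) = ev i a * ev i b :=
  Quotient.inductionOn₂ a b fun _ _ => rfl
@[simp] theorem ev_smul (i : R.ι) (c : ℂ) (a : R.Poly) : ev i (c • a) = c • ev i a :=
  Quotient.inductionOn a fun _ => rfl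
@[simp] theorem ev_star (i : R.ι) (a : R.Poly) : ev i (star a) = star (ev i a) :=
  Quotient.inductionOn a fun _ => rfl
@[simp] theorem ev_neg (i : R.ι) (a : R.Poly) : ev i (-a) = -ev i a :=
  (ev_smul i (-1) a).trans (neg_one_smul ℂ _)

instance : NonUnitalRing R.Poly where
  add_assoc a b c := ext fun i => by simp [add_assoc]
  zero_add a := ext fun i => by simp
  add_zero a := ext fun i => by simp
  add_comm a b := ext fun i => by simp [add_comm]
  nsmul := nsmulRec
  zsmul := zsmulRec
  neg_add_cancel a := ext fun i => by simp
  left_distrib a b c := ext fun i => by simp [mul_add]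
  right_distrib a b c := ext fun i => by simp [add_mul]
  zero_mul a := ext fun i => by simp
  mul_zero a := ext fun i => by simp
  mul_assoc a b c := ext fun i => by simp [mul_assoc]

instance : Module ℂ R.Poly where
  one_smul a := ext fun i => by simp
  mul_smul c d a := ext fun i => by simp [mul_smul]
  smul_zero c := ext fun i => by simp
  smul_add c a b := ext fun i => by simp
  add_smul c d a := ext fun i => by simp [add_smul]
  zero_smul a := ext fun i => by simp

instance : StarRing R.Poly where
  star_involutive a := ext fun i => by simp
  star_mul a b := ext fun i => by simp
  star_add a b := ext fun i => by simp

instance : IsScalarTower ℂ R.Poly R.Poly :=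
  ⟨fun c a b => ext fun i => by simp [smul_mul_assoc]⟩
instance : SMulCommClass ℂ R.Poly R.Poly :=
  ⟨fun c a b => ext fun i => by simp [mul_smul_comm]⟩
instance : StarModule ℂ R.Poly := ⟨fun c a => ext fun i => by simp⟩

/-- The norm of a polynomial: the supremum of the norms of its values. -/
instance : Norm R.Poly := ⟨fun a => ⨆ i, ‖ev i a‖⟩

theorem norm_def (a : R.Poly) : ‖a‖ = ⨆ i, ‖ev i a‖ := rfl

theorem norm_ev_le (i : R.ι) (a : R.Poly) : ‖ev i a‖ ≤ ‖a‖ := by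
  refine le_ciSup (f := fun i => ‖ev i a‖) ?_ i
  obtain ⟨p, rfl⟩ := mk_surjective a
  obtain ⟨C, hC⟩ := R.bounded_eval p
  exact ⟨C, by rintro _ ⟨j, rfl⟩; exact hC j⟩

theorem norm_le {a : R.Poly} {C : ℝ} (hC : 0 ≤ C) (h : ∀ i, ‖ev i a‖ ≤ C) : ‖a‖ ≤ C :=
  Real.iSup_le h hC

theorem norm_nonneg' (a : R.Poly) : 0 ≤ ‖a‖ := Real.iSup_nonneg fun _ => norm_nonneg _

instance : NormedAddCommGroup R.Poly :=
  AddGroupNorm.toNormedAddCommGroup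
    { toFun := fun a => ‖a‖
      map_zero' := by simp [norm_def]
      add_le' := fun a b => norm_le (add_nonneg (norm_nonneg' a) (norm_nonneg' b)) fun i => by
        rw [ev_add]
        exact (norm_add_le _ _).trans (add_le_add (norm_ev_le i a) (norm_ev_le i b))
      neg' := fun a => by simp [norm_def]
      eq_zero_of_map_eq_zero' := fun a h => ext fun i => by
        simpa using (norm_ev_le i a).trans h.le }

instance : NonUnitalNormedRing R.Poly where
  __ := (inferInstance : NonUnitalRing R.Poly)
  __ := (inferInstance : NormedAddCommGroup R.Poly)
  norm_mul_le a b := norm_le (mul_nonneg (norm_nonneg' a) (norm_nonneg' b)) fun i => by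
    rw [ev_mul]
    exact (norm_mul_le _ _).trans
      (mul_le_mul (norm_ev_le i a) (norm_ev_le i b) (norm_nonneg _) (norm_nonneg' a))

instance : NormedSpace ℂ R.Poly where
  norm_smul_le c a := norm_le (mul_nonneg (norm_nonneg c) (norm_nonneg' a)) fun i => by
    rw [ev_smul, norm_smul]
    exact mul_le_mul_of_nonneg_left (norm_ev_le i a) (norm_nonneg _)

instance : CStarRing R.Poly where
  norm_mul_self_le a := by
    have h : ‖a‖ ≤ √‖star a * a‖ := norm_le (Real.sqrt_nonneg _) fun i => by
      refine Real.le_sqrt_of_sq_le ?_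
      have := norm_ev_le i (star a * a)
      rwa [ev_mul, ev_star, CStarRing.norm_star_mul_self, ← sq] at this
    calc ‖a‖ * ‖a‖ ≤ √‖star a * a‖ * √‖star a * a‖ :=
          mul_self_le_mul_self (norm_nonneg' a) h
      _ = ‖star a * a‖ := Real.mul_self_sqrt (norm_nonneg' _)

end Poly

end RepClass

/-- The completion of the *-algebra of polynomials. -/
def PreGen {X : Type u} (R : RepClass.{u} X) : Type u := Completion R.Poly

namespace PreGen

variable {X : Type u} {R : RepClass.{u} X}

instance : NormedAddCommGroup (PreGen R) := inferInstanceAs (NormedAddCommGroup (Completion R.Poly))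
instance : NormedSpace ℂ (PreGen R) := inferInstanceAs (NormedSpace ℂ (Completion R.Poly))
instance : ContinuousConstSMul ℂ (PreGen R) :=
  inferInstanceAs (ContinuousConstSMul ℂ (Completion R.Poly))
instance : CompleteSpace (PreGen R) := inferInstanceAs (CompleteSpace (Completion R.Poly))

/-- The inclusion of the polynomials. -/
def coe (a : R.Poly) : PreGen R := (a : Completion R.Poly)

theorem continuous_coe : Continuous (coe : R.Poly → PreGen R) := Completion.continuous_coe _
theorem isDenseInducing_coe : IsDenseInducing (coe : R.Poly → PreGen R) :=
  Completion.isDenseInducing_coe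
theorem norm_coe (a : R.Poly) : ‖coe a‖ = ‖a‖ := Completion.norm_coe a
theorem coe_add (a b : R.Poly) : coe (a + b) = coe a + coe b := Completion.coe_add a b
theorem coe_zero : coe (0 : R.Poly) = 0 := rfl
theorem coe_smul (c : ℂ) (a : R.Poly) : coe (c • a) = c • coe a := Completion.coe_smul c a

theorem continuous_smul (c : ℂ) : Continuous fun a : PreGen R => c • a :=
  continuous_const_smul c

theorem induction {P : PreGen R → Prop} (a : PreGen R) (hp : IsClosed {a | P a})
    (ih : ∀ a : R.Poly, P (coe a)) : P a := Completion.induction_on a hp ih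
theorem induction₂ {P : PreGen R → PreGen R → Prop} (a b : PreGen R)
    (hp : IsClosed {x : PreGen R × PreGen R | P x.1 x.2})
    (ih : ∀ a b : R.Poly, P (coe a) (coe b)) : P a b := Completion.induction_on₂ a b hp ih
theorem induction₃ {P : PreGen R → PreGen R → PreGen R → Prop} (a b c : PreGen R)
    (hp : IsClosed {x : PreGen R × PreGen R × PreGen R | P x.1 x.2.1 x.2.2})
    (ih : ∀ a b c : R.Poly, P (coe a) (coe b) (coe c)) : P a b c :=
  Completion.induction_on₃ a b c hp ih

instance : Mul (PreGen R) :=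
  ⟨Function.curry <| (isDenseInducing_coe.prodMap isDenseInducing_coe).extend
    (coe ∘ Function.uncurry (· * ·))⟩

theorem coe_mul (a b : R.Poly) : coe (a * b) = coe a * coe b :=
  ((isDenseInducing_coe.prodMap isDenseInducing_coe).extend_eq
    (continuous_coe.comp continuous_mul) (a, b)).symm

/-- The inclusion of the polynomials as an additive map. -/
def coeHom : R.Poly →+ PreGen R where
  toFun := coe
  map_zero' := coe_zero
  map_add' := coe_add

instance : ContinuousMul (PreGen R) where
  continuous_mul := by
    let m := (AddMonoidHom.mul : R.Poly →+ R.Poly →+ R.Poly).compr₂ coeHom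
    have : Continuous fun p : R.Poly × R.Poly => m p.1 p.2 := continuous_coe.comp continuous_mul
    have di : IsDenseInducing (coeHom : R.Poly → PreGen R) := isDenseInducing_coe
    exact di.extend_Z_bilin di this

instance : Star (PreGen R) := ⟨Completion.map (star : R.Poly → R.Poly)⟩

theorem uniformContinuous_star : UniformContinuous (star : R.Poly → R.Poly) :=
  (LipschitzWith.of_dist_le_mul (K := 1) fun a b => by
    rw [dist_eq_norm, dist_eq_norm, ← star_sub, norm_star]; simp).uniformContinuous

theorem coe_star (a : R.Poly) : coe (star a) = star (coe a) :=
  (Completion.map_coe uniformContinuous_star a).symm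

instance : ContinuousStar (PreGen R) := ⟨Completion.continuous_map⟩

instance : NonUnitalNormedRing (PreGen R) where
  __ := (inferInstance : NormedAddCommGroup (PreGen R))
  left_distrib a b c := by
    induction a, b, c using induction₃ with
    | hp => exact isClosed_eq (by fun_prop) (by fun_prop)
    | ih a b c => rw [← coe_add, ← coe_mul, ← coe_mul, ← coe_mul, ← coe_add, mul_add]
  right_distrib a b c := by
    induction a, b, c using induction₃ with
    | hp => exact isClosed_eq (by fun_prop) (by fun_prop)
    | ih a b c => rw [← coe_add, ← coe_mul, ← coe_mul, ← coe_mul, ← coe_add, add_mul]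
  zero_mul a := by
    induction a using induction with
    | hp => exact isClosed_eq (by fun_prop) (by fun_prop)
    | ih a => rw [← coe_zero, ← coe_mul, zero_mul]
  mul_zero a := by
    induction a using induction with
    | hp => exact isClosed_eq (by fun_prop) (by fun_prop)
    | ih a => rw [← coe_zero, ← coe_mul, mul_zero]
  mul_assoc a b c := by
    induction a, b, c using induction₃ with
    | hp => exact isClosed_eq (by fun_prop) (by fun_prop)
    | ih a b c => rw [← coe_mul, ← coe_mul, ← coe_mul, ← coe_mul, mul_assoc]
  norm_mul_le a b := by
    induction a, b using induction₂ with
    | hp => exact isClosed_le (by fun_prop) (by fun_prop)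
    | ih a b => rw [← coe_mul, norm_coe, norm_coe, norm_coe]; exact norm_mul_le a b

instance : StarRing (PreGen R) where
  star_involutive a := by
    induction a using induction with
    | hp => exact isClosed_eq (by fun_prop) (by fun_prop)
    | ih a => rw [← coe_star, ← coe_star, star_star]
  star_mul a b := by
    induction a, b using induction₂ with
    | hp => exact isClosed_eq (by fun_prop) (by fun_prop)
    | ih a b => rw [← coe_mul, ← coe_star, ← coe_star, ← coe_star, ← coe_mul, star_mul]
  star_add a b := by
    induction a, b using induction₂ with
    | hp => exact isClosed_eq (by fun_prop) (by fun_prop)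
    | ih a b => rw [← coe_add, ← coe_star, ← coe_star, ← coe_star, ← coe_add, star_add]

instance : CStarRing (PreGen R) where
  norm_mul_self_le a := by
    induction a using induction with
    | hp => exact isClosed_le (by fun_prop) (by fun_prop)
    | ih a =>
      rw [← coe_star, ← coe_mul, norm_coe, norm_coe]
      exact CStarRing.norm_mul_self_le a

instance : IsScalarTower ℂ (PreGen R) (PreGen R) where
  smul_assoc c a b := by
    rw [smul_eq_mul, smul_eq_mul]
    induction a, b using induction₂ with
    | hp =>
      exact isClosed_eq (((continuous_smul c).comp continuous_fst).mul continuous_snd)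
        ((continuous_smul c).comp (continuous_fst.mul continuous_snd))
    | ih a b => rw [← coe_smul, ← coe_mul, ← coe_mul, ← coe_smul, smul_mul_assoc]

instance : SMulCommClass ℂ (PreGen R) (PreGen R) where
  smul_comm c a b := by
    rw [smul_eq_mul, smul_eq_mul]
    induction a, b using induction₂ with
    | hp =>
      exact isClosed_eq ((continuous_smul c).comp (continuous_fst.mul continuous_snd))
        (continuous_fst.mul ((continuous_smul c).comp continuous_snd))
    | ih a b => rw [← coe_mul, ← coe_smul, ← coe_smul, ← coe_mul, mul_smul_comm]

instance : StarModule ℂ (PreGen R) where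
  star_smul c a := by
    induction a using induction with
    | hp =>
      exact isClosed_eq (continuous_star.comp (continuous_smul c))
        ((continuous_smul (star c)).comp continuous_star)
    | ih a => rw [← coe_smul, ← coe_star, ← coe_star, ← coe_smul, star_smul]

instance : NonUnitalCStarAlgebra (PreGen R) where

variable {Y : Type u} {S : RepClass.{u} Y}

/-- Renaming of the generators, on polynomials. -/
def relabelPoly (r : X → Y)
    (hr : ∀ j, ∃ i, ∀ p : StarTerm X, ‖p.eval (S.val j ∘ r)‖ ≤ ‖p.eval (R.val i)‖) :
    R.Poly → S.Poly :=
  Quotient.map (StarTerm.rename r) fun p q h j => by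
    obtain ⟨i, hi⟩ := hr j
    have := hi (.add p (.smul (-1) q))
    simp only [StarTerm.eval, neg_smul, one_smul, h i, add_neg_cancel, norm_zero] at this
    rw [StarTerm.eval_rename, StarTerm.eval_rename]
    exact add_neg_eq_zero.mp (norm_le_zero_iff.mp this)

theorem lipschitz_relabelPoly (r : X → Y)
    (hr : ∀ j, ∃ i, ∀ p : StarTerm X, ‖p.eval (S.val j ∘ r)‖ ≤ ‖p.eval (R.val i)‖) :
    LipschitzWith 1 (relabelPoly r hr) := LipschitzWith.of_dist_le_mul fun a b => by
  obtain ⟨p, rfl⟩ := RepClass.Poly.mk_surjective a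
  obtain ⟨q, rfl⟩ := RepClass.Poly.mk_surjective b
  rw [dist_eq_norm, dist_eq_norm, NNReal.coe_one, one_mul]
  refine RepClass.Poly.norm_le (norm_nonneg _) fun j => ?_
  obtain ⟨i, hi⟩ := hr j
  refine le_trans ?_ ((hi (.add p (.smul (-1) q))).trans ?_)
  · rw [← StarTerm.eval_rename]
    simp only [sub_eq_add_neg, RepClass.Poly.ev_add, RepClass.Poly.ev_neg, StarTerm.eval, neg_smul,
      one_smul, StarTerm.rename]
    exact le_rfl
  · refine le_trans (le_of_eq ?_) (RepClass.Poly.norm_ev_le i _)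
    simp only [sub_eq_add_neg, RepClass.Poly.ev_add, RepClass.Poly.ev_neg, StarTerm.eval, neg_smul,
      one_smul]
    rfl

/-- The *-homomorphism which maps the generator `x` to the generator `r x`; it exists if the
reindexing by `r` of every family of the class `S` is dominated by a family of the class `R`. -/
def relabel (r : X → Y)
    (hr : ∀ j, ∃ i, ∀ p : StarTerm X, ‖p.eval (S.val j ∘ r)‖ ≤ ‖p.eval (R.val i)‖) :
    PreGen R →⋆ₙₐ[ℂ] PreGen S :=
  let m : PreGen R → PreGen S := Completion.map (relabelPoly r hr)
  have hcoe (a : R.Poly) : m (coe a) = coe (relabelPoly r hr a) :=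
    Completion.map_coe (lipschitz_relabelPoly r hr).uniformContinuous a
  have hc : Continuous m := Completion.continuous_map
  { toFun := m
    map_smul' := fun c a => by
      induction a using induction with
      | hp =>
        exact isClosed_eq (f := fun a => m (c • a)) (g := fun a => c • m a)
          (hc.comp (continuous_smul c)) ((continuous_smul c).comp hc)
      | ih a =>
        rw [← coe_smul, hcoe, hcoe, MonoidHom.id_apply, ← coe_smul]
        exact congrArg coe (Quotient.inductionOn a fun _ => rfl)
    map_zero' := by
      rw [← coe_zero, hcoe]
      rfl
    map_add' := fun a b => by
      induction a, b using induction₂ with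
      | hp =>
        exact isClosed_eq (hc.comp (continuous_fst.add continuous_snd))
          ((hc.comp continuous_fst).add (hc.comp continuous_snd))
      | ih a b =>
        rw [← coe_add, hcoe, hcoe, hcoe, ← coe_add]
        exact congrArg coe (Quotient.inductionOn₂ a b fun _ _ => rfl)
    map_mul' := fun a b => by
      induction a, b using induction₂ with
      | hp =>
        exact isClosed_eq (hc.comp (continuous_fst.mul continuous_snd))
          ((hc.comp continuous_fst).mul (hc.comp continuous_snd))
      | ih a b =>
        rw [← coe_mul, hcoe, hcoe, hcoe, ← coe_mul]
        exact congrArg coe (Quotient.inductionOn₂ a b fun _ _ => rfl)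
    map_star' := fun a => by
      induction a using induction with
      | hp => exact isClosed_eq (hc.comp continuous_star) (continuous_star.comp hc)
      | ih a =>
        rw [← coe_star, hcoe, hcoe, ← coe_star]
        exact congrArg coe (Quotient.inductionOn a fun _ => rfl) }

end PreGen

/-- The C*-algebra generated by a class of families: the completion of the *-algebra of
polynomials in the generators in the norm `‖p‖ = sup ‖p(b)‖`, the supremum over all families `b` of
the class. If the class consists of all families which satisfy given relations in a C*-algebra, then
this is the universal C*-algebra defined by these generators and relations; if the class consists of
all families coming from representations of a certain kind, then this is the C*-algebra generated in
the direct sum of these representations. -/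
def CStarGen {X : Type u} (R : RepClass.{u} X) : Type u := PreGen R

namespace CStarGen

variable {X : Type u} {R : RepClass.{u} X}

instance instCStar : NonUnitalCStarAlgebra (CStarGen R) :=
  inferInstanceAs (NonUnitalCStarAlgebra (PreGen R))

variable (R) in
/-- The inclusion of the polynomials. -/
def ofPoly : R.Poly →⋆ₙₐ[ℂ] CStarGen R where
  toFun := PreGen.coe
  map_smul' := PreGen.coe_smul
  map_zero' := PreGen.coe_zero
  map_add' := PreGen.coe_add
  map_mul' := PreGen.coe_mul
  map_star' := PreGen.coe_star

theorem norm_ofPoly (a : R.Poly) : ‖ofPoly R a‖ = ‖a‖ := PreGen.norm_coe a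

theorem denseRange_ofPoly : DenseRange (ofPoly R) := PreGen.isDenseInducing_coe.dense

variable (R) in
/-- The generators. -/
def gen (x : X) : CStarGen R := ofPoly R (RepClass.Poly.mk R (.gen x))

variable {Y : Type u} {S : RepClass.{u} Y}

/-- The *-homomorphism which maps the generator `x` to the generator `r x`; it exists if the
reindexing by `r` of every family of the class `S` is dominated by a family of the class `R`. -/
def relabel (r : X → Y)
    (hr : ∀ j, ∃ i, ∀ p : StarTerm X, ‖p.eval (S.val j ∘ r)‖ ≤ ‖p.eval (R.val i)‖) :
    CStarGen R →⋆ₙₐ[ℂ] CStarGen S :=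
  PreGen.relabel r hr

theorem relabel_ofPoly (r : X → Y)
    (hr : ∀ j, ∃ i, ∀ p : StarTerm X, ‖p.eval (S.val j ∘ r)‖ ≤ ‖p.eval (R.val i)‖)
    (p : StarTerm X) : relabel r hr (ofPoly R (RepClass.Poly.mk R p)) =
      ofPoly S (RepClass.Poly.mk S (p.rename r)) :=
  Completion.map_coe (PreGen.lipschitz_relabelPoly r hr).uniformContinuous _

theorem relabel_gen (r : X → Y)
    (hr : ∀ j, ∃ i, ∀ p : StarTerm X, ‖p.eval (S.val j ∘ r)‖ ≤ ‖p.eval (R.val i)‖)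
    (x : X) : relabel r hr (gen R x) = gen S (r x) := relabel_ofPoly r hr _

attribute [irreducible] instCStar

/-- Two *-homomorphisms which agree on the generators are equal. -/
theorem hom_ext {B : Type v} [NonUnitalCStarAlgebra B] {φ ψ : CStarGen R →⋆ₙₐ[ℂ] B}
    (h : ∀ x, φ (gen R x) = ψ (gen R x)) : φ = ψ := by
  have hφ : Continuous φ := map_continuous φ
  have hψ : Continuous ψ := map_continuous ψ
  have key (p : StarTerm X) : φ (ofPoly R (RepClass.Poly.mk R p)) =
      ψ (ofPoly R (RepClass.Poly.mk R p)) := by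
    induction p with
    | zero => exact (map_zero (φ.comp (ofPoly R))).trans (map_zero (ψ.comp (ofPoly R))).symm
    | gen x => exact h x
    | add p q hp hq =>
      change φ (ofPoly R (RepClass.Poly.mk R p + RepClass.Poly.mk R q)) =
        ψ (ofPoly R (RepClass.Poly.mk R p + RepClass.Poly.mk R q))
      rw [map_add, map_add, map_add, hp, hq]
    | smul c p hp =>
      change φ (ofPoly R (c • RepClass.Poly.mk R p)) = ψ (ofPoly R (c • RepClass.Poly.mk R p))
      rw [map_smul, map_smul, map_smul, hp]
    | mul p q hp hq =>
      change φ (ofPoly R (RepClass.Poly.mk R p * RepClass.Poly.mk R q)) =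
        ψ (ofPoly R (RepClass.Poly.mk R p * RepClass.Poly.mk R q))
      rw [map_mul, map_mul, map_mul, hp, hq]
    | star p hp =>
      change φ (ofPoly R (star (RepClass.Poly.mk R p))) =
        ψ (ofPoly R (star (RepClass.Poly.mk R p)))
      rw [map_star, map_star, map_star, hp]
  ext a
  refine congrFun (denseRange_ofPoly.equalizer hφ hψ (funext fun b => ?_)) a
  obtain ⟨p, rfl⟩ := RepClass.Poly.mk_surjective b
  exact key p

end CStarGen

/-! ### Universal C*-algebras defined by generators and relations -/

/-- A family in a C*-algebra which satisfies given relations. -/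
structure RelFamily {X : Type u}
    (rel : ∀ {B : Type u} [NonUnitalCStarAlgebra B], (X → B) → Prop) : Type (u + 1) where
  alg : Type u
  [inst : NonUnitalCStarAlgebra alg]
  val : X → alg
  prop : rel val

attribute [instance] RelFamily.inst

/-- The class of all families, in arbitrary C*-algebras, which satisfy given relations. The C*-algebra
generated by this class is the universal C*-algebra defined by these generators and relations; it
exists as soon as the relations bound the norm of every generator. -/
def RepClass.ofRelations {X : Type u}
    (rel : ∀ {B : Type u} [NonUnitalCStarAlgebra B], (X → B) → Prop)
    (bound : ∀ x, ∃ C : ℝ, ∀ (B : Type u) [NonUnitalCStarAlgebra B] (f : X → B),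
      rel f → ‖f x‖ ≤ C) : RepClass.{u} X where
  ι := RelFamily rel
  alg i := i.alg
  val i := i.val
  bounded x := (bound x).imp fun _ hC i => hC i.alg i.val i.prop

/-- The *-homomorphism between universal C*-algebras which maps the generator `x` to the generator
`r x`; it exists if the reindexed families satisfy the relations of the domain. -/
def CStarGen.relabelRelations {X Y : Type u}
    {rel : ∀ {B : Type u} [NonUnitalCStarAlgebra B], (X → B) → Prop}
    {bound : ∀ x, ∃ C : ℝ, ∀ (B : Type u) [NonUnitalCStarAlgebra B] (f : X → B),
      rel f → ‖f x‖ ≤ C}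
    {rel' : ∀ {B : Type u} [NonUnitalCStarAlgebra B], (Y → B) → Prop}
    {bound' : ∀ y, ∃ C : ℝ, ∀ (B : Type u) [NonUnitalCStarAlgebra B] (f : Y → B),
      rel' f → ‖f y‖ ≤ C}
    (r : X → Y)
    (h : ∀ (B : Type u) [NonUnitalCStarAlgebra B] (f : Y → B), rel' f → rel (f ∘ r)) :
    CStarGen (RepClass.ofRelations rel bound) →⋆ₙₐ[ℂ] CStarGen (RepClass.ofRelations rel' bound') :=
  CStarGen.relabel r fun (j : RelFamily rel') =>
    ⟨(⟨j.alg, j.val ∘ r, h j.alg j.val j.prop⟩ : RelFamily rel), fun _ => le_rfl⟩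

theorem CStarGen.relabelRelations_gen {X Y : Type u}
    {rel : ∀ {B : Type u} [NonUnitalCStarAlgebra B], (X → B) → Prop}
    {bound : ∀ x, ∃ C : ℝ, ∀ (B : Type u) [NonUnitalCStarAlgebra B] (f : X → B),
      rel f → ‖f x‖ ≤ C}
    {rel' : ∀ {B : Type u} [NonUnitalCStarAlgebra B], (Y → B) → Prop}
    {bound' : ∀ y, ∃ C : ℝ, ∀ (B : Type u) [NonUnitalCStarAlgebra B] (f : Y → B),
      rel' f → ‖f y‖ ≤ C}
    (r : X → Y)
    (h : ∀ (B : Type u) [NonUnitalCStarAlgebra B] (f : Y → B), rel' f → rel (f ∘ r)) (x : X) :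
    CStarGen.relabelRelations (bound := bound) (bound' := bound') r h
      (CStarGen.gen (RepClass.ofRelations rel bound) x) =
      CStarGen.gen (RepClass.ofRelations rel' bound') (r x) :=
  CStarGen.relabel_gen _ _ _

/-! ### Minimal tensor products -/

/-- A representation of a C*-algebra on a Hilbert space. -/
structure HilbRep (A : Type u) [NonUnitalCStarAlgebra A] : Type (u + 1) where
  space : Type u
  [group : NormedAddCommGroup space]
  [inner : InnerProductSpace ℂ space]
  [complete : CompleteSpace space]
  hom : A →⋆ₙₐ[ℂ] (space →L[ℂ] space)

attribute [instance] HilbRep.group HilbRep.inner HilbRep.complete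

open scoped TensorProduct in
/-- The operator `S ⊗ T` on the Hilbert space tensor product of `H` and `K`, that is on the completion
of their algebraic tensor product. -/
def tensorOp {H K : Type u} [NormedAddCommGroup H] [InnerProductSpace ℂ H]
    [NormedAddCommGroup K] [InnerProductSpace ℂ K] (S : H →L[ℂ] H) (T : K →L[ℂ] K) :
    Completion (H ⊗[ℂ] K) →L[ℂ] Completion (H ⊗[ℂ] K) :=
  (TensorProduct.mapL S T).completion

theorem norm_tensorOp_le {H K : Type u} [NormedAddCommGroup H] [InnerProductSpace ℂ H]
    [NormedAddCommGroup K] [InnerProductSpace ℂ K] (S : H →L[ℂ] H) (T : K →L[ℂ] K) :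
    ‖tensorOp S T‖ ≤ ‖S‖ * ‖T‖ := by
  refine ContinuousLinearMap.opNorm_le_bound _ (by positivity) fun x => ?_
  induction x using Completion.induction_on with
  | hp => exact isClosed_le (by fun_prop) (by fun_prop)
  | ih x =>
    rw [tensorOp, ContinuousLinearMap.completion_apply_coe, Completion.norm_coe,
      Completion.norm_coe]
    exact ((TensorProduct.mapL S T).le_opNorm x).trans
      (mul_le_mul_of_nonneg_right (TensorProduct.norm_mapL_le S T) (norm_nonneg x))

/-- The families `(π(a) ⊗ ρ(b))_{a, b}`, for all representations `π` of `A` and `ρ` of `B`. -/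
def tensorClass (A B : Type u) [NonUnitalCStarAlgebra A] [NonUnitalCStarAlgebra B] :
    RepClass.{u} (A × B) where
  ι := HilbRep A × HilbRep B
  alg i := Completion (TensorProduct ℂ i.1.space i.2.space) →L[ℂ]
    Completion (TensorProduct ℂ i.1.space i.2.space)
  val i x := tensorOp (i.1.hom x.1) (i.2.hom x.2)
  bounded x := ⟨‖x.1‖ * ‖x.2‖, fun i => (norm_tensorOp_le _ _).trans
    (mul_le_mul (NonUnitalStarAlgHom.norm_apply_le i.1.hom x.1)
      (NonUnitalStarAlgHom.norm_apply_le i.2.hom x.2) (norm_nonneg _) (norm_nonneg _))⟩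

/-- The minimal (spatial) tensor product of two C*-algebras: the C*-algebra generated by the
elementary tensors `a ⊗ b` in the norm `‖∑ a_k ⊗ b_k‖ = sup ‖∑ π(a_k) ⊗ ρ(b_k)‖`, the supremum over
all representations `π` of `A` and `ρ` of `B` on Hilbert spaces. -/
abbrev MinTensor (A B : Type u) [NonUnitalCStarAlgebra A] [NonUnitalCStarAlgebra B] : Type u :=
  CStarGen (tensorClass A B)

namespace MinTensor

variable {A B C D : Type u} [NonUnitalCStarAlgebra A] [NonUnitalCStarAlgebra B]
  [NonUnitalCStarAlgebra C] [NonUnitalCStarAlgebra D]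

/-- The elementary tensor `a ⊗ b`. -/
def tmul (a : A) (b : B) : MinTensor A B := CStarGen.gen (tensorClass A B) (a, b)

/-- The *-homomorphism `φ ⊗ ψ`, which maps `a ⊗ b` to `φ a ⊗ ψ b`. -/
def map (φ : A →⋆ₙₐ[ℂ] C) (ψ : B →⋆ₙₐ[ℂ] D) : MinTensor A B →⋆ₙₐ[ℂ] MinTensor C D :=
  CStarGen.relabel (fun x => (φ x.1, ψ x.2)) fun j =>
    ⟨(⟨j.1.space, j.1.hom.comp φ⟩, ⟨j.2.space, j.2.hom.comp ψ⟩), fun _ => le_rfl⟩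

theorem map_tmul (φ : A →⋆ₙₐ[ℂ] C) (ψ : B →⋆ₙₐ[ℂ] D) (a : A) (b : B) :
    map φ ψ (tmul a b) = tmul (φ a) (ψ b) := CStarGen.relabel_gen _ _ _

end MinTensor

/-! ### The regular representation and the reduced group C*-algebra -/

section Regular

variable {Γ : Type u} [Group Γ] {H : Type v} [NormedAddCommGroup H] [InnerProductSpace ℂ H]

theorem summable_translate (T : Γ → H →L[ℂ] H) (C : ℝ) (hT : ∀ t, ‖T t‖ ≤ C) (s : Γ)
    (ξ : lp (fun _ : Γ => H) 2) :
    Summable (fun t => C ^ 2 * ‖ξ (s⁻¹ * t)‖ ^ 2) ∧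
      ∀ t, ‖T t (ξ (s⁻¹ * t))‖ ^ 2 ≤ C ^ 2 * ‖ξ (s⁻¹ * t)‖ ^ 2 := by
  constructor
  · have h : Summable fun t => ‖ξ t‖ ^ 2 := by
      simpa using (lp.memℓp ξ).summable (by simp)
    exact ((Equiv.mulLeft s⁻¹).summable_iff.mpr h).mul_left _
  · intro t
    rw [← mul_pow]
    gcongr
    exact ((T t).le_opNorm _).trans (mul_le_mul_of_nonneg_right (hT t) (norm_nonneg _))

theorem memℓp_translate (T : Γ → H →L[ℂ] H) (C : ℝ) (hT : ∀ t, ‖T t‖ ≤ C) (s : Γ)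
    (ξ : lp (fun _ : Γ => H) 2) : Memℓp (fun t => T t (ξ (s⁻¹ * t))) 2 := by
  obtain ⟨h1, h2⟩ := summable_translate T C hT s ξ
  exact memℓp_gen (by simpa using h1.of_nonneg_of_le (fun t => by positivity) h2)

/-- The operator on `ℓ²(Γ, H)` given by `(T λ_s ξ)(t) = T_t (ξ (s⁻¹ t))`, where `T` is the diagonal
operator with the uniformly bounded entries `T_t`. -/
def diagTranslate (T : Γ → H →L[ℂ] H) (C : ℝ) (hT : ∀ t, ‖T t‖ ≤ C) (s : Γ) :
    lp (fun _ : Γ => H) 2 →L[ℂ] lp (fun _ : Γ => H) 2 :=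
  LinearMap.mkContinuous
    { toFun := fun ξ => ⟨fun t => T t (ξ (s⁻¹ * t)), memℓp_translate T C hT s ξ⟩
      map_add' := fun ξ η => lp.ext (funext fun t => map_add (T t) (ξ (s⁻¹ * t)) (η (s⁻¹ * t)))
      map_smul' := fun c ξ => lp.ext (funext fun t => map_smul (T t) c (ξ (s⁻¹ * t))) }
    C fun ξ => by
      have hC : 0 ≤ C := (norm_nonneg _).trans (hT 1)
      obtain ⟨h1, h2⟩ := summable_translate T C hT s ξ
      refine lp.norm_le_of_tsum_le (by simp) (by positivity) ?_
      have h3 : ‖ξ‖ ^ 2 = ∑' t, ‖ξ (s⁻¹ * t)‖ ^ 2 := by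
        have := lp.norm_rpow_eq_tsum (p := 2) (by simp) ξ
        simp only [ENNReal.toReal_ofNat, Real.rpow_ofNat] at this
        rw [this]
        exact ((Equiv.mulLeft s⁻¹).tsum_eq fun t => ‖ξ t‖ ^ 2).symm
      simp only [ENNReal.toReal_ofNat, Real.rpow_ofNat]
      rw [mul_pow, h3, ← tsum_mul_left]
      exact (h1.of_nonneg_of_le (fun t => by positivity) h2).tsum_le_tsum h2 h1

theorem diagTranslate_apply (T : Γ → H →L[ℂ] H) (C : ℝ) (hT : ∀ t, ‖T t‖ ≤ C) (s : Γ)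
    (ξ : lp (fun _ : Γ => H) 2) (t : Γ) : diagTranslate T C hT s ξ t = T t (ξ (s⁻¹ * t)) := rfl

theorem norm_diagTranslate_le (T : Γ → H →L[ℂ] H) (C : ℝ) (hT : ∀ t, ‖T t‖ ≤ C) (s : Γ) :
    ‖diagTranslate T C hT s‖ ≤ C :=
  LinearMap.mkContinuous_norm_le _ ((norm_nonneg _).trans (hT 1)) _

end Regular

/-- The unitary `λ_s` on `ℓ²(Γ)`, `λ_s ξ_t = ξ_{st}`, that is `(λ_s ξ)(t) = ξ(s⁻¹ t)`. -/
def leftRegular {Γ : Type u} [Group Γ] (s : Γ) :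
    lp (fun _ : Γ => ℂ) 2 →L[ℂ] lp (fun _ : Γ => ℂ) 2 :=
  diagTranslate (fun _ => 1) 1 (fun _ => norm_one.le) s

/-- The closed *-subalgebra generated by a set in a C*-algebra. -/
def cstarAdjoin {A : Type v} [NonUnitalCStarAlgebra A] (S : Set A) : NonUnitalStarSubalgebra ℂ A :=
  (NonUnitalStarAlgebra.adjoin ℂ S).topologicalClosure

theorem subset_cstarAdjoin {A : Type v} [NonUnitalCStarAlgebra A] (S : Set A) :
    S ⊆ cstarAdjoin S :=
  (NonUnitalStarAlgebra.subset_adjoin ℂ S).trans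
    (NonUnitalStarSubalgebra.le_topologicalClosure _)

instance {A : Type v} [NonUnitalCStarAlgebra A] (S : Set A) :
    IsClosed (cstarAdjoin S : Set A) :=
  NonUnitalStarSubalgebra.isClosed_topologicalClosure _

/-- The reduced group C*-algebra. -/
def RedGroupCStar (Γ : Type u) [Group Γ] : Type u :=
  cstarAdjoin (Set.range (leftRegular : Γ → lp (fun _ : Γ => ℂ) 2 →L[ℂ] lp (fun _ : Γ => ℂ) 2))

instance RedGroupCStar.instCStar (Γ : Type u) [Group Γ] : NonUnitalCStarAlgebra (RedGroupCStar Γ) :=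
  inferInstanceAs (NonUnitalCStarAlgebra (cstarAdjoin (Set.range
    (leftRegular : Γ → lp (fun _ : Γ => ℂ) 2 →L[ℂ] lp (fun _ : Γ => ℂ) 2))))

/-- The generators of the reduced group C*-algebra. -/
def RedGroupCStar.unit {Γ : Type u} [Group Γ] (s : Γ) : RedGroupCStar Γ :=
  ⟨leftRegular s, subset_cstarAdjoin _ ⟨s, rfl⟩⟩

/-! ### Actions of the dual, equivariant Morita equivalence -/

/-- An action of the dual of the discrete group `Γ` on `A`: a nondegenerate coassociative
*-homomorphism `δ : A → A ⊗ C*_red(Γ)`. -/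
structure DualAction (Γ : Type u) [Group Γ] (A : Type u) [NonUnitalCStarAlgebra A] where
  δ : A →⋆ₙₐ[ℂ] MinTensor A (RedGroupCStar Γ)
  /-- The hereditary subalgebra generated by the image of `δ` is everything. -/
  nondegenerate : (Submodule.span ℂ {z | ∃ a b : A, ∃ y, z = δ a * y * δ b}).topologicalClosure = ⊤
  /-- `(δ ⊗ 1) δ = (1 ⊗ δ_Γ) δ`, where `1 ⊗ δ_Γ` is the *-homomorphism, determined by its values on
  elementary tensors, which maps `a ⊗ λ_s` to `a ⊗ λ_s ⊗ λ_s`. -/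
  coassociative : ∃ Δ : MinTensor A (RedGroupCStar Γ) →⋆ₙₐ[ℂ]
      MinTensor (MinTensor A (RedGroupCStar Γ)) (RedGroupCStar Γ),
    (∀ (a : A) (s : Γ), Δ (.tmul a (.unit s)) = .tmul (.tmul a (.unit s)) (.unit s)) ∧
    ∀ a, MinTensor.map δ (NonUnitalStarAlgHom.id ℂ _) (δ a) = Δ (δ a)

/-- The closed linear span of the products `x y` with `x ∈ X` and `y ∈ Y`. -/
def closedMul {E : Type u} [NonUnitalCStarAlgebra E] (X Y : Submodule ℂ E) : Submodule ℂ E :=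
  (Submodule.span ℂ {z | ∃ x ∈ X, ∃ y ∈ Y, z = x * y}).topologicalClosure

/-- Equivariant Morita equivalence of `A` and `B`: there is a C*-algebra `E` with an action of the
dual of `Γ` which is the direct sum of closed invariant subspaces `M k l`, `k, l ∈ {0, 1}`, that
multiply like the entries of 2×2-matrices, and there are equivariant isomorphisms of `A` onto `M 0 0`
and of `B` onto `M 1 1`. -/
def DualMoritaEquivalent {Γ : Type u} [Group Γ] {A B : Type u} [NonUnitalCStarAlgebra A]
    [NonUnitalCStarAlgebra B] (α : DualAction Γ A) (β : DualAction Γ B) : Prop :=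
  ∃ (E : Type u) (_ : NonUnitalCStarAlgebra E) (ε : DualAction Γ E)
    (M : Fin 2 → Fin 2 → Submodule ℂ E) (i : A →⋆ₙₐ[ℂ] E) (j : B →⋆ₙₐ[ℂ] E),
    (∀ k l, IsClosed (M k l : Set E)) ∧
    DirectSum.IsInternal (fun kl : Fin 2 × Fin 2 => M kl.1 kl.2) ∧
    (∀ k l m, closedMul (M k l) (M l m) = M k m) ∧
    (∀ k l l' m, l ≠ l' → ∀ x ∈ M k l, ∀ y ∈ M l' m, x * y = 0) ∧
    (∀ k l, ∀ x ∈ M k l, star x ∈ M l k) ∧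
    (∀ k l, ∀ x ∈ M k l, ε.δ x ∈ (Submodule.span ℂ
      {z | ∃ y ∈ M k l, ∃ c, z = MinTensor.tmul y c}).topologicalClosure) ∧
    Function.Injective i ∧ Set.range i = M 0 0 ∧
    Function.Injective j ∧ Set.range j = M 1 1 ∧
    (∀ a, ε.δ (i a) = MinTensor.map i (NonUnitalStarAlgHom.id ℂ _) (α.δ a)) ∧
    ∀ b, ε.δ (j b) = MinTensor.map j (NonUnitalStarAlgHom.id ℂ _) (β.δ b)

/-! ### Crossed products -/

/-- An action of a discrete group on a C*-algebra by automorphisms. -/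
structure CStarAction (Γ : Type u) [Group Γ] (A : Type u) [NonUnitalCStarAlgebra A] where
  act : Γ → A →⋆ₙₐ[ℂ] A
  act_one : act 1 = NonUnitalStarAlgHom.id ℂ A
  act_mul : ∀ s t, act (s * t) = (act s).comp (act t)

section Crossed

variable {Γ : Type u} [Group Γ] {A : Type u} [NonUnitalCStarAlgebra A]

/-- The relations between the elements `a u_s`, `a ∈ A`, `s ∈ Γ`, of a crossed product: they say that
`∑ a_s u_s ↦ ∑ f (a_s, s)` is a *-homomorphism on the convolution *-algebra of finitely supported
functions from `Γ` to `A`. -/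
structure IsCrossedFamily (α : CStarAction Γ A) {B : Type u} [NonUnitalCStarAlgebra B]
    (f : A × Γ → B) : Prop where
  add : ∀ a b s, f (a + b, s) = f (a, s) + f (b, s)
  smul : ∀ (c : ℂ) a s, f (c • a, s) = c • f (a, s)
  mul : ∀ a b s t, f (a, s) * f (b, t) = f (a * α.act s b, s * t)
  adj : ∀ a s, star (f (a, s)) = f (α.act s⁻¹ (star a), s⁻¹)

theorem IsCrossedFamily.norm_le {α : CStarAction Γ A} {B : Type u} [NonUnitalCStarAlgebra B]
    {f : A × Γ → B} (hf : IsCrossedFamily α f) (x : A × Γ) : ‖f x‖ ≤ ‖x.1‖ := by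
  obtain ⟨a, s⟩ := x
  have h1 (b : A) : α.act 1 b = b := by rw [α.act_one]; rfl
  let φ : A →⋆ₙₐ[ℂ] B :=
    { toFun := fun b => f (b, 1)
      map_smul' := fun c b => hf.smul c b 1
      map_zero' := by simpa using hf.smul 0 0 1
      map_add' := fun b c => hf.add b c 1
      map_mul' := fun b c => by rw [hf.mul, h1, one_mul]
      map_star' := fun b => by rw [hf.adj, inv_one, h1] }
  have h2 : f (a, s) * star (f (a, s)) = φ (a * star a) := by
    rw [hf.adj, hf.mul, ← NonUnitalStarAlgHom.comp_apply, ← α.act_mul, mul_inv_cancel, h1]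
    rfl
  have h3 := NonUnitalStarAlgHom.norm_apply_le φ (a * star a)
  rw [← h2, CStarRing.norm_self_mul_star, CStarRing.norm_self_mul_star] at h3
  exact abs_le_of_sq_le_sq' (by simpa [sq] using h3) (norm_nonneg _) |>.2

/-- The full crossed product `A ⋊ Γ`: the universal C*-algebra generated by the elements `a u_s`,
that is the enveloping C*-algebra of the convolution *-algebra of finitely supported functions from
`Γ` to `A`. -/
abbrev FullCrossed (α : CStarAction Γ A) : Type u :=
  CStarGen (RepClass.ofRelations (X := A × Γ) (fun f => IsCrossedFamily α f)
    fun x => ⟨‖x.1‖, fun _ _ _ hf => hf.norm_le x⟩)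

/-- The element `a u_s` of the full crossed product. -/
def FullCrossed.mk (α : CStarAction Γ A) (a : A) (s : Γ) : FullCrossed α := CStarGen.gen _ (a, s)

/-- The families `(a, s) ↦ π̃(a) λ_s` on `ℓ²(Γ, H)`, with `(π̃(a) ξ)(t) = π(t⁻¹ • a) (ξ t)`, for all
representations `π` of `A` on a Hilbert space `H`. -/
def regularClass (α : CStarAction Γ A) : RepClass.{u} (A × Γ) where
  ι := HilbRep A
  alg i := lp (fun _ : Γ => i.space) 2 →L[ℂ] lp (fun _ : Γ => i.space) 2
  val i x := diagTranslate (fun t => i.hom (α.act t⁻¹ x.1)) ‖x.1‖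
    (fun t => (NonUnitalStarAlgHom.norm_apply_le i.hom _).trans
      (NonUnitalStarAlgHom.norm_apply_le (α.act t⁻¹) x.1)) x.2
  bounded x := ⟨‖x.1‖, fun _ => norm_diagTranslate_le _ _ _ _⟩

/-- The reduced crossed product of `A` by `Γ`: the C*-algebra generated by the elements `a u_s` in
the regular representations on `ℓ²(Γ, H)` induced by the representations of `A` on Hilbert spaces
`H`. -/
abbrev RedCrossed (α : CStarAction Γ A) : Type u := CStarGen (regularClass α)

/-- The element `a u_s` of the reduced crossed product. -/
def RedCrossed.mk (α : CStarAction Γ A) (a : A) (s : Γ) : RedCrossed α := CStarGen.gen _ (a, s)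

end Crossed

/-! ### The universal algebras generated by the coefficients of a projection -/

section Projection

variable {Γ : Type u} [Group Γ] (F : Finset Γ)

/-- The relations satisfied by the coefficients of a projection with support in `F`. -/
structure IsProjFamily {B : Type u} [NonUnitalCStarAlgebra B] (p : Γ → B) : Prop where
  zero : ∀ s, s ∉ F → p s = 0
  adj : ∀ s, star (p s) = p s⁻¹
  mul : ∀ t, p t = ∑ s ∈ F, p s * p (s⁻¹ * t)

/-- In addition, all products `p_{s₁} p_{s₂} ⋯ p_{sₙ}` with `s₁ s₂ ⋯ sₙ ∉ F` vanish. -/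
structure IsStrongProjFamily {B : Type u} [NonUnitalCStarAlgebra B] (p : Γ → B) : Prop extends
    IsProjFamily F p where
  prod : ∀ (s : Γ) (l : List Γ), s * l.prod ∉ F → l.foldl (fun x a => x * p a) (p s) = 0

variable {F}

theorem IsProjFamily.norm_le {B : Type u} [NonUnitalCStarAlgebra B] {p : Γ → B}
    (hp : IsProjFamily F p) (s : Γ) : ‖p s‖ ≤ 1 := by
  let _ := spectralOrder B
  have _ := spectralOrderedRing B
  have h1 : p 1 = ∑ s ∈ F, p s * star (p s) := by
    rw [hp.mul 1]
    exact Finset.sum_congr rfl fun s _ => by rw [hp.adj, mul_one]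
  have h2 (s : Γ) : p s * star (p s) ≤ p 1 := by
    by_cases hs : s ∈ F
    · rw [h1]
      exact Finset.single_le_sum (f := fun s => p s * star (p s))
        (fun t _ => mul_star_self_nonneg _) hs
    · rw [hp.zero s hs, zero_mul, h1]
      exact Finset.sum_nonneg fun t _ => mul_star_self_nonneg _
  have h3 (s : Γ) : ‖p s‖ * ‖p s‖ ≤ ‖p 1‖ := by
    rw [← CStarRing.norm_self_mul_star]
    exact norm_le_norm_of_nonneg_of_le (mul_star_self_nonneg _) (h2 s)
  have h4 : ‖p 1‖ ≤ 1 := by nlinarith [h3 1, norm_nonneg (p 1)]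
  nlinarith [h3 s, norm_nonneg (p s)]

variable (F)

/-- The universal C*-algebra generated by the coefficients of a projection with support in `F`. -/
abbrev ProjAlg : Type u :=
  CStarGen (RepClass.ofRelations (X := Γ) (fun p => IsProjFamily F p)
    fun s => ⟨1, fun _ _ _ hp => hp.norm_le s⟩)

/-- The generator `p_s`. -/
def ProjAlg.p (s : Γ) : ProjAlg F := CStarGen.gen _ s

/-- The universal C*-algebra generated by the coefficients of a projection which generate a
C*-algebra with support in `F`. -/
abbrev StrongProjAlg : Type u :=
  CStarGen (RepClass.ofRelations (X := Γ) (fun p => IsStrongProjFamily F p)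
    fun s => ⟨1, fun _ _ _ hp => hp.norm_le s⟩)

/-- The generator `p_s`. -/
def StrongProjAlg.p (s : Γ) : StrongProjAlg F := CStarGen.gen _ s

/-- The C*-subalgebra generated by the elements `p_s ⊗ λ_s` of the minimal tensor product. -/
def RedProjAlg : Type u :=
  cstarAdjoin (Set.range fun s : Γ => (MinTensor.tmul (ProjAlg.p F s) (.unit s) :
    MinTensor (ProjAlg F) (RedGroupCStar Γ)))

instance RedProjAlg.instCStar : NonUnitalCStarAlgebra (RedProjAlg F) :=
  inferInstanceAs (NonUnitalCStarAlgebra (cstarAdjoin (Set.range fun s : Γ =>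
    (MinTensor.tmul (ProjAlg.p F s) (.unit s) : MinTensor (ProjAlg F) (RedGroupCStar Γ)))))

/-- The generator `p_s ⊗ λ_s`. -/
def RedProjAlg.p (s : Γ) : RedProjAlg F :=
  ⟨MinTensor.tmul (ProjAlg.p F s) (.unit s), subset_cstarAdjoin _ ⟨s, rfl⟩⟩

end Projection

/-! ### The noncommutative simplicial complexes -/

section Complex

variable {Γ : Type u} [Group Γ] (F : Finset Γ)

/-- Positive elements `h_s`, `s ∈ Γ`, with `h_s h_t = 0` if `s⁻¹ t ∉ F` and `∑_s h_s h_t = h_t`; by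
the second relation only the terms with `s⁻¹ t ∈ F`, that is `s = t f⁻¹` with `f ∈ F`, contribute to
the sum. -/
structure IsComplexFamily {B : Type u} [NonUnitalCStarAlgebra B] (h : Γ → B) : Prop where
  pos : ∀ s, ∃ b, h s = star b * b
  orth : ∀ s t, s⁻¹ * t ∉ F → h s * h t = 0
  sum : ∀ t, ∑ f ∈ F, h (t * f⁻¹) * h t = h t

/-- In addition, `h_s h_{a₁} ⋯ h_{aₙ} h_t = 0` for all `a₁, …, aₙ` if `s⁻¹ t ∉ F`. -/
structure IsStrongComplexFamily {B : Type u} [NonUnitalCStarAlgebra B] (h : Γ → B) : Prop extends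
    IsComplexFamily F h where
  prod : ∀ s t, s⁻¹ * t ∉ F → ∀ l : List Γ, h s * l.foldr (fun a x => h a * x) (h t) = 0

variable {F}

theorem IsComplexFamily.norm_le {B : Type u} [NonUnitalCStarAlgebra B] {h : Γ → B}
    (hh : IsComplexFamily F h) (s : Γ) : ‖h s‖ ≤ 1 := by
  let _ := spectralOrder B
  have _ := spectralOrderedRing B
  have h0 (t : Γ) : 0 ≤ h t := by
    obtain ⟨b, hb⟩ := hh.pos t
    exact hb ▸ star_mul_self_nonneg b
  have hsa : star (h s) = h s := (IsSelfAdjoint.of_nonneg (h0 s)).star_eq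
  have h1 (t : Γ) : 0 ≤ h s * h t * h s := by
    simpa [hsa] using star_left_conjugate_nonneg (h0 t) (h s)
  have h2 : ‖h s * h s‖ = ‖h s‖ * ‖h s‖ := by
    simpa [hsa] using CStarRing.norm_star_mul_self (x := h s)
  by_cases hF : (1 : Γ) ∈ F
  · have h3 : ∑ f ∈ F, h s * h (s * f⁻¹) * h s = h s * h s := by
      conv_rhs => rw [← hh.sum s, Finset.mul_sum]
      exact Finset.sum_congr rfl fun f _ => by rw [hh.sum s, mul_assoc]
    have h4 : h s * h s * h s ≤ h s * h s := by
      have := Finset.single_le_sum (f := fun f => h s * h (s * f⁻¹) * h s)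
        (fun f _ => h1 _) hF
      simpa only [inv_one, mul_one, h3] using this
    have h5 : ‖h s * h s * h s‖ ≤ ‖h s‖ * ‖h s‖ :=
      (norm_le_norm_of_nonneg_of_le (h1 s) h4).trans_eq h2
    have h6 : ‖h s‖ * ‖h s‖ * (‖h s‖ * ‖h s‖) ≤ ‖h s * h s * h s‖ * ‖h s‖ := by
      have h7 : star (h s * h s) * (h s * h s) = h s * h s * h s * h s := by
        simp [hsa, mul_assoc]
      rw [← h2, ← CStarRing.norm_star_mul_self, h7]
      exact norm_mul_le _ _
    by_contra! hlt
    have h8 : 0 < ‖h s‖ * ‖h s‖ * ‖h s‖ := by positivity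
    nlinarith [mul_le_mul_of_nonneg_right h5 (norm_nonneg (h s))]
  · have h3 := hh.orth s s (by simpa using hF)
    rw [h3, norm_zero] at h2
    nlinarith [norm_nonneg (h s)]

theorem IsComplexFamily.translate {B : Type u} [NonUnitalCStarAlgebra B] {h : Γ → B}
    (hh : IsComplexFamily F h) (g : Γ) : IsComplexFamily F (h ∘ (g * ·)) where
  pos s := hh.pos _
  orth s t hst := hh.orth _ _ (by simpa [mul_assoc] using hst)
  sum t := by simpa [mul_assoc] using hh.sum (g * t)

theorem IsStrongComplexFamily.translate {B : Type u} [NonUnitalCStarAlgebra B] {h : Γ → B}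
    (hh : IsStrongComplexFamily F h) (g : Γ) : IsStrongComplexFamily F (h ∘ (g * ·)) where
  toIsComplexFamily := hh.toIsComplexFamily.translate g
  prod s t hst l := by
    have := hh.prod (g * s) (g * t) (by simpa [mul_assoc] using hst) (l.map (g * ·))
    rwa [List.foldr_map] at this

variable (F)

/-- The universal C*-algebra with generators `h_s`, `s ∈ Γ`. -/
abbrev ComplexAlg : Type u :=
  CStarGen (RepClass.ofRelations (X := Γ) (fun h => IsComplexFamily F h)
    fun s => ⟨1, fun _ _ _ hh => hh.norm_le s⟩)

/-- The quotient of this algebra by the additional relations. -/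
abbrev StrongComplexAlg : Type u :=
  CStarGen (RepClass.ofRelations (X := Γ) (fun h => IsStrongComplexFamily F h)
    fun s => ⟨1, fun _ _ _ hh => hh.norm_le s⟩)

/-- The action of `Γ` by `g • h_s = h_{gs}`. -/
def ComplexAlg.action : CStarAction Γ (ComplexAlg F) where
  act g := CStarGen.relabelRelations (g * ·) fun _ _ _ hf => hf.translate g
  act_one := CStarGen.hom_ext fun s => by simp [CStarGen.relabelRelations_gen]
  act_mul g k := CStarGen.hom_ext fun s => by simp [CStarGen.relabelRelations_gen, mul_assoc]

/-- The action of `Γ` by `g • h_s = h_{gs}`. -/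
def StrongComplexAlg.action : CStarAction Γ (StrongComplexAlg F) where
  act g := CStarGen.relabelRelations (g * ·) fun _ _ _ hf => hf.translate g
  act_one := CStarGen.hom_ext fun s => by simp [CStarGen.relabelRelations_gen]
  act_mul g k := CStarGen.hom_ext fun s => by simp [CStarGen.relabelRelations_gen, mul_assoc]

end Complex

end

noncomputable section

open UniformSpace CStarAlgebra
open scoped TensorProduct

/-! ### Generating families -/

namespace StarTerm

variable {X : Type u} {A : Type v} {B : Type w} [NonUnitalCStarAlgebra A] [NonUnitalCStarAlgebra B]

/-! Let `C` be a crossed product of the algebra of the `h_s` by `Γ`, and let `b` be a selfadjoint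
square root of `h_1`. The elements `b u_s b = b (s·b) u_s` of `C` satisfy the relations of the
`p_s`: cancelling roots in `h_1 h_s = 0` gives `b (s·b) = 0` for `s ∉ F`, the product of the
elements at `s` and `s⁻¹t` is `b h_s (t·b) u_t`, and `∑_{s ∈ F} h_s` acts as a unit on `b`. They
generate exactly the closure of `b C b`, and this corner is full
(`EquivariantComplex.range_eq_corner`, `EquivariantComplex.mem_of_corner_mem`). A linking algebra
inside `M₂(C)` then gives the equivariant Morita equivalence (`dualMoritaEquivalent_of_corner`),
once the homomorphism `p_s ↦ b u_s b` is known to be injective.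

Injectivity comes from a dilation. If operators `π_s` on `H` satisfy the relations of the `p_s`,
then `e = ∑ π_s ⊗ r_s`, with right translations `r_s`, is a projection on `ℓ²(Γ, H)` which commutes
with the left translations `l_s`. The compressions by `e` of the coordinate projections satisfy the
relations of the `h_s` and are permuted by the `l_s`. If `c` is `e` restricted to the summand at
`1`, these compressions are `l_s c c* l_s*`, while `c* l_s c` is `π_s` placed on that summand
(`projDilation`, `star_dilationOp_mul`). So there is a covariant representation `(ρ, l)` with `ρ(b)²
= c c*`, and polynomials in the `c* l_s c` and in the `ρ(b) l_s ρ(b)` have equal norms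
(`norm_eval_compression`). Hence the crossed product sees the norm of every representation of the
`p_s`.

For the reduced algebras the same dilation is tensored with `λ`; untwisting by `l` turns it into a
regular representation of the crossed product (`ProjDilation.norm_eval_le_red`). The opposite
estimate restricts `x ⊗ λ_s` to the diagonal of `Γ × Γ` (`norm_eval_red_le_tmul`).

In the strong case words in the `p_s` have degrees in the finite set `F` or vanish. Summing finitely
many coordinates therefore recovers `a` from `δ a`, so `δ` is injective
(`IsStrongProjFamily.injective_of_isHomogeneous`), and the corner embeds already in the reduced
crossed product. An ideal which meets a full corner trivially is zero, so the full and the reduced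
crossed product coincide. -/

theorem map_eval {Φ : Type*} [FunLike Φ A B] [NonUnitalAlgHomClass Φ ℂ A B] [StarHomClass Φ A B]
    (φ : Φ) (g : X → A) (q : StarTerm X) : φ (q.eval g) = q.eval (fun x => φ (g x)) := by
  induction q with
  | zero => exact map_zero φ
  | gen x => rfl
  | add p q hp hq => simp only [eval, map_add, hp, hq]
  | smul c p hp => simp only [eval, map_smul, hp]
  | mul p q hp hq => simp only [eval, map_mul, hp, hq]
  | star p hp => simp only [eval, map_star, hp]

theorem range_eval (g : X → A) :
    Set.range (fun q : StarTerm X => q.eval g) = NonUnitalStarAlgebra.adjoin ℂ (Set.range g) := by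
  apply Set.Subset.antisymm
  · rintro _ ⟨q, rfl⟩
    induction q with
    | zero => exact zero_mem _
    | gen x => exact NonUnitalStarAlgebra.subset_adjoin ℂ _ ⟨x, rfl⟩
    | add p q hp hq => exact add_mem hp hq
    | smul c p hp => exact SMulMemClass.smul_mem c hp
    | mul p q hp hq => exact mul_mem hp hq
    | star p hp => exact star_mem hp
  · intro a ha
    induction ha using NonUnitalStarAlgebra.adjoin_induction with
    | mem x hx =>
      obtain ⟨y, rfl⟩ := hx
      exact ⟨.gen y, rfl⟩
    | zero => exact ⟨.zero, rfl⟩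
    | add x y _ _ hx hy =>
      obtain ⟨p, rfl⟩ := hx
      obtain ⟨q, rfl⟩ := hy
      exact ⟨.add p q, rfl⟩
    | smul c x _ hx =>
      obtain ⟨p, rfl⟩ := hx
      exact ⟨.smul c p, rfl⟩
    | mul x y _ _ hx hy =>
      obtain ⟨p, rfl⟩ := hx
      obtain ⟨q, rfl⟩ := hy
      exact ⟨.mul p q, rfl⟩
    | star x _ hx =>
      obtain ⟨p, rfl⟩ := hx
      exact ⟨.star p, rfl⟩

end StarTerm

/-- The family `g` generates `A` as a C*-algebra. -/
def Generates {X : Type u} {A : Type v} [NonUnitalCStarAlgebra A] (g : X → A) : Prop :=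
  DenseRange fun q : StarTerm X => q.eval g

namespace Generates

variable {X : Type u} {A : Type v} {B : Type w} [NonUnitalCStarAlgebra A] [NonUnitalCStarAlgebra B]
  {g : X → A}

/-- A closed *-subalgebra which contains generators is everything. -/
theorem mem (hg : Generates g) (S : NonUnitalStarSubalgebra ℂ A) (hS : IsClosed (S : Set A))
    (h : ∀ x, g x ∈ S) (a : A) : a ∈ S := by
  have h1 : Set.range (fun q : StarTerm X => q.eval g) ⊆ S := by
    rw [StarTerm.range_eval]
    exact NonUnitalStarAlgebra.adjoin_le (by rintro _ ⟨x, rfl⟩; exact h x)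
  exact hS.closure_subset_iff.mpr h1 (hg a)

theorem of_cstarAdjoin (h : cstarAdjoin (Set.range g) = ⊤) : Generates g := by
  intro a
  have h1 : a ∈ cstarAdjoin (Set.range g) := h ▸ NonUnitalStarAlgebra.mem_top
  change a ∈ closure _
  rw [StarTerm.range_eval]
  exact h1

theorem cstarAdjoin_eq_top (hg : Generates g) : cstarAdjoin (Set.range g) = ⊤ :=
  NonUnitalStarAlgebra.eq_top_iff.mpr fun a => hg.mem _
    (NonUnitalStarSubalgebra.isClosed_topologicalClosure _)
    (fun x => subset_cstarAdjoin _ (Set.mem_range_self x)) a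

/-- Generators of `A` map to generators of a closed subalgebra. -/
theorem of_forall_mem {Y : Type*} {g' : Y → A} (hg : Generates g)
    (h : ∀ x, g x ∈ cstarAdjoin (Set.range g')) : Generates g' :=
  of_cstarAdjoin <| NonUnitalStarAlgebra.eq_top_iff.mpr fun a => hg.mem _
    (NonUnitalStarSubalgebra.isClosed_topologicalClosure _) h a

/-- The generators of a subalgebra of the form `cstarAdjoin`. -/
theorem subtype (g : X → A) :
    Generates (fun x => (⟨g x, subset_cstarAdjoin (Set.range g) ⟨x, rfl⟩⟩ :
      cstarAdjoin (Set.range g))) := by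
  intro a
  have h1 : (a : A) ∈ closure (Set.range fun q : StarTerm X => q.eval g) := by
    rw [StarTerm.range_eval]
    exact a.2
  rw [closure_subtype]
  convert h1 using 1
  rw [← Set.range_comp]
  congr 2
  funext q
  exact StarTerm.map_eval (NonUnitalStarSubalgebraClass.subtype (cstarAdjoin (Set.range g))) _ q

theorem hom_ext (hg : Generates g) {φ ψ : A →⋆ₙₐ[ℂ] B} (h : ∀ x, φ (g x) = ψ (g x)) : φ = ψ := by
  ext a
  refine congrFun (hg.equalizer (map_continuous φ) (map_continuous ψ) (funext fun q => ?_)) a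
  simp only [Function.comp_apply, StarTerm.map_eval, h]

/-- Homomorphisms of C*-algebras are contractive, so a lower bound on the dense *-algebra of
polynomials already forces an isometry. -/
theorem norm_map_of_norm_eval (hg : Generates g) (φ : A →⋆ₙₐ[ℂ] B)
    (h : ∀ q : StarTerm X, ‖q.eval g‖ ≤ ‖q.eval fun x => φ (g x)‖) (a : A) : ‖φ a‖ = ‖a‖ := by
  refine congrFun (DenseRange.equalizer hg (g := fun a => ‖φ a‖) (h := fun a => ‖a‖)
    (map_continuous φ).norm continuous_norm (funext fun q => ?_)) a
  refine le_antisymm (NonUnitalStarAlgHom.norm_apply_le φ _) ?_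
  simp only [Function.comp_apply, StarTerm.map_eval]
  exact h q

theorem injective_of_norm_eval (hg : Generates g) (φ : A →⋆ₙₐ[ℂ] B)
    (h : ∀ q : StarTerm X, ‖q.eval g‖ ≤ ‖q.eval fun x => φ (g x)‖) : Function.Injective φ :=
  (AddMonoidHomClass.isometry_of_norm φ (hg.norm_map_of_norm_eval φ h)).injective

/-- The range of a *-homomorphism is closed. -/
theorem _root_.NonUnitalStarAlgHom.isClosed_range_of_injective (φ : A →⋆ₙₐ[ℂ] B)
    (hφ : Function.Injective φ) : IsClosed (Set.range φ) :=
  (NonUnitalStarAlgHom.isometry φ hφ).isClosedEmbedding.isClosed_range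

/-- The image of an injective *-homomorphism is generated by the image of generators. -/
theorem range_eq (hg : Generates g) (φ : A →⋆ₙₐ[ℂ] B) (hφ : Function.Injective φ) :
    Set.range φ = cstarAdjoin (Set.range fun x => φ (g x)) := by
  apply Set.Subset.antisymm
  · rintro _ ⟨a, rfl⟩
    exact hg.mem ((cstarAdjoin (Set.range fun x => φ (g x))).comap φ)
      ((NonUnitalStarSubalgebra.isClosed_topologicalClosure _).preimage (map_continuous φ))
      (fun x => subset_cstarAdjoin _ ⟨x, rfl⟩) a
  · have h1 : IsClosed (NonUnitalStarAlgHom.range φ : Set B) := by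
      rw [NonUnitalStarAlgHom.coe_range]
      exact φ.isClosed_range_of_injective hφ
    have h2 : cstarAdjoin (Set.range fun x => φ (g x)) ≤ NonUnitalStarAlgHom.range φ :=
      NonUnitalStarSubalgebra.topologicalClosure_minimal _
        (NonUnitalStarAlgebra.adjoin_le (by rintro _ ⟨x, rfl⟩; exact ⟨g x, rfl⟩)) h1
    intro b hb
    have := h2 hb
    exact NonUnitalStarAlgHom.coe_range φ ▸ this

/-- A family dominated by generators is the image of the generators under a *-homomorphism. -/
theorem exists_hom (hg : Generates g) (f : X → B)
    (h : ∀ q : StarTerm X, ‖q.eval f‖ ≤ ‖q.eval g‖) :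
    ∃ φ : A →⋆ₙₐ[ℂ] B, ∀ x, φ (g x) = f x := by
  -- The homomorphism is constructed from its closed graph `G` in `A × B`. The norm of the product
  -- is a maximum, so domination makes the projection to `A` isometric; its range is closed and
  -- contains the generators, so it can be inverted.
  let G := cstarAdjoin (Set.range fun x => (g x, f x))
  let i := NonUnitalStarSubalgebraClass.subtype G
  let p₁ : G →⋆ₙₐ[ℂ] A := (NonUnitalStarAlgHom.fst ℂ A B).comp i
  let p₂ : G →⋆ₙₐ[ℂ] B := (NonUnitalStarAlgHom.snd ℂ A B).comp i
  have hG := Generates.subtype (fun x => (g x, f x))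
  have h1 : Function.Injective p₁ := by
    refine hG.injective_of_norm_eval p₁ fun q => ?_
    change ‖i (q.eval _)‖ ≤ ‖q.eval g‖
    rw [StarTerm.map_eval, Prod.norm_def]
    refine max_le (le_of_eq (congrArg norm ?_)) ((le_of_eq (congrArg norm ?_)).trans (h q))
    · exact StarTerm.map_eval (NonUnitalStarAlgHom.fst ℂ A B) _ q
    · exact StarTerm.map_eval (NonUnitalStarAlgHom.snd ℂ A B) _ q
  have h2 : Function.Surjective p₁ := by
    intro a
    have := hg.cstarAdjoin_eq_top
    have h3 := hG.range_eq p₁ h1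
    have h4 : a ∈ Set.range p₁ := by
      rw [h3]
      exact (hg.cstarAdjoin_eq_top ▸ NonUnitalStarAlgebra.mem_top : a ∈ cstarAdjoin (Set.range g))
    exact h4
  let e := StarAlgEquiv.ofBijective p₁ ⟨h1, h2⟩
  refine ⟨p₂.comp (e.symm : A →⋆ₙₐ[ℂ] G), fun x => ?_⟩
  have h5 : e ⟨(g x, f x), subset_cstarAdjoin _ ⟨x, rfl⟩⟩ = g x := rfl
  change p₂ (e.symm (g x)) = f x
  rw [← h5, e.symm_apply_apply]
  rfl

end Generates

/-! ### The C*-algebra generated by a class of families -/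

namespace CStarGen

variable {X : Type u} (R : RepClass.{u} X)

theorem eval_gen (q : StarTerm X) : q.eval (gen R) = ofPoly R (RepClass.Poly.mk R q) := by
  induction q with
  | zero => exact (map_zero (ofPoly R)).symm
  | gen x => rfl
  | add p q hp hq => exact (congrArg₂ (· + ·) hp hq).trans (map_add (ofPoly R) _ _).symm
  | smul c p hp => exact (congrArg (c • ·) hp).trans (map_smul (ofPoly R) _ _).symm
  | mul p q hp hq => exact (congrArg₂ (· * ·) hp hq).trans (map_mul (ofPoly R) _ _).symm
  | star p hp => exact (congrArg star hp).trans (map_star (ofPoly R) _).symm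

theorem generates_gen : Generates (gen R) := by
  have h : (fun q : StarTerm X => q.eval (gen R)) = ofPoly R ∘ RepClass.Poly.mk R :=
    funext (eval_gen R)
  rw [Generates, h]
  exact denseRange_ofPoly.comp RepClass.Poly.mk_surjective.denseRange 
    (AddMonoidHomClass.isometry_of_norm (ofPoly R) norm_ofPoly).continuous

theorem norm_eval_val_le (i : R.ι) (q : StarTerm X) : ‖q.eval (R.val i)‖ ≤ ‖q.eval (gen R)‖ := by
  rw [eval_gen, norm_ofPoly]
  exact RepClass.Poly.norm_ev_le i (RepClass.Poly.mk R q)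

theorem norm_eval_gen_le {q : StarTerm X} {C : ℝ} (hC : 0 ≤ C)
    (h : ∀ i, ‖q.eval (R.val i)‖ ≤ C) : ‖q.eval (gen R)‖ ≤ C := by
  rw [eval_gen, norm_ofPoly]
  exact RepClass.Poly.norm_le hC h

/-- The evaluation at the `i`-th family of the class. -/
def evalHom (i : R.ι) : CStarGen R →⋆ₙₐ[ℂ] R.alg i :=
  ((generates_gen R).exists_hom (R.val i) (norm_eval_val_le R i)).choose

@[simp] theorem evalHom_gen (i : R.ι) (x : X) : evalHom R i (gen R x) = R.val i x :=
  ((generates_gen R).exists_hom (R.val i) (norm_eval_val_le R i)).choose_spec x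

theorem evalHom_eval (i : R.ι) (q : StarTerm X) :
    evalHom R i (q.eval (gen R)) = q.eval (R.val i) := by
  rw [StarTerm.map_eval]
  simp

/-- On polynomials the norm is by definition a supremum over the evaluations. An approximation by
polynomials carries the joint injectivity over to the completion. -/
theorem eq_zero_of_evalHom {a : CStarGen R} (h : ∀ i, evalHom R i a = 0) : a = 0 := by
  refine norm_le_zero_iff.mp (le_of_forall_pos_le_add fun ε hε => ?_)
  obtain ⟨q, hq⟩ := (generates_gen R).exists_dist_lt a (half_pos hε)
  rw [dist_eq_norm] at hq
  have h1 : ‖q.eval (gen R)‖ ≤ ε / 2 := norm_eval_gen_le R (half_pos hε).le fun i => by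
    have h2 := NonUnitalStarAlgHom.norm_apply_le (evalHom R i) (a - q.eval (gen R))
    rw [map_sub, h, zero_sub, norm_neg, evalHom_eval] at h2
    exact h2.trans hq.le
  calc ‖a‖ ≤ ‖a - q.eval (gen R)‖ + ‖q.eval (gen R)‖ := norm_le_norm_sub_add _ _
    _ ≤ 0 + ε := by linarith

end CStarGen

section Relations

variable {X : Type u} {rel : ∀ {B : Type u} [NonUnitalCStarAlgebra B], (X → B) → Prop}
  {bound : ∀ x, ∃ C : ℝ, ∀ (B : Type u) [NonUnitalCStarAlgebra B] (f : X → B),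
      rel f → ‖f x‖ ≤ C}

/-- The universal property of a C*-algebra defined by generators and relations. -/
theorem CStarGen.exists_hom_of_relations {B : Type u} [NonUnitalCStarAlgebra B] (f : X → B)
    (hf : rel f) : ∃ φ : CStarGen (RepClass.ofRelations rel bound) →⋆ₙₐ[ℂ] B,
      ∀ x, φ (gen _ x) = f x :=
  ⟨evalHom (RepClass.ofRelations rel bound) (⟨B, f, hf⟩ : RelFamily rel), fun x =>
    evalHom_gen (RepClass.ofRelations rel bound) (⟨B, f, hf⟩ : RelFamily rel) x⟩

end Relations

section

/-! ### Representations on Hilbert spaces separate points -/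

section Separation

open scoped ComplexOrder ComplexStarModule

/-- The complex-linear extension of a real functional on the selfadjoint elements. -/
def complexExtension {A : Type v} [NonUnitalCStarAlgebra A] (f : StrongDual ℝ A) : A →ₗ[ℂ] ℂ where
  toFun x := f (realPart x : A) + Complex.I * f (imaginaryPart x : A)
  map_add' x y := by
    simp only [map_add, AddSubgroup.coe_add, Complex.ofReal_add]
    ring
  map_smul' c x := by
    simp only [realPart_smul, imaginaryPart_smul, AddSubgroup.coe_sub, AddSubgroup.coe_add,
      selfAdjoint.val_smul, map_sub, map_add, map_smul, smul_eq_mul, RingHom.id_apply]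
    push_cast
    apply Complex.ext <;> simp

theorem complexExtension_of_isSelfAdjoint {A : Type v} [NonUnitalCStarAlgebra A]
    (f : StrongDual ℝ A) {x : A} (hx : IsSelfAdjoint x) : complexExtension f x = f x := by
  simp [complexExtension, hx.coe_realPart, imaginaryPart_eq_zero_iff.mpr hx]

/-- **Gelfand–Naimark**: the representations of a C*-algebra on Hilbert spaces separate points. -/
theorem HilbRep.exists_apply_ne_zero {A : Type u} [NonUnitalCStarAlgebra A] {a : A} (ha : a ≠ 0) :
    ∃ π : HilbRep A, π.hom a ≠ 0 := by
  let _ := spectralOrder A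
  have _ := spectralOrderedRing A
  let C : ProperCone ℝ A :=
    { carrier := {x | 0 ≤ x}
      add_mem' := fun {x y} hx hy => add_nonneg (show 0 ≤ x from hx) (show 0 ≤ y from hy)
      zero_mem' := le_refl (0 : A)
      smul_mem' := fun c x hx => smul_nonneg c.2 (show 0 ≤ x from hx)
      isClosed' := CStarAlgebra.isClosed_nonneg }
  let b := a * star a
  have hb : IsSelfAdjoint b := .mul_star_self a
  have hb0 : b ≠ 0 := fun h => ha (CStarRing.mul_star_self_eq_zero_iff a |>.mp h)
  have hbb : 0 ≤ b * b := by simpa [hb.star_eq] using mul_star_self_nonneg b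
  have hbb0 : b * b ≠ 0 := by
    have := (CStarRing.mul_star_self_eq_zero_iff b).not.mpr hb0
    rwa [hb.star_eq] at this
  -- Hahn–Banach separation of `-b²` from the closed positive cone gives a positive functional with
  -- `f (b²) > 0`.
  have hC : -(b * b) ∉ C := fun h => hbb0 (le_antisymm (neg_nonneg.mp h) hbb)
  obtain ⟨f, hf, hfb⟩ := C.hyperplane_separation_point hC
  have hpos (x : A) (hx : 0 ≤ x) : 0 ≤ complexExtension f x := by
    rw [complexExtension_of_isSelfAdjoint f (IsSelfAdjoint.of_nonneg hx)]
    exact_mod_cast hf x hx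
  let φ : A →ₚ[ℂ] ℂ := PositiveLinearMap.mk₀ (complexExtension f) hpos
  refine ⟨⟨φ.GNS, φ.gnsNonUnitalStarAlgHom⟩, fun h => ?_⟩
  -- The class of `a*` serves as test vector, so no cyclic vector is needed: the squared norm of its
  -- image under `a` is `f ((a a*)²) = f (b²)`.
  have h1 : φ.gnsNonUnitalStarAlgHom a (φ.toPreGNS (star a) : φ.GNS) = 0 :=
    congrArg (fun T : φ.GNS →L[ℂ] φ.GNS => T _) h
  rw [PositiveLinearMap.gnsNonUnitalStarAlgHom_apply_coe, ← norm_eq_zero, Completion.norm_coe] at h1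
  have h2 := φ.preGNS_norm_sq (φ.leftMulMapPreGNS a (φ.toPreGNS (star a)))
  rw [h1] at h2
  have h3 : φ (b * b) = f (b * b) :=
    complexExtension_of_isSelfAdjoint f (IsSelfAdjoint.of_nonneg hbb)
  simp only [PositiveLinearMap.leftMulMapPreGNS_apply, PositiveLinearMap.ofPreGNS_toPreGNS,
    star_mul, star_star] at h2
  rw [h3] at h2
  have h4 : f (b * b) = 0 := by exact_mod_cast (by simpa using h2.symm : (f (b * b) : ℂ) = 0)
  rw [map_neg, h4] at hfb
  simp at hfb

end Separation

open scoped ENNReal in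
/-- The norm of `a` is bounded by the norms of the images under jointly injective homomorphisms. -/
theorem norm_le_of_jointly_injective {A : Type v} [NonUnitalCStarAlgebra A] {J : Type*}
    {B : J → Type w} [∀ j, NonUnitalCStarAlgebra (B j)] (φ : ∀ j, A →⋆ₙₐ[ℂ] B j)
    (hφ : ∀ a, (∀ j, φ j a = 0) → a = 0) {a : A} {C : ℝ} (hC : 0 ≤ C) (h : ∀ j, ‖φ j a‖ ≤ C) :
    ‖a‖ ≤ C := by
  have hmem (a : A) : Memℓp (fun j => φ j a) ∞ :=
    memℓp_infty ⟨‖a‖, by rintro _ ⟨j, rfl⟩; exact NonUnitalStarAlgHom.norm_apply_le (φ j) a⟩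
  -- Injective homomorphisms are isometric; applied to the `ℓ^∞`-product of the `φ j`, this turns
  -- joint injectivity into a norm estimate.
  let Φ : A →⋆ₙₐ[ℂ] lp B ∞ :=
    { toFun := fun a => ⟨fun j => φ j a, hmem a⟩
      map_smul' := fun c a => lp.ext (funext fun j => map_smul (φ j) c a)
      map_zero' := lp.ext (funext fun j => map_zero (φ j))
      map_add' := fun a b => lp.ext (funext fun j => map_add (φ j) a b)
      map_mul' := fun a b => lp.ext (funext fun j => map_mul (φ j) a b)
      map_star' := fun a => lp.ext (funext fun j => map_star (φ j) a) }
  have hΦ : Function.Injective Φ := by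
    refine (injective_iff_map_eq_zero Φ).mpr fun a ha => hφ a fun j => ?_
    have : (Φ a : ∀ j, B j) j = (0 : lp B ∞) j := by rw [ha]
    exact this
  rw [← NonUnitalStarAlgHom.norm_map Φ hΦ a]
  exact lp.norm_le_of_forall_le hC h

/-! ### Elementary facts on C*-algebras -/

section Elementary

variable {A : Type v} [NonUnitalCStarAlgebra A]

/-- The square root of a positive element. -/
theorem exists_selfAdjoint_mul_self_eq {h : A} (hh : ∃ b, h = star b * b) :
    ∃ c : A, star c = c ∧ c * c = h := by
  let _ := spectralOrder A
  have _ := spectralOrderedRing A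
  obtain ⟨b, rfl⟩ := hh
  exact ⟨CFC.sqrt (star b * b), (IsSelfAdjoint.of_nonneg (CFC.sqrt_nonneg _)).star_eq,
    CFC.sqrt_mul_sqrt_self _ (star_mul_self_nonneg b)⟩

theorem star_mul_self_cancel {a : A} (h : star a * a = 0) : a = 0 :=
  (CStarRing.star_mul_self_eq_zero_iff a).mp h

theorem mul_star_self_cancel {a : A} (h : a * star a = 0) : a = 0 :=
  (CStarRing.mul_star_self_eq_zero_iff a).mp h

theorem eq_zero_of_forall_mul_mul {a : A} (h : ∀ x y, x * a * y = 0) : a = 0 := by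
  refine star_mul_self_cancel (star_mul_self_cancel ?_)
  rw [star_mul, star_star]
  exact h (star a) (star a * a)

/-- Every element is a limit of multiples of itself. -/
theorem mem_closure_mul (a : A) {S : Submodule ℂ A} (hS : IsClosed (S : Set A))
    (h : ∀ x, a * x ∈ S) : a ∈ S := by
  let _ := spectralOrder A
  have _ := spectralOrderedRing A
  have h1 := (increasingApproximateUnit A).tendsto_mul_left a
  exact hS.mem_of_tendsto h1 (.of_forall h)

end Elementary

end

/-! ### Intertwiners -/

/-- The condition on adjoints makes the range of `V` reducing, so `V` intertwines all *-polynomials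
and `S` becomes a subrepresentation of `T`. All comparisons between concrete operators on
`ℓ²`-spaces are made in this way. -/
theorem norm_eval_le_of_intertwine {X : Type u} {H : Type v} {K : Type w} [NormedAddCommGroup H]
    [InnerProductSpace ℂ H] [CompleteSpace H] [NormedAddCommGroup K] [InnerProductSpace ℂ K]
    [CompleteSpace K] (V : H →ₗᵢ[ℂ] K) {S : X → H →L[ℂ] H} {T : X → K →L[ℂ] K}
    (h : ∀ x ξ, T x (V ξ) = V (S x ξ)) (h' : ∀ x ξ, star (T x) (V ξ) = V (star (S x) ξ))
    (q : StarTerm X) : ‖q.eval S‖ ≤ ‖q.eval T‖ := by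
  have key (q : StarTerm X) : (∀ ξ, q.eval T (V ξ) = V (q.eval S ξ)) ∧
      ∀ ξ, star (q.eval T) (V ξ) = V (star (q.eval S) ξ) := by
    induction q with
    | zero => simp [StarTerm.eval]
    | gen x => exact ⟨h x, h' x⟩
    | add p q hp hq =>
      exact ⟨fun ξ => by simp [StarTerm.eval, hp.1, hq.1],
        fun ξ => by simp only [StarTerm.eval, star_add, add_apply, hp.2, hq.2, map_add]⟩
    | smul c p hp =>
      exact ⟨fun ξ => by simp [StarTerm.eval, hp.1],
        fun ξ => by simp only [StarTerm.eval, star_smul, smul_apply, hp.2, map_smul]⟩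
    | mul p q hp hq =>
      exact ⟨fun ξ => by simp [StarTerm.eval, hp.1, hq.1],
        fun ξ => by simp only [StarTerm.eval, star_mul, mul_apply_eq_comp, hp.2, hq.2]⟩
    | star p hp => exact ⟨hp.2, fun ξ => by simp only [StarTerm.eval, star_star, hp.1]⟩
  refine ContinuousLinearMap.opNorm_le_bound _ (norm_nonneg _) fun ξ => ?_
  rw [← V.norm_map, ← (key q).1, ← V.norm_map ξ]
  exact ContinuousLinearMap.le_opNorm _ _

/-! ### Operators on `ℓ²(Γ, H)` -/

section Regular

variable {Γ : Type u} [Group Γ] {H : Type v} [NormedAddCommGroup H] [InnerProductSpace ℂ H]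

theorem diagTranslate_mul (T T' : Γ → H →L[ℂ] H) {C C' D : ℝ} (hT : ∀ t, ‖T t‖ ≤ C)
    (hT' : ∀ t, ‖T' t‖ ≤ C') (s s' : Γ) (h : ∀ t, ‖T t * T' (s⁻¹ * t)‖ ≤ D) :
    diagTranslate T C hT s * diagTranslate T' C' hT' s' =
      diagTranslate (fun t => T t * T' (s⁻¹ * t)) D h (s * s') := by
  ext ξ t
  simp [diagTranslate_apply, mul_assoc]

theorem star_diagTranslate [CompleteSpace H] (T : Γ → H →L[ℂ] H) {C : ℝ} (hT : ∀ t, ‖T t‖ ≤ C)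
    (s : Γ) : star (diagTranslate T C hT s) =
      diagTranslate (fun t => star (T (s * t))) C (fun t => by rw [norm_star]; exact hT _) s⁻¹ := by
  rw [ContinuousLinearMap.star_eq_adjoint]
  symm
  rw [ContinuousLinearMap.eq_adjoint_iff]
  intro ξ η
  rw [lp.inner_eq_tsum, lp.inner_eq_tsum, ← (Equiv.mulLeft s⁻¹).tsum_eq]
  refine tsum_congr fun t => ?_
  simp [diagTranslate_apply, ContinuousLinearMap.star_eq_adjoint,
    ContinuousLinearMap.adjoint_inner_left]

/-- The diagonal isometry `ξ ↦ ∑ δ_t ⊗ ξ(t)`. -/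
def diagonalIsometry [DecidableEq Γ] :
    lp (fun _ : Γ => H) 2 →ₗᵢ[ℂ] lp (fun _ : Γ => lp (fun _ : Γ => H) 2) 2 :=
  have hmem (ξ : lp (fun _ : Γ => H) 2) :
      Memℓp (fun t => (lp.single 2 t (ξ t) : lp (fun _ : Γ => H) 2)) 2 := by
    refine memℓp_gen ?_
    have h := (lp.memℓp ξ).summable (by simp)
    refine h.congr fun t => ?_
    rw [lp.norm_single (by simp)]
  { toFun := fun ξ => ⟨fun t => lp.single 2 t (ξ t), hmem ξ⟩
    map_add' := fun ξ η => lp.ext (funext fun t => by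
      exact map_add (lp.singleAddMonoidHom (E := fun _ : Γ => H) 2 t) (ξ t) (η t))
    map_smul' := fun c ξ => lp.ext (funext fun t => by
      exact lp.single_smul (E := fun _ : Γ => H) 2 t c (ξ t))
    norm_map' := fun ξ => by
      have h : (0 : ℝ) < (2 : ENNReal).toReal := by simp
      rw [← Real.rpow_left_inj (norm_nonneg _) (norm_nonneg _) h.ne', lp.norm_rpow_eq_tsum h,
        lp.norm_rpow_eq_tsum h]
      refine tsum_congr fun t => ?_
      change ‖(lp.single 2 t (ξ t) : lp (fun _ : Γ => H) 2)‖ ^ _ = _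
      rw [lp.norm_single (by simp)] }

omit [Group Γ] in
theorem diagonalIsometry_apply [DecidableEq Γ] (ξ : lp (fun _ : Γ => H) 2) (t : Γ) :
    diagonalIsometry ξ t = lp.single 2 t (ξ t) := rfl

theorem diagTranslate_single [DecidableEq Γ] (T : Γ → H →L[ℂ] H) (C : ℝ) (hT : ∀ t, ‖T t‖ ≤ C)
    (s t : Γ) (ξ : H) :
    diagTranslate T C hT s (lp.single 2 (s⁻¹ * t) ξ) = lp.single 2 t (T t ξ) := by
  ext r
  rw [diagTranslate_apply]
  by_cases h : r = t
  · subst h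
    simp
  · rw [lp.single_apply_ne _ _ _ h, lp.single_apply_ne _ _ _ (by simpa using h), map_zero]

/-- Both legs of `(T λ_s) ⊗ λ_s` translate by the same `s`, so vectors supported on the diagonal of
`Γ × Γ` stay there, and on them the operator is `T λ_s`. -/
theorem diagTranslate_diagonalIsometry [DecidableEq Γ] (T : Γ → H →L[ℂ] H) (C D : ℝ)
    (hT : ∀ t, ‖T t‖ ≤ C) (s : Γ) (h : ∀ _ : Γ, ‖diagTranslate T C hT s‖ ≤ D)
    (ξ : lp (fun _ : Γ => H) 2) :
    diagTranslate (fun _ : Γ => diagTranslate T C hT s) D h s (diagonalIsometry ξ) =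
      diagonalIsometry (diagTranslate T C hT s ξ) := by
  ext t : 2
  rw [diagTranslate_apply, diagonalIsometry_apply, diagonalIsometry_apply, diagTranslate_single,
    diagTranslate_apply]

/-- Restriction to the diagonal. This is the inequality opposite to Fell absorption, and it bounds
the reduced crossed product by the tensor product with `λ`. -/
theorem norm_eval_diagTranslate_le {X : Type u} [CompleteSpace H] (T : X → Γ → H →L[ℂ] H)
    (C : X → ℝ) (hT : ∀ x t, ‖T x t‖ ≤ C x) (s : X → Γ) (D : X → ℝ)
    (h : ∀ x (_ : Γ), ‖diagTranslate (T x) (C x) (hT x) (s x)‖ ≤ D x) (q : StarTerm X) :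
    ‖q.eval fun x => diagTranslate (T x) (C x) (hT x) (s x)‖ ≤
      ‖q.eval fun x => diagTranslate (fun _ : Γ => diagTranslate (T x) (C x) (hT x) (s x))
        (D x) (h x) (s x)‖ := by
  classical
  refine norm_eval_le_of_intertwine diagonalIsometry
    (fun x ξ => diagTranslate_diagonalIsometry _ _ _ _ _ _ ξ) (fun x ξ => ?_) q
  rw [star_diagTranslate]
  simp only [star_diagTranslate]
  exact diagTranslate_diagonalIsometry _ _ _ _ _ _ ξ

/-- The amplification of an operator to `ℓ²(Γ, H)`. -/
def amplify (Γ : Type u) [Group Γ] (H : Type v) [NormedAddCommGroup H] [InnerProductSpace ℂ H]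
    [CompleteSpace H] :
    (H →L[ℂ] H) →⋆ₙₐ[ℂ] (lp (fun _ : Γ => H) 2 →L[ℂ] lp (fun _ : Γ => H) 2) where
  toFun T := diagTranslate (fun _ => T) ‖T‖ (fun _ => le_rfl) 1
  map_smul' c T := by ext; simp [diagTranslate_apply]
  map_zero' := by ext; simp [diagTranslate_apply]
  map_add' S T := by ext; simp [diagTranslate_apply]
  map_mul' S T := by ext; simp [diagTranslate_apply]
  map_star' T := by ext; simp [star_diagTranslate, diagTranslate_apply]

end Regular

/-! ### Reindexing of iterated `ℓ²`-sums -/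

section Reindex

variable {I : Type*} {J : Type*} {I' : Type*} {J' : Type*} {H : Type v} [NormedAddCommGroup H]
  [InnerProductSpace ℂ H]

theorem lp.summable_norm_sq {G : I → Type*} [∀ i, NormedAddCommGroup (G i)] (ξ : lp G 2) :
    Summable fun i => ‖ξ i‖ ^ 2 := by
  simpa using (lp.memℓp ξ).summable (by simp)

theorem lp.norm_sq_eq {G : I → Type*} [∀ i, NormedAddCommGroup (G i)] (ξ : lp G 2) :
    ‖ξ‖ ^ 2 = ∑' i, ‖ξ i‖ ^ 2 := by
  have := lp.norm_rpow_eq_tsum (p := 2) (by simp) ξ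
  simpa using this

omit [InnerProductSpace ℂ H] in
theorem lp.summable_prod (ξ : lp (fun _ : I => lp (fun _ : J => H) 2) 2) :
    Summable fun x : I × J => ‖ξ x.1 x.2‖ ^ 2 := by
  refine (summable_prod_of_nonneg fun x => by positivity).mpr ⟨fun i => ?_, ?_⟩
  · exact lp.summable_norm_sq (ξ i)
  · refine (lp.summable_norm_sq ξ).congr fun i => ?_
    exact lp.norm_sq_eq (ξ i)

/-- The isometry of iterated `ℓ²`-sums given by a bijection of the index sets. -/
def lp.reindex (e : I' × J' ≃ I × J) : lp (fun _ : I => lp (fun _ : J => H) 2) 2 →ₗᵢ[ℂ]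
    lp (fun _ : I' => lp (fun _ : J' => H) 2) 2 :=
  have hsum (ξ : lp (fun _ : I => lp (fun _ : J => H) 2) 2) :
      Summable fun x : I' × J' => ‖ξ (e x).1 (e x).2‖ ^ 2 :=
    e.summable_iff.mpr (lp.summable_prod ξ)
  have hmem (ξ : lp (fun _ : I => lp (fun _ : J => H) 2) 2) (i : I') :
      Memℓp (fun j => ξ (e (i, j)).1 (e (i, j)).2) 2 := by
    refine memℓp_gen ?_
    simpa using (hsum ξ).prod_factor i
  have hmem' (ξ : lp (fun _ : I => lp (fun _ : J => H) 2) 2) :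
      Memℓp (fun i => (⟨_, hmem ξ i⟩ : lp (fun _ : J' => H) 2)) 2 := by
    refine memℓp_gen ?_
    have := ((summable_prod_of_nonneg fun x => by positivity).mp (hsum ξ)).2
    simp only [ENNReal.toReal_ofNat, Real.rpow_ofNat]
    refine this.congr fun i => ?_
    exact (lp.norm_sq_eq (⟨_, hmem ξ i⟩ : lp (fun _ : J' => H) 2)).symm
  { toFun := fun ξ => ⟨fun i => ⟨fun j => ξ (e (i, j)).1 (e (i, j)).2, hmem ξ i⟩, hmem' ξ⟩
    map_add' := fun ξ η => rfl
    map_smul' := fun c ξ => rfl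
    norm_map' := fun ξ => by
      rw [← sq_eq_sq₀ (norm_nonneg _) (norm_nonneg _), lp.norm_sq_eq, lp.norm_sq_eq]
      have h1 (i : I') : ‖(⟨_, hmem ξ i⟩ : lp (fun _ : J' => H) 2)‖ ^ 2 =
          ∑' j, ‖ξ (e (i, j)).1 (e (i, j)).2‖ ^ 2 := lp.norm_sq_eq _
      have h2 (i : I) : ‖ξ i‖ ^ 2 = ∑' j, ‖ξ i j‖ ^ 2 := lp.norm_sq_eq _
      refine (tsum_congr h1).trans (Eq.trans ?_ (tsum_congr h2).symm)
      rw [← (hsum ξ).tsum_prod, ← (lp.summable_prod ξ).tsum_prod]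
      exact e.tsum_eq fun x : I × J => ‖ξ x.1 x.2‖ ^ 2 }

@[simp] theorem lp.reindex_apply (e : I' × J' ≃ I × J)
    (ξ : lp (fun _ : I => lp (fun _ : J => H) 2) 2) (i : I') (j : J') :
    lp.reindex e ξ i j = ξ (e (i, j)).1 (e (i, j)).2 := rfl

end Reindex

/-! ### Fell absorption -/

section Fell

variable {Γ : Type u} [Group Γ] {H : Type v} [NormedAddCommGroup H] [InnerProductSpace ℂ H]

/-- The shear `(t, r) ↦ (r t, r)`. -/
def shear (Γ : Type u) [Group Γ] : Γ × Γ ≃ Γ × Γ where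
  toFun x := (x.2 * x.1, x.2)
  invFun x := (x.2⁻¹ * x.1, x.2)
  left_inv x := by simp
  right_inv x := by simp

/-- After the shear the outer coordinate is `r⁻¹` times the old one, which a simultaneous left
translation does not change: the second leg of `(T λ_s) ⊗ λ_s` becomes trivial. The diagonal entries
depend on the inner coordinate `r` only, and the shear fixes it. -/
theorem diagTranslate_one_reindex_shear (T : Γ → H →L[ℂ] H) (C D D' : ℝ)
    (hT : ∀ t, ‖T t‖ ≤ C) (s : Γ) (h : ∀ _ : Γ, ‖diagTranslate T C hT s‖ ≤ D)
    (h' : ∀ _ : Γ, ‖diagTranslate T C hT s‖ ≤ D')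
    (ξ : lp (fun _ : Γ => lp (fun _ : Γ => H) 2) 2) :
    diagTranslate (fun _ : Γ => diagTranslate T C hT s) D h 1 (lp.reindex (shear Γ) ξ) =
      lp.reindex (shear Γ) (diagTranslate (fun _ : Γ => diagTranslate T C hT s) D' h' s ξ) := by
  ext t r
  simp [diagTranslate_apply, shear, mul_assoc]

/-- **Fell absorption** for operators of the form `T λ_s`, where `T` is diagonal. -/
theorem norm_eval_diagTranslate_diagTranslate_le {X : Type u} [CompleteSpace H]
    (T : X → Γ → H →L[ℂ] H) (C : X → ℝ) (hT : ∀ x t, ‖T x t‖ ≤ C x) (s : X → Γ) (D : X → ℝ)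
    (h : ∀ x (_ : Γ), ‖diagTranslate (T x) (C x) (hT x) (s x)‖ ≤ D x) (q : StarTerm X) :
    ‖q.eval fun x => diagTranslate (fun _ : Γ => diagTranslate (T x) (C x) (hT x) (s x))
        (D x) (h x) (s x)‖ ≤
      ‖q.eval fun x => diagTranslate (T x) (C x) (hT x) (s x)‖ := by
  have h1 := norm_eval_le_of_intertwine (lp.reindex (shear Γ))
    (S := fun x => diagTranslate (fun _ : Γ => diagTranslate (T x) (C x) (hT x) (s x))
        (D x) (h x) (s x))
    (T := fun x => amplify Γ (lp (fun _ : Γ => H) 2) (diagTranslate (T x) (C x) (hT x) (s x)))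
    (fun x ξ => diagTranslate_one_reindex_shear _ _ _ _ _ _ (fun _ => le_rfl) _ ξ) (fun x ξ => by
      rw [← map_star, star_diagTranslate]
      simp only [star_diagTranslate]
      exact diagTranslate_one_reindex_shear _ _ _ _ _ _ (fun _ => le_rfl) _ ξ) q
  refine h1.trans ?_
  rw [← StarTerm.map_eval (amplify Γ (lp (fun _ : Γ => H) 2))]
  exact NonUnitalStarAlgHom.norm_apply_le _ _

end Fell

/-! ### Operators on Hilbert space tensor products -/

section TensorOp

variable {H K : Type u} [NormedAddCommGroup H] [InnerProductSpace ℂ H]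
  [NormedAddCommGroup K] [InnerProductSpace ℂ K]

theorem tensorOp_coe (S : H →L[ℂ] H) (T : K →L[ℂ] K) (x : H ⊗[ℂ] K) :
    tensorOp S T (x : Completion (H ⊗[ℂ] K)) = (TensorProduct.mapL S T x : H ⊗[ℂ] K) := by
  rw [tensorOp, ContinuousLinearMap.completion_apply_coe]

theorem continuousLinearMap_completion_ext {E F : Type*} [NormedAddCommGroup E] [NormedSpace ℂ E]
    [NormedAddCommGroup F] [NormedSpace ℂ F] {S T : Completion E →L[ℂ] F}
    (h : ∀ x : E, S x = T x) : S = T := by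
  ext x
  induction x using Completion.induction_on with
  | hp => exact isClosed_eq (by fun_prop) (by fun_prop)
  | ih x => exact h x

theorem tensorOp_add_left (S S' : H →L[ℂ] H) (T : K →L[ℂ] K) :
    tensorOp (S + S') T = tensorOp S T + tensorOp S' T :=
  continuousLinearMap_completion_ext fun x => by
    simp [tensorOp_coe, TensorProduct.mapL_add_left, Completion.coe_add, -TensorProduct.mapL_apply]

theorem tensorOp_add_right (S : H →L[ℂ] H) (T T' : K →L[ℂ] K) :
    tensorOp S (T + T') = tensorOp S T + tensorOp S T' :=
  continuousLinearMap_completion_ext fun x => by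
    simp [tensorOp_coe, TensorProduct.mapL_add_right, Completion.coe_add, -TensorProduct.mapL_apply]

theorem tensorOp_smul_left (c : ℂ) (S : H →L[ℂ] H) (T : K →L[ℂ] K) :
    tensorOp (c • S) T = c • tensorOp S T :=
  continuousLinearMap_completion_ext fun x => by
    simp [tensorOp_coe, TensorProduct.mapL_smul_left, -TensorProduct.mapL_apply]

theorem tensorOp_smul_right (c : ℂ) (S : H →L[ℂ] H) (T : K →L[ℂ] K) :
    tensorOp S (c • T) = c • tensorOp S T :=
  continuousLinearMap_completion_ext fun x => by
    simp [tensorOp_coe, TensorProduct.mapL_smul_right, -TensorProduct.mapL_apply]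

theorem tensorOp_mul (S S' : H →L[ℂ] H) (T T' : K →L[ℂ] K) :
    tensorOp (S * S') (T * T') = tensorOp S T * tensorOp S' T' :=
  continuousLinearMap_completion_ext fun x => by
    simp [tensorOp_coe, TensorProduct.mapL_mul, -TensorProduct.mapL_apply]

theorem star_tensorOp [CompleteSpace H] [CompleteSpace K] (S : H →L[ℂ] H) (T : K →L[ℂ] K) :
    star (tensorOp S T) = tensorOp (star S) (star T) := by
  rw [ContinuousLinearMap.star_eq_adjoint (tensorOp S T)]
  symm
  rw [ContinuousLinearMap.eq_adjoint_iff]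
  intro x y
  induction x, y using Completion.induction_on₂ with
  | hp => exact isClosed_eq (by fun_prop) (by fun_prop)
  | ih x y =>
    rw [tensorOp_coe, tensorOp_coe, Completion.inner_coe, Completion.inner_coe]
    induction x with
    | zero => simp
    | add x x' hx hx' => rw [map_add, inner_add_left, inner_add_left, hx, hx']
    | tmul a b =>
      induction y with
      | zero => simp
      | add y y' hy hy' => rw [map_add, inner_add_right, inner_add_right, hy, hy']
      | tmul c d =>
        simp [TensorProduct.mapL_tmul, ContinuousLinearMap.star_eq_adjoint,
          ContinuousLinearMap.adjoint_inner_left, -TensorProduct.mapL_apply]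

/-- The isometry `ξ ↦ ξ ⊗ e` for a unit vector `e`. -/
def tensorUnitVector (H : Type u) [NormedAddCommGroup H] [InnerProductSpace ℂ H] (e : K)
    (he : ‖e‖ = 1) : H →ₗᵢ[ℂ] Completion (H ⊗[ℂ] K) where
  toFun ξ := ((ξ ⊗ₜ e : H ⊗[ℂ] K) : Completion (H ⊗[ℂ] K))
  map_add' ξ η := by rw [TensorProduct.add_tmul, Completion.coe_add]
  map_smul' c ξ := by rw [← TensorProduct.smul_tmul', Completion.coe_smul, RingHom.id_apply]
  norm_map' ξ := by
    change ‖((ξ ⊗ₜ e : H ⊗[ℂ] K) : Completion (H ⊗[ℂ] K))‖ = _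
    rw [Completion.norm_coe, TensorProduct.norm_tmul, he, mul_one]

theorem tensorUnitVector_apply (e : K) (he : ‖e‖ = 1) (ξ : H) :
    tensorUnitVector H e he ξ = ((ξ ⊗ₜ e : H ⊗[ℂ] K) : Completion (H ⊗[ℂ] K)) := rfl

variable {I : Type*} {e : I → K}

theorem Orthonormal.orthogonalFamily_tensorUnitVector (he : Orthonormal ℂ e) :
    OrthogonalFamily ℂ (fun _ : I => H) fun i => tensorUnitVector H (e i) (he.1 i) :=
  fun i j hij ξ η => by
    rw [tensorUnitVector_apply, tensorUnitVector_apply, Completion.inner_coe,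
      TensorProduct.inner_tmul, he.2 hij, mul_zero]

variable [CompleteSpace H]

/-- The isometry `ξ ↦ ∑ ξ_i ⊗ e_i` for an orthonormal family `e`. -/
def tensorOrthonormal (H : Type u) [NormedAddCommGroup H] [InnerProductSpace ℂ H] [CompleteSpace H]
    (he : Orthonormal ℂ e) : lp (fun _ : I => H) 2 →ₗᵢ[ℂ] Completion (H ⊗[ℂ] K) :=
  (he.orthogonalFamily_tensorUnitVector (H := H)).linearIsometry

theorem tensorOrthonormal_single [DecidableEq I] (he : Orthonormal ℂ e) (i : I) (ξ : H) :
    tensorOrthonormal H he (lp.single 2 i ξ) = ((ξ ⊗ₜ e i : H ⊗[ℂ] K) : Completion (H ⊗[ℂ] K)) :=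
  OrthogonalFamily.linearIsometry_apply_single _ _

end TensorOp

/-! ### The Hilbert space `H ⊗ ℓ²(Γ)` as `ℓ²(Γ, H)` -/

section Regular

variable {Γ : Type u} [Group Γ] {H : Type u} [NormedAddCommGroup H] [InnerProductSpace ℂ H]
  [CompleteSpace H]

omit [Group Γ] in
theorem orthonormal_single [DecidableEq Γ] :
    Orthonormal ℂ fun t : Γ => (lp.single 2 t (1 : ℂ) : lp (fun _ : Γ => ℂ) 2) := by
  constructor
  · intro t
    rw [lp.norm_single (by simp), norm_one]
  · intro s t hst
    rw [lp.inner_single_left, lp.single_apply_ne _ _ _ hst, inner_zero_right]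

theorem star_leftRegular (s : Γ) : star (leftRegular s) = leftRegular s⁻¹ := by
  rw [leftRegular, star_diagTranslate]
  simp only [star_one]
  rfl

/-- The isometry of `ℓ²(Γ, H)` onto `H ⊗ ℓ²(Γ)`. -/
def tensorEll (Γ : Type u) [Group Γ] (H : Type u) [NormedAddCommGroup H] [InnerProductSpace ℂ H]
    [CompleteSpace H] [DecidableEq Γ] :
    lp (fun _ : Γ => H) 2 →ₗᵢ[ℂ] Completion (H ⊗[ℂ] lp (fun _ : Γ => ℂ) 2) :=
  tensorOrthonormal H (orthonormal_single (Γ := Γ))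

/-- An isometry has closed range, so elementary tensors suffice, and these are limits of the finite
sums obtained by expanding the second factor in the point masses. -/
theorem tensorEll_surjective [DecidableEq Γ] : Function.Surjective (tensorEll Γ H) := by
  have h1 : IsClosed (Set.range (tensorEll Γ H)) :=
    (tensorEll Γ H).isometry.isClosedEmbedding.isClosed_range
  intro x
  induction x using Completion.induction_on with
  | hp => exact h1
  | ih x =>
    induction x with
    | zero => exact ⟨0, map_zero _⟩
    | add x y hx hy =>
      obtain ⟨a, ha⟩ := hx
      obtain ⟨b, hb⟩ := hy
      exact ⟨a + b, by rw [map_add, ha, hb, Completion.coe_add]⟩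
    | tmul ξ η =>
      have h2 := lp.hasSum_single (p := 2) (by simp) η
      let L : lp (fun _ : Γ => ℂ) 2 →L[ℂ] Completion (H ⊗[ℂ] lp (fun _ : Γ => ℂ) 2) :=
        Completion.toComplL.comp (TensorProduct.mkL ℂ H (lp (fun _ : Γ => ℂ) 2) ξ)
      have h3 := h2.mapL L
      refine h1.mem_of_tendsto h3 (.of_forall fun s => ⟨∑ t ∈ s, lp.single 2 t (η t • ξ), ?_⟩)
      rw [map_sum]
      refine Finset.sum_congr rfl fun t _ => ?_
      have h4 : (lp.single 2 t (η t) : lp (fun _ : Γ => ℂ) 2) = η t • lp.single 2 t 1 := by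
        rw [← lp.single_smul, smul_eq_mul, mul_one]
      have h5 : L (lp.single 2 t (η t)) =
          ((ξ ⊗ₜ (η t • lp.single 2 t 1) : H ⊗[ℂ] lp (fun _ : Γ => ℂ) 2) :
            Completion (H ⊗[ℂ] lp (fun _ : Γ => ℂ) 2)) := by
        rw [h4]
        rfl
      refine Eq.trans ?_ h5.symm
      rw [tensorEll, tensorOrthonormal_single, TensorProduct.smul_tmul]

theorem tensorOp_leftRegular_tensorEll [DecidableEq Γ] (S : H →L[ℂ] H) (C : ℝ)
    (h : ∀ _ : Γ, ‖S‖ ≤ C) (s : Γ) (ξ : lp (fun _ : Γ => H) 2) :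
    tensorOp S (leftRegular s) (tensorEll Γ H ξ) =
      tensorEll Γ H (diagTranslate (fun _ : Γ => S) C h s ξ) := by
  suffices h1 : (tensorOp S (leftRegular s)).comp (tensorEll Γ H).toContinuousLinearMap =
      (tensorEll Γ H).toContinuousLinearMap.comp (diagTranslate (fun _ : Γ => S) C h s) from
    congrArg (fun T => T ξ) h1
  refine lp.ext_continuousLinearMap (by simp) fun t => ?_
  ext η
  have h2 := diagTranslate_single (fun _ : Γ => S) C h s (s * t) η
  have h3 := diagTranslate_single (fun _ : Γ => (1 : ℂ →L[ℂ] ℂ)) 1 (fun _ => norm_one.le) s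
    (s * t) 1
  rw [inv_mul_cancel_left] at h2 h3
  change tensorOp S (leftRegular s) (tensorEll Γ H (lp.single 2 t η)) =
    tensorEll Γ H (diagTranslate (fun _ : Γ => S) C h s (lp.single 2 t η))
  rw [h2, tensorEll, tensorOrthonormal_single, tensorOrthonormal_single, tensorOp_coe,
    TensorProduct.mapL_tmul, leftRegular, h3]
  rfl

/-- The norm of operators on `H ⊗ ℓ²(Γ)` in the picture `ℓ²(Γ, H)`. -/
theorem norm_eval_tensorOp_leftRegular {X : Type u} (S : X → H →L[ℂ] H) (C : X → ℝ)
    (h : ∀ x (_ : Γ), ‖S x‖ ≤ C x) (s : X → Γ) (q : StarTerm X) :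
    ‖q.eval fun x => tensorOp (S x) (leftRegular (s x))‖ =
      ‖q.eval fun x => diagTranslate (fun _ : Γ => S x) (C x) (h x) (s x)‖ := by
  classical
  let e := LinearIsometryEquiv.ofSurjective (tensorEll Γ H) tensorEll_surjective
  have h1 (x : X) (ξ : lp (fun _ : Γ => H) 2) : tensorOp (S x) (leftRegular (s x)) (e ξ) =
      e (diagTranslate (fun _ : Γ => S x) (C x) (h x) (s x) ξ) :=
    tensorOp_leftRegular_tensorEll _ _ _ _ _
  have h2 (x : X) (ξ : lp (fun _ : Γ => H) 2) : star (tensorOp (S x) (leftRegular (s x))) (e ξ) =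
      e (star (diagTranslate (fun _ : Γ => S x) (C x) (h x) (s x)) ξ) := by
    rw [star_tensorOp, star_leftRegular, star_diagTranslate]
    exact tensorOp_leftRegular_tensorEll _ _ _ _ _
  apply le_antisymm
  · refine norm_eval_le_of_intertwine e.symm.toLinearIsometry (fun x ξ => ?_) (fun x ξ => ?_) q
    · refine e.injective ?_
      change e _ = e (e.symm _)
      rw [← h1, e.apply_symm_apply]
      change tensorOp _ _ (e (e.symm ξ)) = _
      rw [e.apply_symm_apply]
    · refine e.injective ?_
      change e _ = e (e.symm _)
      rw [← h2, e.apply_symm_apply]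
      change star (tensorOp _ _) (e (e.symm ξ)) = _
      rw [e.apply_symm_apply]
  · exact norm_eval_le_of_intertwine e.toLinearIsometry h1 h2 q

end Regular

section

/-! ### Matrices over C*-algebras -/

/-- The C*-algebra structure of the matrix algebra over a C*-algebra. -/
@[reducible] def cstarMatrixAlgebra (n : Type v) [Fintype n] (A : Type w)
    [NonUnitalCStarAlgebra A] : NonUnitalCStarAlgebra (CStarMatrix n n A) :=
  letI := spectralOrder A
  haveI := spectralOrderedRing A
  CStarMatrix.instNonUnitalCStarAlgebra

attribute [local instance] cstarMatrixAlgebra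

section Matrix

variable {n : Type v} [Fintype n] {A : Type u} [NonUnitalCStarAlgebra A] {H : Type w}
  [NormedAddCommGroup H] [InnerProductSpace ℂ H] [CompleteSpace H]

/-- The matrix operator on `ℓ²(n, H)` with the given entries. -/
def matrixOp (T : n → n → H →L[ℂ] H) : lp (fun _ : n => H) 2 →L[ℂ] lp (fun _ : n => H) 2 := by
  classical
  exact ∑ k, ∑ l, (lp.singleContinuousLinearMap ℂ (fun _ : n => H) 2 k).comp
    ((T k l).comp (lp.evalCLM ℂ (fun _ : n => H) 2 l))

omit [CompleteSpace H] in
theorem matrixOp_apply (T : n → n → H →L[ℂ] H) (ξ : lp (fun _ : n => H) 2) (k : n) :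
    matrixOp T ξ k = ∑ l, T k l (ξ l) := by
  classical
  simp only [matrixOp, sum_apply, ContinuousLinearMap.comp_apply, lp.coeFn_sum,
    Finset.sum_apply, lp.singleContinuousLinearMap_apply]
  rw [Finset.sum_eq_single k]
  · refine Finset.sum_congr rfl fun l _ => ?_
    rw [lp.single_apply_self]
    rfl
  · intro l _ hl
    refine Finset.sum_eq_zero fun m _ => ?_
    rw [lp.single_apply_ne _ _ _ hl.symm]
  · simp

/-- The representation of the matrix algebra over `A` on `ℓ²(n, H)`. -/
def matrixRep (n : Type v) [Fintype n] (σ : A →⋆ₙₐ[ℂ] (H →L[ℂ] H)) :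
    CStarMatrix n n A →⋆ₙₐ[ℂ] (lp (fun _ : n => H) 2 →L[ℂ] lp (fun _ : n => H) 2) where
  toFun m := matrixOp fun k l => σ (m k l)
  map_smul' c m := by
    ext ξ k
    simp [matrixOp_apply, Finset.smul_sum]
  map_zero' := by
    ext ξ k
    simp [matrixOp_apply]
  map_add' m m' := by
    ext ξ k
    simp [matrixOp_apply, Finset.sum_add_distrib]
  map_mul' m m' := by
    ext ξ k
    simp only [matrixOp_apply, mul_apply_eq_comp, CStarMatrix.mul_apply, map_sum, map_mul,
      sum_apply]
    rw [Finset.sum_comm]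
  map_star' m := by
    rw [ContinuousLinearMap.star_eq_adjoint, ContinuousLinearMap.eq_adjoint_iff]
    intro ξ η
    rw [lp.inner_eq_tsum, lp.inner_eq_tsum, tsum_fintype, tsum_fintype]
    simp only [matrixOp_apply, sum_inner, inner_sum]
    rw [Finset.sum_comm]
    refine Finset.sum_congr rfl fun k _ => Finset.sum_congr rfl fun l _ => ?_
    rw [CStarMatrix.star_apply, map_star, ContinuousLinearMap.star_eq_adjoint,
      ContinuousLinearMap.adjoint_inner_left]

theorem matrixRep_apply (σ : A →⋆ₙₐ[ℂ] (H →L[ℂ] H)) (m : CStarMatrix n n A)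
    (ξ : lp (fun _ : n => H) 2) (k : n) : matrixRep n σ m ξ k = ∑ l, σ (m k l) (ξ l) :=
  matrixOp_apply _ _ _

theorem eq_zero_of_matrixRep {J : Type*} (σ : J → HilbRep A)
    (hσ : ∀ a, (∀ j, (σ j).hom a = 0) → a = 0) (m : CStarMatrix n n A)
    (h : ∀ j, matrixRep n (σ j).hom m = 0) : m = 0 := by
  classical
  ext k l
  refine hσ _ fun j => ?_
  ext ξ
  have h1 : matrixRep n (σ j).hom m (lp.single 2 l ξ) k = 0 := by
    rw [h j]
    rfl
  rw [matrixRep_apply, Finset.sum_eq_single l] at h1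
  · rwa [lp.single_apply_self] at h1
  · intro i _ hi
    rw [lp.single_apply_ne _ _ _ hi, map_zero]
  · simp

end Matrix

/-! ### Independence of the minimal tensor norm from the representations -/

section Independence

variable {A : Type u} [NonUnitalCStarAlgebra A] {K : Type u} [NormedAddCommGroup K]
  [InnerProductSpace ℂ K]

theorem tensorOrthonormal_eq_sum {H : Type u} [NormedAddCommGroup H] [InnerProductSpace ℂ H]
    [CompleteSpace H] {n : Type*} [Fintype n] {e : n → K} (he : Orthonormal ℂ e)
    (ξ : lp (fun _ : n => H) 2) :
    tensorOrthonormal H he ξ = ((∑ k, ξ k ⊗ₜ e k : H ⊗[ℂ] K) : Completion (H ⊗[ℂ] K)) := by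
  rw [tensorOrthonormal, OrthogonalFamily.linearIsometry_apply, tsum_fintype]
  simp only [tensorUnitVector_apply]
  exact (map_sum (Completion.toComplL (𝕜 := ℂ) (E := H ⊗[ℂ] K)) _ _).symm

/-- The compression of `∑ π(a_i) ⊗ T_i` to the span of a finite orthonormal family. -/
theorem inner_tensorOrthonormal (π : HilbRep A) {ι : Type*} (s : Finset ι) (a : ι → A)
    (T : ι → K →L[ℂ] K) {n : Type} [Fintype n] {e : n → K} (he : Orthonormal ℂ e)
    (ξ η : lp (fun _ : n => π.space) 2) :
    inner ℂ (tensorOrthonormal π.space he η)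
      ((∑ i ∈ s, tensorOp (π.hom (a i)) (T i)) (tensorOrthonormal π.space he ξ)) =
    inner ℂ η (matrixRep n π.hom
      (CStarMatrix.ofMatrix fun l k => ∑ i ∈ s, inner ℂ (e l) (T i (e k)) • a i) ξ) := by
  have hm (l k : n) (ζ : π.space) : π.hom ((CStarMatrix.ofMatrix fun l k =>
      ∑ i ∈ s, inner ℂ (e l) (T i (e k)) • a i : CStarMatrix n n A) l k) ζ =
      ∑ i ∈ s, inner ℂ (e l) (T i (e k)) • π.hom (a i) ζ := by
    change π.hom (∑ i ∈ s, inner ℂ (e l) (T i (e k)) • a i) ζ = _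
    rw [map_sum, sum_apply]
    exact Finset.sum_congr rfl fun i _ => by rw [map_smul, smul_apply]
  rw [tensorOrthonormal_eq_sum, tensorOrthonormal_eq_sum, lp.inner_eq_tsum, tsum_fintype]
  simp only [matrixRep_apply, hm, inner_sum, inner_smul_right]
  simp only [sum_apply, tensorOp_coe, inner_sum, Completion.inner_coe, map_sum,
    TensorProduct.mapL_tmul, sum_inner, TensorProduct.inner_tmul]
  rw [Finset.sum_comm]
  refine (Finset.sum_congr rfl fun i _ => Finset.sum_comm).trans ?_
  rw [Finset.sum_comm]
  exact Finset.sum_congr rfl fun l _ => Finset.sum_congr rfl fun k _ =>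
    Finset.sum_congr rfl fun i _ => mul_comm _ _

/-- Vectors in an algebraic tensor product live on a finite-dimensional subspace. -/
theorem exists_tensorOrthonormal {H : Type u} [NormedAddCommGroup H] [InnerProductSpace ℂ H]
    [CompleteSpace H] (x y : H ⊗[ℂ] K) :
    ∃ (n : ℕ) (e : Fin n → K) (he : Orthonormal ℂ e),
      (x : Completion (H ⊗[ℂ] K)) ∈ Set.range (tensorOrthonormal H he) ∧
      (y : Completion (H ⊗[ℂ] K)) ∈ Set.range (tensorOrthonormal H he) := by
  obtain ⟨K', hK', h⟩ := TensorProduct.exists_finite_submodule_right_of_setFinite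
    ({x, y} : Set (H ⊗[ℂ] K)) (by simp)
  let b := stdOrthonormalBasis ℂ K'
  have he : Orthonormal ℂ fun i => (b i : K) := b.orthonormal.comp_linearIsometry K'.subtypeₗᵢ
  refine ⟨_, _, he, ?_⟩
  have key (z : H ⊗[ℂ] K') :
      ((K'.subtype.lTensor H z : H ⊗[ℂ] K) : Completion (H ⊗[ℂ] K)) ∈
        Set.range (tensorOrthonormal H he) := by
    induction z with
    | zero => exact ⟨0, by rw [map_zero, map_zero, Completion.coe_zero]⟩
    | add z w hz hw =>
      obtain ⟨ξ, hξ⟩ := hz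
      obtain ⟨η, hη⟩ := hw
      exact ⟨ξ + η, by rw [map_add, map_add, hξ, hη, Completion.coe_add]⟩
    | tmul ξ η =>
      refine ⟨⟨fun k => b.repr η k • ξ, Memℓp.all _⟩, ?_⟩
      rw [tensorOrthonormal_eq_sum]
      congr 1
      change ∑ k, (b.repr η k • ξ) ⊗ₜ[ℂ] (b k : K) = ξ ⊗ₜ (η : K)
      conv_rhs => rw [← b.sum_repr η]
      simp [TensorProduct.tmul_sum, TensorProduct.smul_tmul]
  obtain ⟨x', hx⟩ := h (Set.mem_insert _ _)
  obtain ⟨y', hy⟩ := h (Set.mem_insert_of_mem _ rfl)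
  exact ⟨hx ▸ key x', hy ▸ key y'⟩

theorem opNorm_le_of_inner_le {E : Type*} [NormedAddCommGroup E] [InnerProductSpace ℂ E]
    (T : E →L[ℂ] E) {C : ℝ} (hC : 0 ≤ C) (h : ∀ x y, ‖inner ℂ y (T x)‖ ≤ C * ‖x‖ * ‖y‖) :
    ‖T‖ ≤ C := by
  refine T.opNorm_le_bound hC fun x => ?_
  have h1 := h x (T x)
  rw [inner_self_eq_norm_sq_to_K, norm_pow, RCLike.norm_ofReal, abs_norm, sq] at h1
  rcases (norm_nonneg (T x)).eq_or_lt with h2 | h2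
  · rw [← h2]
    positivity
  · exact le_of_mul_le_mul_right h1 h2

/-- The norm of `∑ π(a_i) ⊗ T_i` is bounded by the norms in jointly injective representations. -/
theorem norm_sum_tensorOp_le {J : Type*} (σ : J → HilbRep A)
    (hσ : ∀ a, (∀ j, (σ j).hom a = 0) → a = 0) (π : HilbRep A) {ι : Type*} (s : Finset ι)
    (a : ι → A) (T : ι → K →L[ℂ] K) {C : ℝ} (hC : 0 ≤ C)
    (h : ∀ j, ‖∑ i ∈ s, tensorOp ((σ j).hom (a i)) (T i)‖ ≤ C) :
    ‖∑ i ∈ s, tensorOp (π.hom (a i)) (T i)‖ ≤ C := by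
  have bound (S : Completion (π.space ⊗[ℂ] K) →L[ℂ] Completion (π.space ⊗[ℂ] K))
      (hS : ∀ x y : π.space ⊗[ℂ] K, ‖inner ℂ (y : Completion (π.space ⊗[ℂ] K)) (S x)‖ ≤
        C * ‖(x : Completion (π.space ⊗[ℂ] K))‖ * ‖(y : Completion (π.space ⊗[ℂ] K))‖) :
      ‖S‖ ≤ C := by
    refine opNorm_le_of_inner_le S hC fun x y => ?_
    induction x, y using Completion.induction_on₂ with
    | hp => exact isClosed_le (by fun_prop) (by fun_prop)
    | ih x y => exact hS x y
  refine bound _ fun x y => ?_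
  -- Both vectors lie in `H ⊗ span e` for a finite orthonormal family `e`. The compression to this
  -- subspace is the image under `π` of a matrix over `A` with entries `∑ ⟨e_l, T_i e_k⟩ a_i`, which
  -- do not involve `π`. The norm of this matrix can therefore be computed in the representations `σ
  -- j`, where it is the norm of a compression again.
  obtain ⟨n, e, he, ⟨ξ, hξ⟩, ⟨η, hη⟩⟩ := exists_tensorOrthonormal x y
  rw [← hξ, ← hη, inner_tensorOrthonormal, LinearIsometry.norm_map, LinearIsometry.norm_map]
  refine (norm_inner_le_norm _ _).trans ?_
  rw [mul_comm]
  refine mul_le_mul_of_nonneg_right ?_ (norm_nonneg _)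
  refine (ContinuousLinearMap.le_opNorm _ _).trans (mul_le_mul_of_nonneg_right ?_ (norm_nonneg _))
  refine (NonUnitalStarAlgHom.norm_apply_le (matrixRep (Fin n) π.hom) _).trans ?_
  refine norm_le_of_jointly_injective (fun j => matrixRep (Fin n) (σ j).hom)
    (eq_zero_of_matrixRep σ hσ) hC fun j => ?_
  refine opNorm_le_of_inner_le _ hC fun ξ η => ?_
  rw [← inner_tensorOrthonormal _ _ _ _ he, ← (tensorOrthonormal (σ j).space he).norm_map ξ,
    ← (tensorOrthonormal (σ j).space he).norm_map η, mul_comm]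
  refine (norm_inner_le_norm _ _).trans (mul_le_mul_of_nonneg_left ?_ (norm_nonneg _))
  exact (ContinuousLinearMap.le_opNorm _ _).trans
    (mul_le_mul_of_nonneg_right (h j) (norm_nonneg _))

end Independence

end

/-! ### Minimal tensor products -/

/-- A closed subspace containing a multiplicative selfadjoint set which contains generators. -/
theorem Generates.mem_of_mul_star {X : Type u} {A : Type v} [NonUnitalCStarAlgebra A] {g : X → A}
    (hg : Generates g) {T : Set A} (hT : ∀ x, g x ∈ T) (hmul : ∀ a ∈ T, ∀ b ∈ T, a * b ∈ T)
    (hstar : ∀ a ∈ T, star a ∈ T) {S : Submodule ℂ A} (hS : IsClosed (S : Set A)) (hTS : T ⊆ S)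
    (a : A) : a ∈ S := by
  let N : NonUnitalStarSubalgebra ℂ A :=
    { Submodule.span ℂ T with
      mul_mem' := fun {a b} ha hb => by
        change a * b ∈ Submodule.span ℂ T
        change a ∈ Submodule.span ℂ T at ha
        change b ∈ Submodule.span ℂ T at hb
        induction ha, hb using Submodule.span_induction₂ with
        | mem_mem a b ha hb => exact Submodule.subset_span (hmul a ha b hb)
        | zero_left b hb => rw [zero_mul]; exact zero_mem _
        | zero_right b hb => rw [mul_zero]; exact zero_mem _
        | add_left a b c _ _ _ h1 h2 => rw [add_mul]; exact add_mem h1 h2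
        | add_right a b c _ _ _ h1 h2 => rw [mul_add]; exact add_mem h1 h2
        | smul_left c a b _ _ h1 => rw [smul_mul_assoc]; exact Submodule.smul_mem _ c h1
        | smul_right c a b _ _ h1 => rw [mul_smul_comm]; exact Submodule.smul_mem _ c h1
      star_mem' := fun {a} ha => by
        change star a ∈ Submodule.span ℂ T
        change a ∈ Submodule.span ℂ T at ha
        induction ha using Submodule.span_induction with
        | mem a ha => exact Submodule.subset_span (hstar a ha)
        | zero => rw [star_zero]; exact zero_mem _
        | add a b _ _ h1 h2 => rw [star_add]; exact add_mem h1 h2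
        | smul c a _ h1 => rw [star_smul]; exact Submodule.smul_mem _ _ h1 }
  have h1 : a ∈ N.topologicalClosure :=
    hg.mem _ N.isClosed_topologicalClosure (fun x => N.le_topologicalClosure
      (Submodule.subset_span (hT x))) a
  have h2 : (N : Set A) ⊆ S := Submodule.span_le.mpr hTS
  exact hS.closure_subset_iff.mpr h2 h1

/-- The flip is unitary. It transfers the independence result, proved for the first leg, to the
second leg. -/
theorem norm_sum_tensorOp_comm {H K : Type u} [NormedAddCommGroup H] [InnerProductSpace ℂ H]
    [NormedAddCommGroup K] [InnerProductSpace ℂ K] {ι : Type*} (s : Finset ι) (S : ι → H →L[ℂ] H)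
    (T : ι → K →L[ℂ] K) :
    ‖∑ i ∈ s, tensorOp (S i) (T i)‖ ≤ ‖∑ i ∈ s, tensorOp (T i) (S i)‖ := by
  let e := (TensorProduct.commIsometry ℂ H K)
  have key (x : H ⊗[ℂ] K) : ‖(∑ i ∈ s, tensorOp (S i) (T i)) (x : Completion (H ⊗[ℂ] K))‖ =
      ‖(∑ i ∈ s, tensorOp (T i) (S i)) (e x : Completion (K ⊗[ℂ] H))‖ := by
    have h1 : (∑ i ∈ s, tensorOp (S i) (T i)) (x : Completion (H ⊗[ℂ] K)) =
        ((∑ i ∈ s, TensorProduct.mapL (S i) (T i) x : H ⊗[ℂ] K) : Completion (H ⊗[ℂ] K)) := by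
      simp only [sum_apply, tensorOp_coe]
      exact (map_sum (Completion.toComplL (𝕜 := ℂ) (E := H ⊗[ℂ] K)) _ _).symm
    have h2 : (∑ i ∈ s, tensorOp (T i) (S i)) (e x : Completion (K ⊗[ℂ] H)) =
        ((∑ i ∈ s, TensorProduct.mapL (T i) (S i) (e x) : K ⊗[ℂ] H) :
          Completion (K ⊗[ℂ] H)) := by
      simp only [sum_apply, tensorOp_coe]
      exact (map_sum (Completion.toComplL (𝕜 := ℂ) (E := K ⊗[ℂ] H)) _ _).symm
    have h3 (i : ι) : e (TensorProduct.mapL (S i) (T i) x) =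
        TensorProduct.mapL (T i) (S i) (e x) := by
      clear h1 h2
      induction x with
      | zero => simp
      | add x y hx hy => rw [map_add, map_add, map_add, map_add, hx, hy]
      | tmul ξ η => simp [e]
    rw [h1, h2, Completion.norm_coe, Completion.norm_coe, ← e.norm_map, map_sum]
    exact congrArg norm (Finset.sum_congr rfl fun i _ => h3 i)
  refine ContinuousLinearMap.opNorm_le_bound _ (ContinuousLinearMap.opNorm_nonneg _) fun x => ?_
  induction x using Completion.induction_on with
  | hp => exact isClosed_le (by fun_prop) (by fun_prop)
  | ih x =>
    rw [key]
    refine ((∑ i ∈ s, tensorOp (T i) (S i)).le_opNorm _).trans_eq ?_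
    rw [Completion.norm_coe, Completion.norm_coe, e.norm_map]

namespace MinTensor

variable {A B : Type u} [NonUnitalCStarAlgebra A] [NonUnitalCStarAlgebra B]

/-- The tensor product of two representations. -/
def rep (π : HilbRep A) (ρ : HilbRep B) : MinTensor A B →⋆ₙₐ[ℂ]
    (Completion (π.space ⊗[ℂ] ρ.space) →L[ℂ] Completion (π.space ⊗[ℂ] ρ.space)) :=
  CStarGen.evalHom (tensorClass A B) (π, ρ)

theorem rep_tmul (π : HilbRep A) (ρ : HilbRep B) (a : A) (b : B) :
    rep π ρ (tmul a b) = tensorOp (π.hom a) (ρ.hom b) :=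
  CStarGen.evalHom_gen (tensorClass A B) (π, ρ) (a, b)

theorem eq_zero_of_rep {x : MinTensor A B} (h : ∀ π ρ, rep π ρ x = 0) : x = 0 :=
  CStarGen.eq_zero_of_evalHom _ fun i => h i.1 i.2

theorem ext_rep {x y : MinTensor A B} (h : ∀ π ρ, rep π ρ x = rep π ρ y) : x = y :=
  sub_eq_zero.mp <| eq_zero_of_rep fun π ρ => by rw [map_sub, sub_eq_zero, h]

theorem add_tmul (a a' : A) (b : B) : tmul (a + a') b = tmul a b + tmul a' b :=
  ext_rep fun π ρ => by
    rw [map_add]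
    simp only [rep_tmul, map_add, tensorOp_add_left]

theorem tmul_add (a : A) (b b' : B) : tmul a (b + b') = tmul a b + tmul a b' :=
  ext_rep fun π ρ => by
    rw [map_add]
    simp only [rep_tmul, map_add, tensorOp_add_right]

theorem smul_tmul (c : ℂ) (a : A) (b : B) : tmul (c • a) b = c • tmul a b :=
  ext_rep fun π ρ => by
    rw [map_smul]
    simp only [rep_tmul, map_smul, tensorOp_smul_left]

theorem tmul_smul (c : ℂ) (a : A) (b : B) : tmul a (c • b) = c • tmul a b :=
  ext_rep fun π ρ => by
    rw [map_smul]
    simp only [rep_tmul, map_smul, tensorOp_smul_right]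

theorem tmul_mul_tmul (a a' : A) (b b' : B) : tmul a b * tmul a' b' = tmul (a * a') (b * b') :=
  ext_rep fun π ρ => by
    rw [map_mul]
    simp only [rep_tmul, map_mul, tensorOp_mul]

theorem star_tmul (a : A) (b : B) : star (tmul a b) = tmul (star a) (star b) :=
  ext_rep fun π ρ => by
    rw [map_star]
    simp only [rep_tmul, map_star, star_tensorOp]

theorem norm_tmul_le (a : A) (b : B) : ‖tmul a b‖ ≤ ‖a‖ * ‖b‖ :=
  CStarGen.norm_eval_gen_le (tensorClass A B) (q := .gen (a, b)) (by positivity) fun i =>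
    (norm_tensorOp_le (i.1.hom a) (i.2.hom b)).trans (mul_le_mul (NonUnitalStarAlgHom.norm_apply_le i.1.hom a)
      (NonUnitalStarAlgHom.norm_apply_le i.2.hom b) (norm_nonneg _) (norm_nonneg _))

variable (A) in
/-- `tmul a b` as a continuous linear map in `a`. -/
def tmulLeft (b : B) : A →L[ℂ] MinTensor A B :=
  LinearMap.mkContinuous
    { toFun := fun a => tmul a b
      map_add' := fun a a' => add_tmul a a' b
      map_smul' := fun c a => smul_tmul c a b } ‖b‖ fun a => by
    rw [mul_comm]
    exact norm_tmul_le a b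

variable (B) in
/-- `tmul a b` as a continuous linear map in `b`. -/
def tmulRight (a : A) : B →L[ℂ] MinTensor A B :=
  LinearMap.mkContinuous
    { toFun := fun b => tmul a b
      map_add' := fun b b' => tmul_add a b b'
      map_smul' := fun c b => tmul_smul c a b } ‖a‖ fun b => norm_tmul_le a b

theorem mem_of_tmul_mem {S : Submodule ℂ (MinTensor A B)} (hS : IsClosed (S : Set (MinTensor A B)))
    (h : ∀ a b, tmul a b ∈ S) (x : MinTensor A B) : x ∈ S :=
  (CStarGen.generates_gen (tensorClass A B)).mem_of_mul_star
    (T := Set.range fun x : A × B => (tmul x.1 x.2 : MinTensor A B))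
    (fun x => ⟨x, rfl⟩)
    (by rintro _ ⟨x, rfl⟩ _ ⟨y, rfl⟩; exact ⟨(x.1 * y.1, x.2 * y.2), (tmul_mul_tmul ..).symm⟩)
    (by rintro _ ⟨x, rfl⟩; exact ⟨(star x.1, star x.2), (star_tmul ..).symm⟩) hS
    (by rintro _ ⟨x, rfl⟩; exact h _ _) x

/-- The norm of the minimal tensor product can be computed in jointly injective families of
representations. -/
theorem norm_le_of_jointly_injective {J J' : Type*} (σ : J → HilbRep A)
    (hσ : ∀ a, (∀ j, (σ j).hom a = 0) → a = 0) (ρ : J' → HilbRep B)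
    (hρ : ∀ b, (∀ j, (ρ j).hom b = 0) → b = 0) (x : MinTensor A B) {C : ℝ} (hC : 0 ≤ C)
    (h : ∀ j k, ‖rep (σ j) (ρ k) x‖ ≤ C) : ‖x‖ ≤ C := by
  have key (x : MinTensor A B) (hx : x ∈ Submodule.span ℂ
      (Set.range fun x : A × B => (tmul x.1 x.2 : MinTensor A B))) {C : ℝ} (hC : 0 ≤ C)
      (h : ∀ j k, ‖rep (σ j) (ρ k) x‖ ≤ C) : ‖x‖ ≤ C := by
    obtain ⟨c, rfl⟩ := Finsupp.mem_span_range_iff_exists_finsupp.mp hx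
    have h1 (π : HilbRep A) (τ : HilbRep B) : rep π τ
        (c.sum fun i a => a • (tmul i.1 i.2 : MinTensor A B)) =
        ∑ i ∈ c.support, tensorOp (π.hom (c i • i.1)) (τ.hom i.2) := by
      rw [Finsupp.sum, map_sum]
      exact Finset.sum_congr rfl fun i _ => by rw [← smul_tmul, rep_tmul]
    refine _root_.norm_le_of_jointly_injective (B := fun i : HilbRep A × HilbRep B =>
      Completion (i.1.space ⊗[ℂ] i.2.space) →L[ℂ] Completion (i.1.space ⊗[ℂ] i.2.space))
      (fun i : HilbRep A × HilbRep B => rep i.1 i.2)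
      (fun a ha => eq_zero_of_rep fun π ρ => ha (π, ρ)) hC fun i => ?_
    rw [h1]
    -- The representation of the first leg is replaced by the `σ j`; between two flips the same is
    -- done with the second leg and the `ρ k`.
    refine norm_sum_tensorOp_le σ hσ i.1 _ _ _ hC fun j => ?_
    refine (norm_sum_tensorOp_comm _ _ _).trans ?_
    refine norm_sum_tensorOp_le ρ hρ i.2 _ _ _ hC fun k => ?_
    refine (norm_sum_tensorOp_comm _ _ _).trans ?_
    rw [← h1]
    exact h j k
  refine le_of_forall_pos_le_add fun ε hε => ?_
  have h1 : x ∈ (Submodule.span ℂ (Set.range fun x : A × B =>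
      (tmul x.1 x.2 : MinTensor A B))).topologicalClosure :=
    mem_of_tmul_mem (Submodule.isClosed_topologicalClosure _)
      (fun a b => Submodule.le_topologicalClosure _ (Submodule.subset_span (Set.mem_range_self (a, b)))) x
  obtain ⟨y, hy, hxy⟩ := Metric.mem_closure_iff.mp h1 (ε / 2) (half_pos hε)
  rw [dist_eq_norm] at hxy
  have h2 : ‖y‖ ≤ C + ε / 2 := key y hy (by linarith) fun j k => by
    have h3 := NonUnitalStarAlgHom.norm_apply_le (rep (σ j) (ρ k))
      (y - x)
    rw [map_sub, norm_sub_rev y x] at h3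
    have h4 := norm_le_norm_sub_add (rep (σ j) (ρ k) y)
      (rep (σ j) (ρ k) x)
    linarith [h j k]
  linarith [norm_le_norm_sub_add x y]

/-- For a closed *-subalgebra `S`, the `b` with `a ⊗ b ∈ S` for all `a` form a closed *-subalgebra
of `B`. Closure under products uses that `a` is a limit of elements `a x`, together with `a x ⊗ b b'
= (a ⊗ b)(x ⊗ b')`. -/
theorem generates_tmul {Y : Type u} {g : Y → B} (hg : Generates g) :
    Generates fun x : A × Y => (tmul x.1 (g x.2) : MinTensor A B) := by
  refine (CStarGen.generates_gen (tensorClass A B)).of_forall_mem fun x => ?_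
  obtain ⟨a, b⟩ := x
  set S := cstarAdjoin (Set.range fun x : A × Y => (tmul x.1 (g x.2) : MinTensor A B))
  have hS : IsClosed (S : Set (MinTensor A B)) :=
    NonUnitalStarSubalgebra.isClosed_topologicalClosure _
  let S' : NonUnitalStarSubalgebra ℂ B :=
    { carrier := {b | ∀ a : A, tmul a b ∈ S}
      add_mem' := fun hb hb' a => by rw [tmul_add]; exact add_mem (hb a) (hb' a)
      zero_mem' := fun a => by
        have : tmul a (0 : B) = 0 := map_zero (tmulRight B a)
        rw [this]
        exact zero_mem _
      smul_mem' := fun c b hb a => by rw [tmul_smul]; exact SMulMemClass.smul_mem c (hb a)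
      mul_mem' := fun {b b'} hb hb' a =>
        mem_closure_mul a (S := S.toSubmodule.comap (tmulLeft A (b * b')).toLinearMap)
          (hS.preimage (tmulLeft A (b * b')).continuous) fun x => by
            change tmul (a * x) (b * b') ∈ S
            rw [← tmul_mul_tmul]
            exact mul_mem (hb a) (hb' x)
      star_mem' := fun {b} hb a => by
        have := star_mem (hb (star a))
        rwa [star_tmul, star_star] at this }
  have hS' : IsClosed (S' : Set B) := by
    have : (S' : Set B) = ⋂ a : A, (tmulRight B a) ⁻¹' S := by
      ext b
      simp only [Set.mem_iInter]
      rfl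
    rw [this]
    exact isClosed_iInter fun a => hS.preimage (tmulRight B a).continuous
  exact hg.mem S' hS' (fun y a => subset_cstarAdjoin _ ⟨(a, y), rfl⟩) b a

end MinTensor

theorem Generates.norm_map_eq {X : Type u} {A B C : Type*} [NonUnitalCStarAlgebra A]
    [NonUnitalCStarAlgebra B] [NonUnitalCStarAlgebra C] {g : X → A} (hg : Generates g)
    (φ : A →⋆ₙₐ[ℂ] B) (ψ : A →⋆ₙₐ[ℂ] C)
    (h : ∀ q : StarTerm X, ‖q.eval fun x => φ (g x)‖ = ‖q.eval fun x => ψ (g x)‖) (a : A) :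
    ‖φ a‖ = ‖ψ a‖ := by
  refine congrFun (DenseRange.equalizer hg (g := fun a => ‖φ a‖) (h := fun a => ‖ψ a‖)
    (map_continuous φ).norm (map_continuous ψ).norm (funext fun q => ?_)) a
  simp only [Function.comp_apply, StarTerm.map_eval]
  exact h q

theorem Generates.norm_rep_eq {X : Type u} {A : Type v} [NonUnitalCStarAlgebra A] {g : X → A}
    (hg : Generates g) {H K : Type w} [NormedAddCommGroup H] [InnerProductSpace ℂ H]
    [CompleteSpace H] [NormedAddCommGroup K] [InnerProductSpace ℂ K] [CompleteSpace K]
    (φ : A →⋆ₙₐ[ℂ] (H →L[ℂ] H)) (ψ : A →⋆ₙₐ[ℂ] (K →L[ℂ] K)) {S : X → H →L[ℂ] H}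
    {T : X → K →L[ℂ] K} (hφ : ∀ x, φ (g x) = S x) (hψ : ∀ x, ψ (g x) = T x)
    (h : ∀ q : StarTerm X, ‖q.eval S‖ = ‖q.eval T‖) (a : A) : ‖φ a‖ = ‖ψ a‖ :=
  hg.norm_map_eq φ ψ (fun q => by simpa only [hφ, hψ] using h q) a

/-! ### The reduced group C*-algebra -/

namespace RedGroupCStar

variable {Γ : Type u} [Group Γ]

variable (Γ) in
/-- The left regular representation. -/
def regularRep : HilbRep (RedGroupCStar Γ) where
  space := lp (fun _ : Γ => ℂ) 2
  hom := NonUnitalStarSubalgebraClass.subtype (cstarAdjoin (Set.range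
    (leftRegular : Γ → lp (fun _ : Γ => ℂ) 2 →L[ℂ] lp (fun _ : Γ => ℂ) 2)))

theorem regularRep_unit (s : Γ) : (regularRep Γ).hom (unit s) = leftRegular s := rfl

theorem regularRep_injective : Function.Injective (regularRep Γ).hom := Subtype.val_injective

theorem generates_unit : Generates (unit : Γ → RedGroupCStar Γ) :=
  Generates.subtype (leftRegular : Γ → lp (fun _ : Γ => ℂ) 2 →L[ℂ] lp (fun _ : Γ => ℂ) 2)

theorem unit_mul_unit (s t : Γ) : (unit s * unit t : RedGroupCStar Γ) = unit (s * t) :=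
  regularRep_injective <| by
    rw [map_mul]
    simp only [regularRep_unit, leftRegular]
    refine (diagTranslate_mul _ _ _ _ _ _ (D := 1) (fun t => by rw [mul_one, norm_one])).trans ?_
    simp only [mul_one]

theorem star_unit (s : Γ) : star (unit s : RedGroupCStar Γ) = unit s⁻¹ :=
  regularRep_injective <| by
    rw [map_star]
    exact star_leftRegular s

end RedGroupCStar

/-! ### Tensor products with the regular representation and the coproduct -/

section DualRep

variable {Γ : Type u} [Group Γ]

/-- The operator `S ⊗ λ_s` on `ℓ²(Γ, H)`. -/
abbrev tensorTranslate {H : Type v} [NormedAddCommGroup H] [InnerProductSpace ℂ H] (S : H →L[ℂ] H)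
    (s : Γ) : lp (fun _ : Γ => H) 2 →L[ℂ] lp (fun _ : Γ => H) 2 :=
  diagTranslate (fun _ : Γ => S) ‖S‖ (fun _ => le_rfl) s

variable {A : Type u} [NonUnitalCStarAlgebra A]

open MinTensor RedGroupCStar

/-- Only the picture changes: `π ⊗ λ` is moved from the completed tensor product to `ℓ²(Γ, H)`,
where the intertwiners for Fell absorption, for the diagonal and for the twist are given by
coordinate formulas. -/
theorem exists_dualRep (Γ : Type u) [Group Γ] (π : HilbRep A) :
    ∃ φ : MinTensor A (RedGroupCStar Γ) →⋆ₙₐ[ℂ]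
      (lp (fun _ : Γ => π.space) 2 →L[ℂ] lp (fun _ : Γ => π.space) 2),
      ∀ x : A × Γ, φ (tmul x.1 (unit x.2)) = tensorTranslate (π.hom x.1) x.2 :=
  (generates_tmul generates_unit).exists_hom _ fun q => by
    rw [← norm_eval_tensorOp_leftRegular (fun x : A × Γ => π.hom x.1) (fun x => ‖π.hom x.1‖)
      (fun _ _ => le_rfl) (fun x => x.2) q]
    refine le_trans (le_of_eq ?_) (NonUnitalStarAlgHom.norm_apply_le (rep π (regularRep Γ)) _)
    rw [StarTerm.map_eval]
    simp only [rep_tmul]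
    rfl

/-- The tensor product of a representation and the regular representation, on `ℓ²(Γ, H)`. -/
def dualRep (Γ : Type u) [Group Γ] (π : HilbRep A) : HilbRep (MinTensor A (RedGroupCStar Γ)) where
  space := lp (fun _ : Γ => π.space) 2
  hom := (exists_dualRep Γ π).choose

theorem dualRep_tmul (π : HilbRep A) (a : A) (s : Γ) :
    (dualRep Γ π).hom (tmul a (unit s)) = tensorTranslate (π.hom a) s :=
  (exists_dualRep Γ π).choose_spec (a, s)

theorem norm_dualRep (π : HilbRep A) (x : MinTensor A (RedGroupCStar Γ)) :
    ‖(dualRep Γ π).hom x‖ = ‖rep π (regularRep Γ) x‖ := by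
  exact (generates_tmul (A := A) (generates_unit (Γ := Γ))).norm_rep_eq
    (H := lp (fun _ : Γ => π.space) 2) (K := Completion (π.space ⊗[ℂ] (regularRep Γ).space))
    (dualRep Γ π).hom (rep π (regularRep Γ)) (fun x => dualRep_tmul π x.1 x.2)
    (fun x => rep_tmul _ _ x.1 _) (fun q => (norm_eval_tensorOp_leftRegular
      (fun x : A × Γ => π.hom x.1) (fun x => ‖π.hom x.1‖) (fun _ _ => le_rfl)
      (fun x => x.2) q).symm) x

/-- The regular representation is faithful on the reduced group algebra by definition, and the
minimal norm may be computed in any jointly injective representations of the two factors. -/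
theorem eq_zero_of_dualRep {J : Type*} (σ : J → HilbRep A)
    (hσ : ∀ a, (∀ j, (σ j).hom a = 0) → a = 0) {x : MinTensor A (RedGroupCStar Γ)}
    (h : ∀ j, (dualRep Γ (σ j)).hom x = 0) : x = 0 := by
  refine norm_le_zero_iff.mp ?_
  refine MinTensor.norm_le_of_jointly_injective σ hσ (fun _ : Unit => regularRep Γ)
    (fun b hb => regularRep_injective ((hb ()).trans (map_zero _).symm)) x le_rfl fun j _ => ?_
  rw [← norm_dualRep, h, norm_zero]

theorem norm_eval_tmul_unit_le {X : Type u} {J : Type*} (σ : J → HilbRep A)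
    (hσ : ∀ a, (∀ j, (σ j).hom a = 0) → a = 0) (g : X → A) (d : X → Γ) (q : StarTerm X) {C : ℝ}
    (hC : 0 ≤ C) (h : ∀ j, ‖q.eval fun x => tensorTranslate ((σ j).hom (g x)) (d x)‖ ≤ C) :
    ‖q.eval fun x => (tmul (g x) (unit (d x)) : MinTensor A (RedGroupCStar Γ))‖ ≤ C :=
  norm_le_of_jointly_injective (fun j => (dualRep Γ (σ j)).hom)
    (fun _ ha => eq_zero_of_dualRep σ hσ ha) hC fun j => by
      rw [StarTerm.map_eval]
      simp only [dualRep_tmul]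
      exact h j

theorem HilbRep.jointly_injective {a : A} (h : ∀ π : HilbRep A, π.hom a = 0) : a = 0 := by
  by_contra ha
  obtain ⟨π, hπ⟩ := HilbRep.exists_apply_ne_zero ha
  exact hπ (h π)

/-- The *-homomorphism `1 ⊗ δ_Γ`. -/
theorem exists_coproduct (Γ : Type u) [Group Γ] (A : Type u) [NonUnitalCStarAlgebra A] :
    ∃ Δ : MinTensor A (RedGroupCStar Γ) →⋆ₙₐ[ℂ]
      MinTensor (MinTensor A (RedGroupCStar Γ)) (RedGroupCStar Γ),
    ∀ x : A × Γ, Δ (tmul x.1 (unit x.2)) = tmul (tmul x.1 (unit x.2)) (unit x.2) :=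
  (generates_tmul generates_unit).exists_hom _ fun q => by
    refine norm_eval_tmul_unit_le (fun π : HilbRep A => dualRep Γ π)
      (fun _ h => eq_zero_of_dualRep (fun π : HilbRep A => π)
        (fun _ h => HilbRep.jointly_injective h) h) _ _ q
      (norm_nonneg _) fun π => ?_
    -- Fell absorption with constant diagonal entries: `(π(a) ⊗ λ_s) ⊗ λ_s` is dominated by `π(a) ⊗
    -- λ_s`, which is the bound needed for the existence of the coproduct.
    have h1 := norm_eval_diagTranslate_diagTranslate_le
      (fun (x : A × Γ) (_ : Γ) => π.hom x.1) (fun x => ‖π.hom x.1‖) (fun _ _ => le_rfl)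
      (fun x => x.2) (fun x => ‖tensorTranslate (π.hom x.1) x.2‖) (fun _ _ => le_rfl) q
    simp only [dualRep_tmul]
    refine h1.trans (le_trans (le_of_eq ?_)
      (NonUnitalStarAlgHom.norm_apply_le (dualRep Γ π).hom _))
    rw [StarTerm.map_eval]
    simp only [dualRep_tmul]
    rfl

/-! ### Construction of actions of the dual -/

/-- `a` is mapped to `a ⊗ λ_s`. -/
def IsHomogeneous (δ : A →⋆ₙₐ[ℂ] MinTensor A (RedGroupCStar Γ)) (s : Γ) (a : A) : Prop :=
  δ a = tmul a (unit s)

variable {δ : A →⋆ₙₐ[ℂ] MinTensor A (RedGroupCStar Γ)}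

theorem IsHomogeneous.mul {s t : Γ} {a b : A} (ha : IsHomogeneous δ s a)
    (hb : IsHomogeneous δ t b) : IsHomogeneous δ (s * t) (a * b) := by
  unfold IsHomogeneous at *
  rw [map_mul, ha, hb, tmul_mul_tmul, unit_mul_unit]

theorem IsHomogeneous.star {s : Γ} {a : A} (ha : IsHomogeneous δ s a) :
    IsHomogeneous δ s⁻¹ (star a) := by
  unfold IsHomogeneous at *
  rw [map_star, ha, star_tmul, star_unit]

/-- Closed subspaces containing the homogeneous elements. -/
theorem Generates.mem_of_isHomogeneous {X : Type u} {g : X → A} (hg : Generates g) {d : X → Γ}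
    (h : ∀ x, IsHomogeneous δ (d x) (g x)) {S : Submodule ℂ A} (hS : IsClosed (S : Set A))
    (hTS : ∀ s a, IsHomogeneous δ s a → a ∈ S) (a : A) : a ∈ S :=
  hg.mem_of_mul_star (T := {a | ∃ s, IsHomogeneous δ s a}) (fun x => ⟨_, h x⟩)
    (fun _ ⟨_, ha⟩ _ ⟨_, hb⟩ => ⟨_, ha.mul hb⟩) (fun _ ⟨_, ha⟩ => ⟨_, ha.star⟩) hS
    (fun _ ⟨_, ha⟩ => hTS _ _ ha) a

theorem mem_of_tmul_unit_mem {S : Submodule ℂ (MinTensor A (RedGroupCStar Γ))}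
    (hS : IsClosed (S : Set (MinTensor A (RedGroupCStar Γ))))
    (h : ∀ a s, tmul a (unit s) ∈ S) (x : MinTensor A (RedGroupCStar Γ)) : x ∈ S :=
  mem_of_tmul_mem hS (fun a b =>
    generates_unit.mem_of_mul_star (T := Set.range unit) Set.mem_range_self
      (by rintro _ ⟨s, rfl⟩ _ ⟨t, rfl⟩; exact ⟨_, (unit_mul_unit s t).symm⟩)
      (by rintro _ ⟨s, rfl⟩; exact ⟨_, (star_unit s).symm⟩)
      (S := S.comap (tmulRight (RedGroupCStar Γ) a).toLinearMap)
      (hS.preimage (tmulRight (RedGroupCStar Γ) a).continuous)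
      (by rintro _ ⟨s, rfl⟩; exact h a s) b) x

/-- A *-homomorphism which maps generators `a` to elements `a ⊗ λ_s` is nondegenerate. -/
theorem mem_of_mul_mul_mem {X : Type u} {g : X → A} (hg : Generates g) {d : X → Γ}
    (h : ∀ x, IsHomogeneous δ (d x) (g x)) {S : Submodule ℂ (MinTensor A (RedGroupCStar Γ))}
    (hS : IsClosed (S : Set (MinTensor A (RedGroupCStar Γ))))
    (hS' : ∀ a b y, δ a * y * δ b ∈ S) (x : MinTensor A (RedGroupCStar Γ)) : x ∈ S := by
  refine mem_of_tmul_unit_mem hS (fun c r => ?_) x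
  have h1 (x b : A) (t : Γ) (hb : IsHomogeneous δ t b) (a : A) :
      tmul (a * (x * b)) (unit r) ∈ S :=
    hg.mem_of_isHomogeneous h
      (S := S.comap ((tmulLeft A (unit r)).comp
        ((ContinuousLinearMap.mul ℂ A).flip (x * b))).toLinearMap)
      (hS.preimage ((tmulLeft A (unit r)).comp
        ((ContinuousLinearMap.mul ℂ A).flip (x * b))).continuous)
      (fun s a ha => by
        change tmul (a * (x * b)) (unit r) ∈ S
        -- The outer factors contribute the degrees `s` and `t`, so the middle factor needs the
        -- degree `s⁻¹ r t⁻¹`. This is the only place where homogeneity of `a` and `b` enters.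
        have h2 : (tmul (a * (x * b)) (unit r) : MinTensor A (RedGroupCStar Γ)) =
            δ a * tmul x (unit (s⁻¹ * r * t⁻¹)) * δ b := by
          rw [ha, hb, tmul_mul_tmul, tmul_mul_tmul, unit_mul_unit, unit_mul_unit, mul_assoc a]
          simp [mul_assoc]
        rw [h2]
        exact hS' _ _ _) a
  have h2 (a x b : A) : tmul (a * x * b) (unit r) ∈ S :=
    hg.mem_of_isHomogeneous h
      (S := S.comap ((tmulLeft A (unit r)).comp (ContinuousLinearMap.mul ℂ A (a * x))).toLinearMap)
      (hS.preimage ((tmulLeft A (unit r)).comp (ContinuousLinearMap.mul ℂ A (a * x))).continuous)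
      (fun s b hb => by
        change tmul (a * x * b) (unit r) ∈ S
        rw [mul_assoc]
        exact h1 x b s hb a) b
  have hS'' : IsClosed (S.comap (tmulLeft A (unit r)).toLinearMap : Set A) :=
    hS.preimage (tmulLeft A (unit r)).continuous
  -- Approximate units remove the two additional right factors, first `y` and then `x`.
  exact mem_closure_mul c hS'' fun x => mem_closure_mul (c * x) hS'' fun y => h2 c x y

/-- A *-homomorphism which maps generators `a` to elements `a ⊗ λ_s` is an action. -/
def DualAction.ofHom {X : Type u} {g : X → A} (hg : Generates g) (d : X → Γ)
    (δ : A →⋆ₙₐ[ℂ] MinTensor A (RedGroupCStar Γ)) (h : ∀ x, IsHomogeneous δ (d x) (g x)) :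
    DualAction Γ A where
  δ := δ
  nondegenerate := Submodule.eq_top_iff'.mpr <|
    mem_of_mul_mul_mem hg h (Submodule.isClosed_topologicalClosure _) fun a b y =>
      Submodule.le_topologicalClosure _ (Submodule.subset_span ⟨a, b, y, rfl⟩)
  coassociative := by
    obtain ⟨Δ, hΔ⟩ := exists_coproduct Γ A
    refine ⟨Δ, fun a s => hΔ (a, s), fun a => ?_⟩
    refine DFunLike.congr_fun (hg.hom_ext (φ := (MinTensor.map δ (NonUnitalStarAlgHom.id ℂ _)).comp δ)
      (ψ := Δ.comp δ) fun x => ?_) a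
    rw [NonUnitalStarAlgHom.comp_apply, NonUnitalStarAlgHom.comp_apply, h, map_tmul, h]
    exact (hΔ (g x, d x)).symm

/-- Construction of an action from norm estimates in jointly injective representations. -/
theorem exists_dualAction {X : Type u} {g : X → A} (hg : Generates g) (d : X → Γ) {J : Type*}
    (σ : J → HilbRep A) (hσ : ∀ a, (∀ j, (σ j).hom a = 0) → a = 0)
    (h : ∀ j (q : StarTerm X), ‖q.eval fun x => tensorTranslate ((σ j).hom (g x)) (d x)‖ ≤ ‖q.eval g‖) :
    ∃ δ : DualAction Γ A, ∀ x, IsHomogeneous δ.δ (d x) (g x) := by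
  obtain ⟨δ, hδ⟩ := hg.exists_hom (fun x => (tmul (g x) (unit (d x)) : MinTensor A _)) fun q =>
    norm_eval_tmul_unit_le σ hσ g d q (norm_nonneg _) fun j => h j q
  exact ⟨DualAction.ofHom hg d δ hδ, hδ⟩

/-- Actions restrict to subalgebras generated by homogeneous elements. -/
theorem exists_dualAction_of_injective {P : Type u} [NonUnitalCStarAlgebra P] (φ : P →⋆ₙₐ[ℂ] A)
    (hφ : Function.Injective φ) {X : Type u} {p : X → P} (hp : Generates p) (d : X → Γ)
    (h : ∀ x, IsHomogeneous δ (d x) (φ (p x))) :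
    ∃ δP : DualAction Γ P, ∀ x, IsHomogeneous δP.δ (d x) (p x) :=
  -- The representations `π ∘ φ` separate the points of `P`, and on them the required estimate is
  -- the contractivity of `(π ⊗ λ) ∘ δ ∘ φ`. It need not be known in advance that `δ` maps the image
  -- of `P` into a tensor product with that image.
  exists_dualAction hp d (fun π : HilbRep A => ⟨π.space, π.hom.comp φ⟩)
    (fun a ha => hφ ((HilbRep.jointly_injective ha).trans (map_zero φ).symm)) fun π q => by
      have h1 := NonUnitalStarAlgHom.norm_apply_le (((dualRep Γ π).hom.comp δ).comp φ) (q.eval p)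
      rw [StarTerm.map_eval] at h1
      have h2 : (fun x => (((dualRep Γ π).hom.comp δ).comp φ) (p x)) =
          fun x => (tensorTranslate (π.hom (φ (p x))) (d x) :
            (dualRep Γ π).space →L[ℂ] (dualRep Γ π).space) :=
        funext fun x => (congrArg (dualRep Γ π).hom (h x)).trans (dualRep_tmul π _ _)
      rw [h2] at h1
      exact h1

end DualRep

section

attribute [local instance] cstarMatrixAlgebra

/-! ### Matrix units -/

section MatrixUnits

variable {A : Type u} [NonUnitalCStarAlgebra A]

/-- The entries of a matrix. -/
def matrixEntry (A : Type u) [NonUnitalCStarAlgebra A] (k l : Fin 2) :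
    CStarMatrix (Fin 2) (Fin 2) A →L[ℂ] A where
  toFun m := m k l
  map_add' _ _ := rfl
  map_smul' _ _ := rfl
  cont := continuous_apply_apply k l

/-- The matrix with a single entry. -/
def matrixUnit (A : Type u) [NonUnitalCStarAlgebra A] (k l : Fin 2) :
    A →L[ℂ] CStarMatrix (Fin 2) (Fin 2) A where
  toFun a := CStarMatrix.ofMatrix (Matrix.single k l a)
  map_add' a b := congrArg CStarMatrix.ofMatrix (Matrix.single_add k l a b)
  map_smul' c a := congrArg CStarMatrix.ofMatrix (Matrix.smul_single c k l a).symm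
  cont := by
    refine continuous_pi fun i => continuous_pi fun j => ?_
    change Continuous fun a : A => Matrix.single k l a i j
    simp only [Matrix.single_apply]
    split_ifs
    · exact continuous_id
    · exact continuous_const

theorem matrixUnit_apply (k l i j : Fin 2) (a : A) :
    matrixUnit A k l a i j = if k = i ∧ l = j then a else 0 := Matrix.single_apply ..

theorem matrixUnit_apply_same (k l : Fin 2) (a : A) : matrixUnit A k l a k l = a := by
  simp [matrixUnit_apply]

theorem matrixUnit_mul_matrixUnit (k l m : Fin 2) (a b : A) :
    matrixUnit A k l a * matrixUnit A l m b = matrixUnit A k m (a * b) :=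
  congrArg CStarMatrix.ofMatrix (Matrix.single_mul_single_same (c := a) k l m b)

theorem star_matrixUnit (k l : Fin 2) (a : A) :
    star (matrixUnit A k l a) = matrixUnit A l k (star a) := by
  ext i j
  rw [CStarMatrix.star_apply, matrixUnit_apply, matrixUnit_apply]
  simp only [and_comm]
  split_ifs <;> simp

theorem sum_matrixUnit (m : CStarMatrix (Fin 2) (Fin 2) A) :
    ∑ k, ∑ l, matrixUnit A k l (m k l) = m := by
  ext i j
  simp only [Fin.sum_univ_two, CStarMatrix.add_apply, matrixUnit_apply]
  fin_cases i <;> fin_cases j <;> simp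

/-- The diagonal corners of the matrix algebra. -/
def matrixDiagonal (A : Type u) [NonUnitalCStarAlgebra A] (k : Fin 2) :
    A →⋆ₙₐ[ℂ] CStarMatrix (Fin 2) (Fin 2) A where
  toFun := matrixUnit A k k
  map_smul' := map_smul (matrixUnit A k k)
  map_zero' := map_zero _
  map_add' := map_add _
  map_mul' a b := (matrixUnit_mul_matrixUnit k k k a b).symm
  map_star' a := (star_matrixUnit k k a).symm

theorem eq_matrixUnit (k l : Fin 2) {m : CStarMatrix (Fin 2) (Fin 2) A}
    (h : ∀ i j, (i, j) ≠ (k, l) → m i j = 0) : m = matrixUnit A k l (m k l) := by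
  ext i j
  rw [matrixUnit_apply]
  split_ifs with h1
  · rw [h1.1, h1.2]
  · exact h i j fun h2 => h1 ⟨(congrArg Prod.fst h2).symm, (congrArg Prod.snd h2).symm⟩

end MatrixUnits

/-! ### Actions on subalgebras of the matrix algebra -/

section MatrixRep

variable {Γ : Type u} [Group Γ] {A : Type u} [NonUnitalCStarAlgebra A]

open MinTensor RedGroupCStar

/-- Matrices and translations act on different indices. When all entries have the common degree `s`,
exchanging the two `ℓ²`-sums identifies the entrywise `π(m k l) ⊗ λ_s` with the single operator
`π(m) ⊗ λ_s`. -/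
theorem matrixRep_reindex {H : Type v} [NormedAddCommGroup H] [InnerProductSpace ℂ H]
    [CompleteSpace H] (π : A →⋆ₙₐ[ℂ] (H →L[ℂ] H))
    (σ : A →⋆ₙₐ[ℂ] (lp (fun _ : Γ => H) 2 →L[ℂ] lp (fun _ : Γ => H) 2)) (s : Γ)
    (m : CStarMatrix (Fin 2) (Fin 2) A)
    (hm : ∀ k l, σ (m k l) = tensorTranslate (π (m k l)) s)
    (ξ : lp (fun _ : Γ => lp (fun _ : Fin 2 => H) 2) 2) :
    matrixRep (Fin 2) σ m (lp.reindex (Equiv.prodComm (Fin 2) Γ) ξ) =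
      lp.reindex (Equiv.prodComm (Fin 2) Γ) (tensorTranslate (matrixRep (Fin 2) π m) s ξ) := by
  ext k t
  rw [lp.reindex_apply, diagTranslate_apply, matrixRep_apply, lp.coeFn_sum, Finset.sum_apply]
  simp only [hm]
  exact (matrixRep_apply π m (ξ (s⁻¹ * t)) k).symm

theorem star_matrixRep_reindex {H : Type v} [NormedAddCommGroup H] [InnerProductSpace ℂ H]
    [CompleteSpace H] (π : A →⋆ₙₐ[ℂ] (H →L[ℂ] H))
    (σ : A →⋆ₙₐ[ℂ] (lp (fun _ : Γ => H) 2 →L[ℂ] lp (fun _ : Γ => H) 2)) (s : Γ)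
    (m : CStarMatrix (Fin 2) (Fin 2) A)
    (hm : ∀ k l, σ (m k l) = tensorTranslate (π (m k l)) s)
    (ξ : lp (fun _ : Γ => lp (fun _ : Fin 2 => H) 2) 2) :
    star (matrixRep (Fin 2) σ m) (lp.reindex (Equiv.prodComm (Fin 2) Γ) ξ) =
      lp.reindex (Equiv.prodComm (Fin 2) Γ)
        (star (tensorTranslate (matrixRep (Fin 2) π m) s) ξ) := by
  have h1 := matrixRep_reindex π σ s⁻¹ (star m) (fun k l => by
    rw [CStarMatrix.star_apply, map_star, hm, star_diagTranslate, map_star]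
    rfl) ξ
  rw [map_star] at h1
  rw [h1, star_diagTranslate]
  simp only [← map_star]
  rfl

/-- Actions on subalgebras of the matrix algebra which are generated by matrices with homogeneous
entries. -/
theorem exists_dualAction_matrix (δ : A →⋆ₙₐ[ℂ] MinTensor A (RedGroupCStar Γ)) {X : Type u}
    (g : X → CStarMatrix (Fin 2) (Fin 2) A) (d : X → Γ)
    (hg : ∀ x k l, IsHomogeneous δ (d x) (g x k l)) :
    ∃ ε : DualAction Γ (cstarAdjoin (Set.range g)),
      ∀ x, IsHomogeneous ε.δ (d x) ⟨g x, subset_cstarAdjoin _ ⟨x, rfl⟩⟩ := by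
  let i := NonUnitalStarSubalgebraClass.subtype (cstarAdjoin (Set.range g))
  refine exists_dualAction (Generates.subtype g) d
    (fun π : HilbRep A => ⟨lp (fun _ : Fin 2 => π.space) 2, (matrixRep (Fin 2) π.hom).comp i⟩)
    (fun a ha => Subtype.ext (eq_zero_of_matrixRep (fun π : HilbRep A => π)
      (fun _ h => HilbRep.jointly_injective h) _ ha)) fun π q => ?_
  -- Applying `(π ⊗ λ) ∘ δ` entrywise is a representation of the matrix algebra, hence contractive.
  -- This bounds the polynomials in `g x ⊗ λ` without any matrix amplification of `δ` itself.
  let σ : A →⋆ₙₐ[ℂ] (lp (fun _ : Γ => π.space) 2 →L[ℂ] lp (fun _ : Γ => π.space) 2) :=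
    (dualRep Γ π).hom.comp δ
  have hσ (x : X) (k l : Fin 2) : σ (g x k l) = tensorTranslate (π.hom (g x k l)) (d x) :=
    (congrArg (dualRep Γ π).hom (hg x k l)).trans (dualRep_tmul π _ _)
  have h1 := norm_eval_le_of_intertwine
    (H := lp (fun _ : Γ => lp (fun _ : Fin 2 => π.space) 2) 2)
    (K := lp (fun _ : Fin 2 => lp (fun _ : Γ => π.space) 2) 2)
    (S := fun x => tensorTranslate (matrixRep (Fin 2) π.hom (g x)) (d x))
    (T := fun x => matrixRep (Fin 2) σ (g x)) (lp.reindex (Equiv.prodComm (Fin 2) Γ))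
    (fun x ξ => matrixRep_reindex π.hom σ (d x) (g x) (hσ x) ξ)
    (fun x ξ => star_matrixRep_reindex π.hom σ (d x) (g x) (hσ x) ξ) q
  have h2 := NonUnitalStarAlgHom.norm_apply_le ((matrixRep (Fin 2) σ).comp i)
    (q.eval fun x => ⟨g x, subset_cstarAdjoin _ ⟨x, rfl⟩⟩)
  rw [StarTerm.map_eval] at h2
  exact h1.trans h2

end MatrixRep

end

section

attribute [local instance] cstarMatrixAlgebra

/-- A *-homomorphism of C*-algebras as a continuous linear map. -/
def NonUnitalStarAlgHom.toCLM {A : Type v} {B : Type w} [NonUnitalCStarAlgebra A]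
    [NonUnitalCStarAlgebra B] (φ : A →⋆ₙₐ[ℂ] B) : A →L[ℂ] B where
  toFun := φ
  map_add' := map_add φ
  map_smul' := map_smul φ
  cont := map_continuous φ

/-! ### The linking algebra of a full corner -/

section Corner

variable {C : Type u} [NonUnitalCStarAlgebra C] (b : C)

/-- Left multiplication by `b` if `k = 0`, the identity if `k = 1`. -/
def cornerLeft (k : Fin 2) : C →L[ℂ] C := if k = 0 then ContinuousLinearMap.mul ℂ C b else .id ℂ C

/-- Right multiplication by `b` if `k = 0`, the identity if `k = 1`. -/
def cornerRight (k : Fin 2) : C →L[ℂ] C :=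
  if k = 0 then (ContinuousLinearMap.mul ℂ C).flip b else .id ℂ C

theorem cornerLeft_mul (k : Fin 2) (x y : C) : cornerLeft b k (x * y) = cornerLeft b k x * y := by
  unfold cornerLeft
  split_ifs
  · exact (mul_assoc b x y).symm
  · rfl

theorem cornerRight_mul (k : Fin 2) (x y : C) :
    cornerRight b k (x * y) = x * cornerRight b k y := by
  unfold cornerRight
  split_ifs
  · exact mul_assoc x y b
  · rfl

theorem cornerLeft_cornerRight (k l : Fin 2) (x : C) :
    cornerLeft b k (cornerRight b l x) = cornerRight b l (cornerLeft b k x) := by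
  unfold cornerLeft cornerRight
  split_ifs
  · exact (mul_assoc b x b).symm
  all_goals rfl

variable {b} in
theorem star_cornerLeft (hb : star b = b) (k : Fin 2) (x : C) :
    star (cornerLeft b k x) = cornerRight b k (star x) := by
  unfold cornerLeft cornerRight
  split_ifs
  · exact (star_mul b x).trans (by rw [hb]; rfl)
  · rfl

variable {b} in
theorem star_cornerRight (hb : star b = b) (k : Fin 2) (x : C) :
    star (cornerRight b k x) = cornerLeft b k (star x) := by
  rw [← star_star (cornerLeft b k (star x)), star_cornerLeft hb, star_star]

/-- The map `x ↦ b_k x b_l`, where `b_0 = b` and `b_1 = 1`. -/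
def cornerMap (k l : Fin 2) : C →L[ℂ] C := (cornerLeft b k).comp (cornerRight b l)

theorem cornerMap_apply (k l : Fin 2) (x : C) :
    cornerMap b k l x = cornerLeft b k (cornerRight b l x) := rfl

theorem cornerMap_mul_cornerMap (k i j l : Fin 2) (x y : C) :
    cornerMap b k i x * cornerMap b j l y =
      cornerMap b k l (cornerRight b i x * cornerLeft b j y) := by
  rw [cornerMap_apply, cornerMap_apply, cornerMap_apply, ← cornerLeft_mul, cornerRight_mul,
    cornerLeft_cornerRight b j l]

variable {b} in
theorem star_cornerMap (hb : star b = b) (k l : Fin 2) (x : C) :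
    star (cornerMap b k l x) = cornerMap b l k (star x) := by
  rw [cornerMap_apply, cornerMap_apply, star_cornerLeft hb, star_cornerRight hb,
    cornerLeft_cornerRight]

/-- The closure of `b_k C b_l`. -/
def corner (k l : Fin 2) : Submodule ℂ C :=
  (LinearMap.range (cornerMap b k l).toLinearMap).topologicalClosure

theorem mem_corner {k l : Fin 2} {x : C} :
    x ∈ corner b k l ↔ x ∈ closure (Set.range (cornerMap b k l)) := Iff.rfl

theorem cornerMap_mem (k l : Fin 2) (x : C) : cornerMap b k l x ∈ corner b k l :=
  subset_closure ⟨x, rfl⟩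

theorem isClosed_corner (k l : Fin 2) : IsClosed (corner b k l : Set C) :=
  Submodule.isClosed_topologicalClosure _

theorem mul_mem_corner {k i j l : Fin 2} {x y : C} (hx : x ∈ corner b k i)
    (hy : y ∈ corner b j l) : x * y ∈ corner b k l := by
  rw [mem_corner] at *
  refine map_mem_closure₂ continuous_mul hx hy ?_
  rintro _ ⟨x, rfl⟩ _ ⟨y, rfl⟩
  exact ⟨_, (cornerMap_mul_cornerMap b k i j l x y).symm⟩

variable {b} in
theorem star_mem_corner (hb : star b = b) {k l : Fin 2} {x : C} (hx : x ∈ corner b k l) :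
    star x ∈ corner b l k := by
  rw [mem_corner] at *
  refine map_mem_closure continuous_star hx ?_
  rintro _ ⟨x, rfl⟩
  exact ⟨_, (star_cornerMap hb k l x).symm⟩

/-- The matrices with entries in the corners. -/
def cornerSubalgebra (hb : star b = b) :
    NonUnitalStarSubalgebra ℂ (CStarMatrix (Fin 2) (Fin 2) C) where
  carrier := {m | ∀ k l, m k l ∈ corner b k l}
  add_mem' hx hy k l := add_mem (hx k l) (hy k l)
  zero_mem' k l := zero_mem (corner b k l)
  smul_mem' c _ hx k l := Submodule.smul_mem _ c (hx k l)
  mul_mem' hx hy k l := by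
    rw [CStarMatrix.mul_apply]
    exact Submodule.sum_mem _ fun j _ => mul_mem_corner b (hx k j) (hy j l)
  star_mem' hx k l := by
    rw [CStarMatrix.star_apply]
    exact star_mem_corner hb (hx l k)

theorem isClosed_cornerSubalgebra (hb : star b = b) :
    IsClosed (cornerSubalgebra b hb : Set (CStarMatrix (Fin 2) (Fin 2) C)) := by
  have : (cornerSubalgebra b hb : Set (CStarMatrix (Fin 2) (Fin 2) C)) =
      ⋂ k, ⋂ l, matrixEntry C k l ⁻¹' corner b k l := by
    ext m
    simp only [Set.mem_iInter]
    rfl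
  rw [this]
  exact isClosed_iInter fun k => isClosed_iInter fun l =>
    (isClosed_corner b k l).preimage (matrixEntry C k l).continuous

variable {Γ : Type u} [Group Γ] (δ : C →⋆ₙₐ[ℂ] MinTensor C (RedGroupCStar Γ))

/-- The homogeneous elements of the corners. -/
abbrev CornerIndex : Type u :=
  {x : (Fin 2 × Fin 2) × Γ × C // x.2.2 ∈ corner b x.1.1 x.1.2 ∧ IsHomogeneous δ x.2.1 x.2.2}

/-- The matrices with a single homogeneous entry. -/
def linkingGen (x : CornerIndex b δ) : CStarMatrix (Fin 2) (Fin 2) C :=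
  matrixUnit C x.1.1.1 x.1.1.2 x.1.2.2

/-- The linking algebra. -/
abbrev linkingAlgebra : NonUnitalStarSubalgebra ℂ (CStarMatrix (Fin 2) (Fin 2) C) :=
  cstarAdjoin (Set.range (linkingGen b δ))

variable {b δ}

theorem mem_corner_of_mem_linkingAlgebra (hb : star b = b)
    {m : CStarMatrix (Fin 2) (Fin 2) C} (hm : m ∈ linkingAlgebra b δ) (k l : Fin 2) :
    m k l ∈ corner b k l := by
  have h1 : linkingAlgebra b δ ≤ cornerSubalgebra b hb := by
    refine NonUnitalStarSubalgebra.topologicalClosure_minimal _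
      (NonUnitalStarAlgebra.adjoin_le ?_) (isClosed_cornerSubalgebra b hb)
    rintro _ ⟨x, rfl⟩ k l
    rw [linkingGen, matrixUnit_apply]
    split_ifs with h
    · rw [← h.1, ← h.2]
      exact x.2.1
    · exact zero_mem _
  exact h1 hm k l

theorem isHomogeneous_zero (s : Γ) : IsHomogeneous δ s 0 := by
  unfold IsHomogeneous
  rw [map_zero]
  exact (map_zero (MinTensor.tmulLeft C (RedGroupCStar.unit s))).symm

theorem isHomogeneous_cornerMap (hδ : IsHomogeneous δ 1 b) (k l : Fin 2) {s : Γ} {x : C}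
    (hx : IsHomogeneous δ s x) : IsHomogeneous δ s (cornerMap b k l x) := by
  have h1 {x : C} (hx : IsHomogeneous δ s x) : IsHomogeneous δ s (cornerRight b l x) := by
    unfold cornerRight
    split_ifs
    · have := hx.mul hδ
      rwa [mul_one] at this
    · exact hx
  have h2 {x : C} (hx : IsHomogeneous δ s x) : IsHomogeneous δ s (cornerLeft b k x) := by
    unfold cornerLeft
    split_ifs
    · have := hδ.mul hx
      rwa [one_mul] at this
    · exact hx
  exact h2 (h1 hx)

variable {Y : Type u} {g : Y → C} (hg : Generates g) {d : Y → Γ}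
  (hd : ∀ y, IsHomogeneous δ (d y) (g y)) (hδ : IsHomogeneous δ 1 b)

include hg hd hδ

/-- The linear span of the homogeneous generators with one fixed nonzero entry is dense. -/
theorem matrixUnit_mem_of_linkingGen_mem {k l : Fin 2}
    {S : Submodule ℂ (CStarMatrix (Fin 2) (Fin 2) C)}
    (hS : IsClosed (S : Set (CStarMatrix (Fin 2) (Fin 2) C)))
    (h : ∀ s y, y ∈ corner b k l → IsHomogeneous δ s y → matrixUnit C k l y ∈ S) {y : C}
    (hy : y ∈ corner b k l) : matrixUnit C k l y ∈ S := by
  have h1 (x : C) : matrixUnit C k l (cornerMap b k l x) ∈ S :=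
    hg.mem_of_isHomogeneous hd
      (S := S.comap ((matrixUnit C k l).comp (cornerMap b k l)).toLinearMap)
      (hS.preimage ((matrixUnit C k l).comp (cornerMap b k l)).continuous)
      (fun s a ha => h s _ (cornerMap_mem b k l a) (isHomogeneous_cornerMap hδ k l ha)) x
  have h2 : closure (Set.range (cornerMap b k l)) ⊆ matrixUnit C k l ⁻¹' S :=
    closure_minimal (by rintro _ ⟨x, rfl⟩; exact h1 x) (hS.preimage (matrixUnit C k l).continuous)
  exact h2 hy

/-- The linking algebra is generated by homogeneous entries only, so that its action of the dual can
be constructed. Nothing is lost: homogeneous elements span a dense subspace of `C`, and since `b`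
has degree `1`, the elements `b_k x b_l` are homogeneous together with `x`. -/
theorem matrixUnit_mem_linkingAlgebra {k l : Fin 2} {y : C} (hy : y ∈ corner b k l) :
    matrixUnit C k l y ∈ linkingAlgebra b δ :=
  matrixUnit_mem_of_linkingGen_mem hg hd hδ (S := (linkingAlgebra b δ).toSubmodule)
    (NonUnitalStarSubalgebra.isClosed_topologicalClosure _)
    (fun s y hy h => subset_cstarAdjoin _ ⟨⟨((k, l), s, y), hy, h⟩, rfl⟩) hy

omit hg hd hδ

variable (b δ) in
/-- The elements of the linking algebra with one fixed nonzero entry. -/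
def linkingEntry (k l : Fin 2) : Submodule ℂ (linkingAlgebra b δ) where
  carrier := {m | ∀ i j, (i, j) ≠ (k, l) → (m : CStarMatrix (Fin 2) (Fin 2) C) i j = 0}
  add_mem' hx hy i j h := by
    change (_ : C) + _ = 0
    rw [hx i j h, hy i j h, add_zero]
  zero_mem' _ _ _ := rfl
  smul_mem' c x hx i j h := by
    change c • (_ : C) = 0
    rw [hx i j h, smul_zero]

variable (b δ) in
/-- The entries of elements of the linking algebra. -/
def linkingCoord (k l : Fin 2) : linkingAlgebra b δ →L[ℂ] C where
  toFun m := (m : CStarMatrix (Fin 2) (Fin 2) C) k l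
  map_add' _ _ := rfl
  map_smul' _ _ := rfl
  cont := (matrixEntry C k l).continuous.comp continuous_subtype_val

theorem linkingCoord_mul (k l : Fin 2) (x y : linkingAlgebra b δ) :
    linkingCoord b δ k l (x * y) = ∑ j, linkingCoord b δ k j x * linkingCoord b δ j l y :=
  CStarMatrix.mul_apply

theorem isClosed_linkingEntry (k l : Fin 2) :
    IsClosed (linkingEntry b δ k l : Set (linkingAlgebra b δ)) := by
  have : (linkingEntry b δ k l : Set (linkingAlgebra b δ)) =
      ⋂ i, ⋂ j, ⋂ _ : (i, j) ≠ (k, l), linkingCoord b δ i j ⁻¹' {0} := by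
    ext m
    simp only [Set.mem_iInter]
    rfl
  rw [this]
  exact isClosed_iInter fun i => isClosed_iInter fun j => isClosed_iInter fun _ =>
    isClosed_singleton.preimage (linkingCoord b δ i j).continuous

theorem coe_eq_matrixUnit {k l : Fin 2} {m : linkingAlgebra b δ} (hm : m ∈ linkingEntry b δ k l) :
    (m : CStarMatrix (Fin 2) (Fin 2) C) = matrixUnit C k l (linkingCoord b δ k l m) :=
  eq_matrixUnit k l hm

theorem mem_linkingEntry_of_coe_eq {k l : Fin 2} {m : linkingAlgebra b δ} {y : C}
    (hm : (m : CStarMatrix (Fin 2) (Fin 2) C) = matrixUnit C k l y) :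
    m ∈ linkingEntry b δ k l := fun i j h => by
  rw [hm, matrixUnit_apply, if_neg]
  rintro ⟨rfl, rfl⟩
  exact h rfl

theorem star_mem_linkingEntry {k l : Fin 2} {x : linkingAlgebra b δ}
    (hx : x ∈ linkingEntry b δ k l) : star x ∈ linkingEntry b δ l k :=
  mem_linkingEntry_of_coe_eq (y := star (linkingCoord b δ k l x)) <| by
    rw [← star_matrixUnit, ← coe_eq_matrixUnit hx]
    rfl

theorem mul_mem_linkingEntry {k l m : Fin 2} {x y : linkingAlgebra b δ}
    (hx : x ∈ linkingEntry b δ k l) (hy : y ∈ linkingEntry b δ l m) :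
    x * y ∈ linkingEntry b δ k m :=
  mem_linkingEntry_of_coe_eq
    (y := linkingCoord b δ k l x * linkingCoord b δ l m y) <| by
    rw [← matrixUnit_mul_matrixUnit, ← coe_eq_matrixUnit hx, ← coe_eq_matrixUnit hy]
    rfl

theorem mul_eq_zero_of_linkingEntry {k l l' m : Fin 2} (hl : l ≠ l') {x y : linkingAlgebra b δ}
    (hx : x ∈ linkingEntry b δ k l) (hy : y ∈ linkingEntry b δ l' m) : x * y = 0 := by
  refine Subtype.ext (CStarMatrix.ext fun i j => ?_)
  refine (linkingCoord_mul i j x y).trans (Finset.sum_eq_zero fun r _ => ?_)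
  by_cases hr : r = l
  · have : linkingCoord b δ r j y = 0 := hy r j fun h => hl (hr ▸ (congrArg Prod.fst h))
    rw [this, mul_zero]
  · have : linkingCoord b δ i r x = 0 := hx i r fun h => hr (congrArg Prod.snd h)
    rw [this, zero_mul]

include hg hd hδ

theorem exists_linking_coe_eq (hb : star b = b) (x : linkingAlgebra b δ) (k l : Fin 2) :
    ∃ m ∈ linkingEntry b δ k l, (m : CStarMatrix (Fin 2) (Fin 2) C) =
      matrixUnit C k l (linkingCoord b δ k l x) :=
  ⟨⟨_, matrixUnit_mem_linkingAlgebra hg hd hδ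
    (mem_corner_of_mem_linkingAlgebra hb x.2 k l)⟩, mem_linkingEntry_of_coe_eq rfl, rfl⟩

/-- Independence is read off from the coordinates. For the spanning property, each entry of an
element, placed alone in a matrix, has to lie in the linking algebra again. -/
theorem isInternal_linkingEntry (hb : star b = b) :
    DirectSum.IsInternal fun kl : Fin 2 × Fin 2 => linkingEntry b δ kl.1 kl.2 := by
  refine DirectSum.isInternal_submodule_of_iSupIndep_of_iSup_eq_top ?_ ?_
  · intro i
    rw [Submodule.disjoint_def]
    intro x hx hx'
    have h1 : ⨆ (j) (_ : j ≠ i), linkingEntry b δ j.1 j.2 ≤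
        LinearMap.ker (linkingCoord b δ i.1 i.2).toLinearMap :=
      iSup₂_le fun j hj y hy => hy i.1 i.2 hj.symm
    have h2 : linkingCoord b δ i.1 i.2 x = 0 := h1 hx'
    refine Subtype.ext ?_
    rw [coe_eq_matrixUnit hx, h2, map_zero]
    rfl
  · rw [Submodule.eq_top_iff']
    intro x
    choose m hm hm' using exists_linking_coe_eq hg hd hδ hb x
    have h1 : x = ∑ k, ∑ l, m k l := by
      refine Subtype.ext ?_
      refine (sum_matrixUnit _).symm.trans ?_
      have h2 (y : Fin 2 → linkingAlgebra b δ) : ((∑ k, y k : linkingAlgebra b δ) :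
          CStarMatrix (Fin 2) (Fin 2) C) = ∑ k, (y k : CStarMatrix (Fin 2) (Fin 2) C) :=
        map_sum (NonUnitalStarSubalgebraClass.subtype (linkingAlgebra b δ)) y Finset.univ
      rw [h2]
      refine Finset.sum_congr rfl fun k _ => ?_
      rw [h2]
      exact Finset.sum_congr rfl fun l _ => (hm' k l).symm
    rw [h1]
    exact Submodule.sum_mem _ fun k _ => Submodule.sum_mem _ fun l _ =>
      Submodule.mem_iSup_of_mem (p := fun kl : Fin 2 × Fin 2 => linkingEntry b δ kl.1 kl.2)
        (k, l) (hm k l)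

/-- The matrix `b_k x b_l` in the entry `(k, l)`. -/
def linkingUnit (k l : Fin 2) : C →L[ℂ] linkingAlgebra b δ where
  toFun x := ⟨matrixUnit C k l (cornerMap b k l x),
    matrixUnit_mem_linkingAlgebra hg hd hδ (cornerMap_mem b k l x)⟩
  map_add' x y := Subtype.ext (map_add ((matrixUnit C k l).comp (cornerMap b k l)) x y)
  map_smul' c x := Subtype.ext (map_smul ((matrixUnit C k l).comp (cornerMap b k l)) c x)
  cont := ((matrixUnit C k l).comp (cornerMap b k l)).continuous.subtype_mk _

theorem linkingUnit_mem (k l : Fin 2) (x : C) :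
    linkingUnit hg hd hδ k l x ∈ linkingEntry b δ k l := mem_linkingEntry_of_coe_eq rfl

/-- Closed conditions on one entry need to be checked on `b_k x b_l` with homogeneous `x` only. The
linking algebra is closed in the matrix algebra, so limits can be taken in the matrices, where they
are controlled by the closure that defines the corner. -/
theorem mem_of_linkingUnit_mem (hb : star b = b) {k l : Fin 2}
    {S : Submodule ℂ (linkingAlgebra b δ)} (hS : IsClosed (S : Set (linkingAlgebra b δ)))
    (h : ∀ s x, IsHomogeneous δ s x → linkingUnit hg hd hδ k l x ∈ S)
    {m : linkingAlgebra b δ} (hm : m ∈ linkingEntry b δ k l) : m ∈ S := by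
  have h1 (x : C) : linkingUnit hg hd hδ k l x ∈ S :=
    hg.mem_of_isHomogeneous hd (S := S.comap (linkingUnit hg hd hδ k l).toLinearMap)
      (hS.preimage (linkingUnit hg hd hδ k l).continuous) h x
  have hL : IsClosed (linkingAlgebra b δ : Set (CStarMatrix (Fin 2) (Fin 2) C)) :=
    NonUnitalStarSubalgebra.isClosed_topologicalClosure _
  have hS' : IsClosed ((fun x : linkingAlgebra b δ => (x : CStarMatrix (Fin 2) (Fin 2) C)) '' S) :=
    hL.isClosedEmbedding_subtypeVal.isClosedMap _ hS
  have h2 : closure (Set.range (cornerMap b k l)) ⊆ matrixUnit C k l ⁻¹'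
      ((fun x : linkingAlgebra b δ => (x : CStarMatrix (Fin 2) (Fin 2) C)) '' S) :=
    closure_minimal (by rintro _ ⟨x, rfl⟩; exact ⟨_, h1 x, rfl⟩)
      (hS'.preimage (matrixUnit C k l).continuous)
  obtain ⟨y, hy, hy'⟩ := h2 (mem_corner_of_mem_linkingAlgebra hb m.2 k l)
  have h3 : y = m := Subtype.ext (hy'.trans (coe_eq_matrixUnit hm).symm)
  rwa [← h3]

theorem closedMul_linkingEntry (hb : star b = b)
    (hfull : ∀ S : Submodule ℂ C, IsClosed (S : Set C) → (∀ x y, x * (b * b) * y ∈ S) → ∀ c, c ∈ S)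
    (k l m : Fin 2) :
    closedMul (linkingEntry b δ k l) (linkingEntry b δ l m) = linkingEntry b δ k m := by
  apply le_antisymm
  · refine Submodule.topologicalClosure_minimal _ (Submodule.span_le.mpr ?_)
      (isClosed_linkingEntry k m)
    rintro _ ⟨x, hx, y, hy, rfl⟩
    exact mul_mem_linkingEntry hx hy
  · intro z hz
    have hcl : IsClosed (closedMul (linkingEntry b δ k l) (linkingEntry b δ l m) :
        Set (linkingAlgebra b δ)) := Submodule.isClosed_topologicalClosure _
    refine mem_of_linkingUnit_mem hg hd hδ hb hcl (fun _ c _ => ?_) hz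
    let S := (closedMul (linkingEntry b δ k l) (linkingEntry b δ l m)).comap
      (linkingUnit hg hd hδ k m).toLinearMap
    have hS : IsClosed (S : Set C) := hcl.preimage (linkingUnit hg hd hδ k m).continuous
    have h1 (x y : C) : cornerRight b l x * cornerLeft b l y ∈ S := by
      refine Submodule.le_topologicalClosure _ (Submodule.subset_span
        ⟨_, linkingUnit_mem hg hd hδ k l x, _, linkingUnit_mem hg hd hδ l m y, ?_⟩)
      refine Subtype.ext ?_
      change matrixUnit C k m _ = matrixUnit C k l _ * matrixUnit C l m _
      rw [matrixUnit_mul_matrixUnit, cornerMap_mul_cornerMap]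
    change c ∈ S
    -- Through the index `0` the products are `b_k (x b² y) b_m`, and fullness applies; through the
    -- index `1` nothing stands between `x` and `y`, and an approximate unit suffices.
    by_cases hl : l = 0
    · refine hfull S hS (fun x y => ?_) c
      have := h1 x y
      simp only [cornerRight, cornerLeft, if_pos hl] at this
      rw [mul_assoc, mul_assoc, ← mul_assoc x]
      exact this
    · refine mem_closure_mul c hS fun x => ?_
      have := h1 c x
      simp only [cornerRight, cornerLeft, if_neg hl] at this
      exact this

theorem isHomogeneous_linkingUnit {ε : DualAction Γ (linkingAlgebra b δ)}
    (hε : ∀ x, IsHomogeneous ε.δ x.1.2.1 ⟨linkingGen b δ x, subset_cstarAdjoin _ ⟨x, rfl⟩⟩)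
    (k l : Fin 2) {s : Γ} {x : C} (hx : IsHomogeneous δ s x) :
    IsHomogeneous ε.δ s (linkingUnit hg hd hδ k l x) :=
  hε ⟨((k, l), s, cornerMap b k l x), cornerMap_mem b k l x, isHomogeneous_cornerMap hδ k l hx⟩

omit hg hd hδ in
/-- **Full corners are equivariantly Morita equivalent.** -/
theorem dualMoritaEquivalent_of_corner {δ : DualAction Γ C} {P : Type u} [NonUnitalCStarAlgebra P]
    {δP : DualAction Γ P} {Z : Type u} {p : Z → P} (hp : Generates p) {e : Z → Γ}
    (he : ∀ z, IsHomogeneous δP.δ (e z) (p z)) (hg : Generates g)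
    (hd : ∀ y, IsHomogeneous δ.δ (d y) (g y)) (hb : star b = b) (hδ : IsHomogeneous δ.δ 1 b)
    (hfull : ∀ S : Submodule ℂ C, IsClosed (S : Set C) → (∀ x y, x * (b * b) * y ∈ S) → ∀ c, c ∈ S)
    (φ : P →⋆ₙₐ[ℂ] C) (hφ : Function.Injective φ)
    (hrange : Set.range φ = closure (Set.range fun x => b * x * b))
    (hφe : ∀ z, IsHomogeneous δ.δ (e z) (φ (p z))) : DualMoritaEquivalent δP δ := by
  obtain ⟨ε, hε⟩ := exists_dualAction_matrix δ.δ (linkingGen b δ.δ) (fun x => x.1.2.1)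
    (fun x k l => by
      rw [linkingGen, matrixUnit_apply]
      split_ifs
      · exact x.2.2
      · exact isHomogeneous_zero _)
  have hrange' (y : C) : y ∈ corner b 0 0 ↔ y ∈ Set.range φ := by
    rw [hrange, mem_corner]
    have : ⇑(cornerMap b 0 0) = fun x => b * x * b := funext fun x => (mul_assoc b x b).symm
    rw [this]
  have hcorner (y : C) : y ∈ corner b 1 1 := subset_closure ⟨y, rfl⟩
  let i : P →⋆ₙₐ[ℂ] linkingAlgebra b δ.δ :=
    NonUnitalStarAlgHom.codRestrict ((matrixDiagonal C 0).comp φ) (linkingAlgebra b δ.δ) fun a =>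
      matrixUnit_mem_linkingAlgebra hg hd hδ ((hrange' _).mpr ⟨a, rfl⟩)
  let j : C →⋆ₙₐ[ℂ] linkingAlgebra b δ.δ :=
    NonUnitalStarAlgHom.codRestrict (matrixDiagonal C 1) (linkingAlgebra b δ.δ) fun a =>
      matrixUnit_mem_linkingAlgebra hg hd hδ (hcorner a)
  have hi (a : P) : linkingCoord b δ.δ 0 0 (i a) = φ a := matrixUnit_apply_same 0 0 (φ a)
  have hj (a : C) : linkingCoord b δ.δ 1 1 (j a) = a := matrixUnit_apply_same 1 1 a
  refine ⟨linkingAlgebra b δ.δ, inferInstance, ε, linkingEntry b δ.δ, i, j,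
    isClosed_linkingEntry, isInternal_linkingEntry hg hd hδ hb,
    closedMul_linkingEntry hg hd hδ hb hfull,
    fun k l l' m hl x hx y hy => mul_eq_zero_of_linkingEntry hl hx hy,
    fun k l x hx => star_mem_linkingEntry hx, fun k l x hx => ?_, fun a a' h => ?_, ?_,
    fun a a' h => ?_, ?_, fun a => ?_, fun a => ?_⟩
  · let S := (Submodule.span ℂ {z | ∃ y ∈ linkingEntry b δ.δ k l, ∃ c,
      z = MinTensor.tmul (B := RedGroupCStar Γ) y c}).topologicalClosure
    exact mem_of_linkingUnit_mem hg hd hδ hb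
      (S := S.comap (NonUnitalStarAlgHom.toCLM ε.δ).toLinearMap)
      ((Submodule.isClosed_topologicalClosure _).preimage (map_continuous ε.δ))
      (fun s x hx => Submodule.le_topologicalClosure _ (Submodule.subset_span
        ⟨_, linkingUnit_mem hg hd hδ k l x, _,
          isHomogeneous_linkingUnit hg hd hδ hε k l hx⟩)) hx
  · refine hφ ?_
    rw [← hi, ← hi, h]
  · refine Set.Subset.antisymm ?_ fun m hm => ?_
    · rintro _ ⟨a, rfl⟩
      exact mem_linkingEntry_of_coe_eq rfl
    · obtain ⟨a, ha⟩ := (hrange' _).mp (mem_corner_of_mem_linkingAlgebra hb m.2 0 0)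
      refine ⟨a, Subtype.ext ((congrArg (matrixUnit C 0 0) ha).trans (coe_eq_matrixUnit hm).symm)⟩
  · rw [← hj a, ← hj a', h]
  · refine Set.Subset.antisymm ?_ fun m hm => ?_
    · rintro _ ⟨a, rfl⟩
      exact mem_linkingEntry_of_coe_eq rfl
    · exact ⟨linkingCoord b δ.δ 1 1 m, Subtype.ext (coe_eq_matrixUnit hm).symm⟩
  · refine DFunLike.congr_fun (hp.hom_ext (φ := ε.δ.comp i)
      (ψ := (MinTensor.map i (NonUnitalStarAlgHom.id ℂ _)).comp δP.δ) fun z => ?_) a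
    rw [NonUnitalStarAlgHom.comp_apply, NonUnitalStarAlgHom.comp_apply, he, MinTensor.map_tmul]
    exact hε ⟨((0, 0), e z, φ (p z)), (hrange' _).mpr ⟨_, rfl⟩, hφe z⟩
  · refine DFunLike.congr_fun (hg.hom_ext (φ := ε.δ.comp j)
      (ψ := (MinTensor.map j (NonUnitalStarAlgHom.id ℂ _)).comp δ.δ) fun y => ?_) a
    rw [NonUnitalStarAlgHom.comp_apply, NonUnitalStarAlgHom.comp_apply, hd, MinTensor.map_tmul]
    exact hε ⟨((1, 1), d y, g y), hcorner _, hd y⟩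

end Corner

end

/-! ### Crossed products and their dual actions -/

section Crossed

open MinTensor RedGroupCStar

variable {Γ : Type u} [Group Γ] {A : Type u} [NonUnitalCStarAlgebra A] {α : CStarAction Γ A}

theorem CStarAction.act_one_apply (α : CStarAction Γ A) (a : A) : α.act 1 a = a := by
  rw [α.act_one]
  rfl

theorem CStarAction.act_act (α : CStarAction Γ A) (s t : Γ) (a : A) :
    α.act s (α.act t a) = α.act (s * t) a := by
  rw [α.act_mul]
  rfl

theorem CStarGen.ext_evalHom {X : Type u} {R : RepClass.{u} X} {a b : CStarGen R}
    (h : ∀ i, CStarGen.evalHom R i a = CStarGen.evalHom R i b) : a = b :=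
  sub_eq_zero.mp <| CStarGen.eq_zero_of_evalHom R fun i => by rw [map_sub, h, sub_self]

/-- Families which satisfy the relations in a jointly injective family of homomorphisms. -/
theorem isCrossedFamily_of_forall {R : RepClass.{u} (A × Γ)}
    (h : ∀ i, IsCrossedFamily α (R.val i)) : IsCrossedFamily α (CStarGen.gen R) where
  add a b s := CStarGen.ext_evalHom fun i => by
    simp only [map_add, CStarGen.evalHom_gen, (h i).add]
  smul c a s := CStarGen.ext_evalHom fun i => by
    simp only [map_smul, CStarGen.evalHom_gen, (h i).smul]
  mul a b s t := CStarGen.ext_evalHom fun i => by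
    simp only [map_mul, CStarGen.evalHom_gen, (h i).mul]
  adj a s := CStarGen.ext_evalHom fun i => by
    simp only [map_star, CStarGen.evalHom_gen, (h i).adj]

theorem FullCrossed.isCrossedFamily (α : CStarAction Γ A) :
    IsCrossedFamily α fun x => FullCrossed.mk α x.1 x.2 :=
  isCrossedFamily_of_forall fun i => RelFamily.prop i

theorem FullCrossed.generates (α : CStarAction Γ A) :
    Generates fun x : A × Γ => FullCrossed.mk α x.1 x.2 := CStarGen.generates_gen _

/-- The regular covariant representation induced by a representation `π`. -/
def regularFamily {H : Type u} [NormedAddCommGroup H] [InnerProductSpace ℂ H] [CompleteSpace H]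
    (α : CStarAction Γ A) (π : A →⋆ₙₐ[ℂ] (H →L[ℂ] H)) (x : A × Γ) :
    lp (fun _ : Γ => H) 2 →L[ℂ] lp (fun _ : Γ => H) 2 :=
  diagTranslate (fun t => π (α.act t⁻¹ x.1)) ‖x.1‖
    (fun t => (NonUnitalStarAlgHom.norm_apply_le π _).trans
      (NonUnitalStarAlgHom.norm_apply_le (α.act t⁻¹) x.1)) x.2

theorem regularFamily_apply {H : Type u} [NormedAddCommGroup H] [InnerProductSpace ℂ H]
    [CompleteSpace H] (π : A →⋆ₙₐ[ℂ] (H →L[ℂ] H)) (x : A × Γ) (ξ : lp (fun _ : Γ => H) 2)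
    (t : Γ) : regularFamily α π x ξ t = π (α.act t⁻¹ x.1) (ξ (x.2⁻¹ * t)) := rfl

theorem isCrossedFamily_regularFamily {H : Type u} [NormedAddCommGroup H] [InnerProductSpace ℂ H]
    [CompleteSpace H] (π : A →⋆ₙₐ[ℂ] (H →L[ℂ] H)) : IsCrossedFamily α (regularFamily α π) where
  add a b s := by
    ext ξ t
    simp [regularFamily_apply]
  smul c a s := by
    ext ξ t
    simp [regularFamily_apply]
  mul a b s t := by
    ext ξ r
    simp [regularFamily_apply, CStarAction.act_act, mul_assoc]
  adj a s := by
    rw [regularFamily, star_diagTranslate]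
    ext ξ t
    simp [regularFamily_apply, diagTranslate_apply, CStarAction.act_act, ← map_star]

theorem RedCrossed.isCrossedFamily (α : CStarAction Γ A) :
    IsCrossedFamily α fun x => RedCrossed.mk α x.1 x.2 :=
  isCrossedFamily_of_forall (R := regularClass α) fun i : HilbRep A =>
    isCrossedFamily_regularFamily i.hom

theorem RedCrossed.generates (α : CStarAction Γ A) :
    Generates fun x : A × Γ => RedCrossed.mk α x.1 x.2 := CStarGen.generates_gen _

/-- The regular representation of the reduced crossed product induced by `π`. -/
def RedCrossed.rep (α : CStarAction Γ A) (π : HilbRep A) : HilbRep (RedCrossed α) where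
  space := lp (fun _ : Γ => π.space) 2
  hom := CStarGen.evalHom (regularClass α) π

theorem RedCrossed.rep_mk (π : HilbRep A) (a : A) (s : Γ) :
    (RedCrossed.rep α π).hom (RedCrossed.mk α a s) = regularFamily α π.hom (a, s) :=
  CStarGen.evalHom_gen (regularClass α) π (a, s)

theorem RedCrossed.norm_eval_mk_le {X : Type u} (a : X → A) (s : X → Γ) (q : StarTerm X) {C : ℝ}
    (hC : 0 ≤ C)
    (h : ∀ π : HilbRep A, ‖q.eval fun x => regularFamily α π.hom (a x, s x)‖ ≤ C) :
    ‖q.eval fun x => RedCrossed.mk α (a x) (s x)‖ ≤ C :=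
  norm_le_of_jointly_injective (fun π : HilbRep A => (RedCrossed.rep α π).hom)
    (fun _ ha => CStarGen.eq_zero_of_evalHom (regularClass α) ha) hC fun π => by
      rw [StarTerm.map_eval]
      simp only [RedCrossed.rep_mk]
      exact h π

/-- The dual action on the full crossed product. -/
theorem FullCrossed.exists_dualAction (α : CStarAction Γ A) :
    ∃ δ : DualAction Γ (FullCrossed α), ∀ x : A × Γ,
      IsHomogeneous δ.δ x.2 (FullCrossed.mk α x.1 x.2) := by
  have hf := FullCrossed.isCrossedFamily α
  -- The `λ_s` multiply and invert like the indices `s`, so the elements `a u_s ⊗ λ_s` inherit the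
  -- relations of a crossed product and universality gives the action.
  have h1 : IsCrossedFamily α fun x : A × Γ => (tmul (FullCrossed.mk α x.1 x.2) (unit x.2) :
      MinTensor (FullCrossed α) (RedGroupCStar Γ)) :=
    { add := fun a b s => (congrArg (tmul · (unit s)) (hf.add a b s)).trans (add_tmul _ _ _)
      smul := fun c a s => (congrArg (tmul · (unit s)) (hf.smul c a s)).trans (smul_tmul _ _ _)
      mul := fun a b s t => (tmul_mul_tmul _ _ _ _).trans
        (congrArg₂ tmul (hf.mul a b s t) (unit_mul_unit s t))
      adj := fun a s => (star_tmul _ _).trans (congrArg₂ tmul (hf.adj a s) (star_unit s)) }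
  obtain ⟨δ, hδ⟩ := CStarGen.exists_hom_of_relations
    (rel := fun f => IsCrossedFamily α f) (bound := fun x => ⟨‖x.1‖, fun _ _ _ hf => hf.norm_le x⟩)
    _ h1
  exact ⟨DualAction.ofHom (FullCrossed.generates α) (fun x => x.2) δ hδ, hδ⟩

/-- The dual action on the reduced crossed product. -/
theorem RedCrossed.exists_dualAction (α : CStarAction Γ A) :
    ∃ δ : DualAction Γ (RedCrossed α), ∀ x : A × Γ,
      IsHomogeneous δ.δ x.2 (RedCrossed.mk α x.1 x.2) :=
  _root_.exists_dualAction (RedCrossed.generates α) (fun x => x.2) (RedCrossed.rep α)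
    (fun _ ha => CStarGen.eq_zero_of_evalHom (regularClass α) ha) fun π q => by
      have h1 := NonUnitalStarAlgHom.norm_apply_le (RedCrossed.rep α π).hom
        (q.eval fun x : A × Γ => RedCrossed.mk α x.1 x.2)
      rw [StarTerm.map_eval] at h1
      simp only [RedCrossed.rep_mk] at h1 ⊢
      -- Without universality the bound comes from Fell absorption, here with the nonconstant
      -- diagonal entries `π(t⁻¹·a)` of the regular representation.
      exact (norm_eval_diagTranslate_diagTranslate_le (fun (x : A × Γ) t =>
        π.hom (α.act t⁻¹ x.1)) _ _ (fun x => x.2) _ _ q).trans h1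

end Crossed

/-! ### The projection in the crossed product -/

section Elementary

variable {A : Type v} [NonUnitalCStarAlgebra A] {x y : A}

/-- Since `x` is selfadjoint, `(x y)* (x y) = y* (x (x y))`. Relations between the `h_s = (s·b)²`
are passed on to their square roots in this way. -/
theorem mul_eq_zero_of_mul_mul_eq_zero (hx : star x = x) (h : x * (x * y) = 0) : x * y = 0 := by
  refine star_mul_self_cancel ?_
  rw [star_mul, hx, mul_assoc, h, mul_zero]

theorem mul_eq_zero_of_mul_mul_eq_zero' (hx : star x = x) (h : y * (x * x) = 0) : y * x = 0 := by
  refine mul_star_self_cancel ?_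
  rw [star_mul, hx, ← mul_assoc, mul_assoc y, h, zero_mul]

/-- Left units of the square of a selfadjoint element are left units of the element. -/
theorem mul_eq_of_mul_mul_eq {k : A} (hx : star x = x) (h : k * (x * x) = x * x) : k * x = x := by
  refine sub_eq_zero.mp (mul_star_self_cancel ?_)
  have h1 : (k * x - x) * x = 0 := by rw [sub_mul, mul_assoc, h, sub_self]
  rw [star_sub, star_mul, hx, mul_sub, ← mul_assoc, h1, zero_mul, sub_zero]

/-- A closed subspace which contains selfadjoint generators and is invariant under left multiplication
by them is everything. -/
theorem Generates.mem_of_mul_mem {X : Type u} {A : Type v} [NonUnitalCStarAlgebra A] {g : X → A}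
    (hg : Generates g) (hsa : ∀ x, star (g x) = g x) {S : Submodule ℂ A}
    (hS : IsClosed (S : Set A)) (h : ∀ x, g x ∈ S) (h' : ∀ x, ∀ a ∈ S, g x * a ∈ S) (a : A) :
    a ∈ S := by
  let M : Set A := {x | x ∈ S ∧ ∀ a ∈ S, x * a ∈ S}
  have hM (x : X) : g x ∈ M := ⟨h x, h' x⟩
  have hmul (x y : A) (hx : x ∈ M) (hy : y ∈ M) : x * y ∈ M :=
    ⟨hx.2 y hy.1, fun a ha => by
      rw [mul_assoc]
      exact hx.2 _ (hy.2 a ha)⟩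
  refine hg.mem_of_mul_star (T := {x | x ∈ M ∧ star x ∈ M}) (fun x => ⟨hM x, ?_⟩)
    (fun x hx y hy => ⟨hmul _ _ hx.1 hy.1, ?_⟩) (fun x hx => ⟨hx.2, ?_⟩) hS
    (fun x hx => hx.1.1) a
  · rw [hsa]
    exact hM x
  · rw [star_mul]
    exact hmul _ _ hy.2 hx.2
  · rw [star_star]
    exact hx.1

end Elementary

theorem IsComplexFamily.star_eq {Γ : Type u} [Group Γ] {F : Finset Γ} {A : Type u}
    [NonUnitalCStarAlgebra A] {h : Γ → A} (hh : IsComplexFamily F h) (s : Γ) :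
    star (h s) = h s := by
  obtain ⟨c, hc⟩ := hh.pos s
  rw [hc, star_mul, star_star]

/-- Generators `h_s` of a C*-algebra with a compatible action, and the square root `b` of `h_1`. -/
structure EquivariantComplex {Γ : Type u} [Group Γ] (F : Finset Γ) {A : Type u}
    [NonUnitalCStarAlgebra A] (α : CStarAction Γ A) (h : Γ → A) (b : A) : Prop where
  family : IsComplexFamily F h
  generates : Generates h
  act : ∀ g s, α.act g (h s) = h (g * s)
  inv : ∀ s ∈ F, s⁻¹ ∈ F
  star_root : star b = b
  root_mul_root : b * b = h 1

namespace EquivariantComplex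

variable {Γ : Type u} [Group Γ] {F : Finset Γ} {A : Type u} [NonUnitalCStarAlgebra A]
  {α : CStarAction Γ A} {h : Γ → A} {b : A} (E : EquivariantComplex F α h b)

include E

theorem star_act (s : Γ) : star (α.act s b) = α.act s b := by rw [← map_star, E.star_root]

theorem act_mul_act (s : Γ) : α.act s b * α.act s b = h s := by
  rw [← map_mul, E.root_mul_root, E.act, mul_one]

/-- In `h_1 h_s = b b (s·b) (s·b) = 0` one factor is cancelled on each side. -/
theorem root_mul_act {s : Γ} (hs : s ∉ F) : b * α.act s b = 0 := by
  have h1 := E.family.orth 1 s (by simpa using hs)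
  rw [← E.root_mul_root, ← E.act_mul_act, mul_assoc] at h1
  exact mul_eq_zero_of_mul_mul_eq_zero' (E.star_act s)
    (mul_eq_zero_of_mul_mul_eq_zero E.star_root h1)

/-- As `F = F⁻¹`, the sum relation at `t = 1` says that `∑_{s ∈ F} h_s` is a left unit of `h_1 =
b²`; left units of the square are left units of `b`. -/
theorem sum_mul_root : (∑ s ∈ F, h s) * b = b := by
  refine mul_eq_of_mul_mul_eq E.star_root ?_
  rw [E.root_mul_root, Finset.sum_mul]
  refine Eq.trans ?_ (E.family.sum 1)
  refine Finset.sum_nbij' (·⁻¹) (·⁻¹) E.inv E.inv ?_ ?_ ?_ <;> simp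

theorem root_mul_sum : b * ∑ s ∈ F, h s = b := by
  have h1 := congrArg star E.sum_mul_root
  rw [star_mul, star_sum, E.star_root] at h1
  simpa only [E.family.star_eq] using h1

variable {C : Type u} [NonUnitalCStarAlgebra C] {f : A × Γ → C} (hf : IsCrossedFamily α f)

include hf

omit E in
theorem _root_.IsCrossedFamily.zero (s : Γ) : f (0, s) = 0 := by
  simpa using hf.smul 0 0 s

omit E in
/-- `a ↦ a u_s` as a continuous linear map. -/
def _root_.IsCrossedFamily.toCLM (s : Γ) : A →L[ℂ] C :=
  LinearMap.mkContinuous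
    { toFun := fun a => f (a, s)
      map_add' := fun a b => hf.add a b s
      map_smul' := fun c a => hf.smul c a s } 1 fun a => by
    rw [one_mul]
    exact hf.norm_le (a, s)

/-- These are the elements `b u_s b`. The inner pair of roots in the product at `s` and `s⁻¹t`
combines to `h_s`, so the product is `b h_s (t·b) u_t`, and the sum over `s ∈ F` is absorbed by `b`.
-/
theorem isProjFamily : IsProjFamily F fun s => f (b * α.act s b, s) where
  zero s hs := by
    rw [E.root_mul_act hs, hf.zero]
  adj s := by
    rw [hf.adj, star_mul, E.star_act, E.star_root, map_mul, α.act_act, inv_mul_cancel,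
      α.act_one_apply]
  mul t := by
    have h1 (s : Γ) : f (b * α.act s b, s) * f (b * α.act (s⁻¹ * t) b, s⁻¹ * t) =
        hf.toCLM t (b * h s * α.act t b) := by
      rw [hf.mul, map_mul, α.act_act, mul_inv_cancel_left, ← E.act_mul_act]
      simp only [mul_assoc]
      rfl
    simp only [h1]
    rw [← map_sum, ← Finset.sum_mul, ← Finset.mul_sum, E.root_mul_sum]
    rfl

/-- Each multiplication by a coefficient combines two adjacent roots into one factor `h`. The
indices of these factors are the partial products of the word, and the last root carries the total
product. -/
theorem exists_foldl_eq (l : List Γ) (z : A) (s : Γ) : ∃ m : List Γ,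
    l.foldl (fun x a => x * f (b * α.act a b, a)) (f (z * α.act s b, s)) =
      f (m.foldl (fun x a => x * h a) z * α.act (s * l.prod) b, s * l.prod) := by
  induction l generalizing z s with
  | nil => exact ⟨[], by simp⟩
  | cons a l ih =>
    obtain ⟨m, hm⟩ := ih (z * h s) (s * a)
    refine ⟨s :: m, ?_⟩
    rw [List.foldl_cons, List.foldl_cons, List.prod_cons, ← mul_assoc s, ← hm, hf.mul, map_mul,
      α.act_act, ← E.act_mul_act]
    simp only [mul_assoc]

omit [Group Γ] E hf in
theorem foldl_mul_eq (m : List Γ) (z y : A) :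
    m.foldl (fun x a => x * h a) z * y = z * m.foldr (fun a x => h a * x) y := by
  induction m generalizing z with
  | nil => rfl
  | cons a m ih => rw [List.foldl_cons, ih, List.foldr_cons, mul_assoc]

/-- A word becomes `b h_{a₁} ⋯ h_{aₙ} (t·b) u_t`, where `t` is its total product. If `t ∉ F`, the
strong relation between `h_1` and `h_t` applies, and the superfluous root is cancelled at each end.
-/
theorem isStrongProjFamily (hs : IsStrongComplexFamily F h) :
    IsStrongProjFamily F fun s => f (b * α.act s b, s) where
  toIsProjFamily := E.isProjFamily hf
  prod s l hl := by
    obtain ⟨m, hm⟩ := E.exists_foldl_eq hf l b s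
    have h1 := hs.prod 1 (s * l.prod) (by simpa using hl) m
    rw [← E.root_mul_root, mul_assoc] at h1
    have h2 := mul_eq_zero_of_mul_mul_eq_zero E.star_root h1
    rw [← foldl_mul_eq, ← E.act_mul_act] at h2
    rw [hm, mul_eq_zero_of_mul_mul_eq_zero' (E.star_act _) h2, hf.zero]

theorem star_corner : star (f (b, 1)) = f (b, 1) := by
  rw [hf.adj, E.star_root, inv_one, α.act_one_apply]

theorem corner_mul_corner : f (b, 1) * f (b, 1) = f (h 1, 1) := by
  rw [hf.mul, α.act_one_apply, E.root_mul_root, one_mul]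

omit E in
theorem corner_mul_mul_corner (a : A) (s : Γ) :
    f (b, 1) * f (a, s) * f (b, 1) = f (b * a * α.act s b, s) := by
  rw [hf.mul, hf.mul, α.act_one_apply, one_mul, mul_one]

/-- The unitary `u_s` need not lie in `C`. Since `b ∑ h_r = b`, the element `(∑ h_r) u_s` can
replace it and exhibits the coefficient as an element of `b C b`. -/
theorem projection_eq (s : Γ) : f (b * α.act s b, s) =
    f (b, 1) * f (∑ r ∈ F, h r, s) * f (b, 1) := by
  rw [corner_mul_mul_corner hf, E.root_mul_sum]

omit E in
/-- A closed subspace which contains all `a u_s` is everything. -/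
theorem _root_.IsCrossedFamily.mem_of_mem (hgen : Generates f) {S : Submodule ℂ C} (hS : IsClosed (S : Set C))
    (h : ∀ a s, f (a, s) ∈ S) (c : C) : c ∈ S :=
  hgen.mem_of_mul_star (T := Set.range f) Set.mem_range_self
    (by rintro _ ⟨x, rfl⟩ _ ⟨y, rfl⟩; exact ⟨_, (hf.mul x.1 y.1 x.2 y.2).symm⟩)
    (by rintro _ ⟨x, rfl⟩; exact ⟨_, (hf.adj x.1 x.2).symm⟩) hS
    (by rintro _ ⟨x, rfl⟩; exact h x.1 x.2) c

/-- The corner is full. -/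
theorem mem_of_corner_mem (hgen : Generates f) (S : Submodule ℂ C) (hS : IsClosed (S : Set C))
    (hS' : ∀ x y, x * (f (b, 1) * f (b, 1)) * y ∈ S) (c : C) : c ∈ S := by
  refine hf.mem_of_mem hgen hS (fun a t => ?_) c
  have hT : IsClosed (S.comap (hf.toCLM t).toLinearMap : Set A) :=
    hS.preimage (hf.toCLM t).continuous
  have h1 (s : Γ) (w : A) : f (h s * w, t) ∈ S := by
    -- The left factor is `u_s ∑ h_r`, where the sum acts as a unit on `h_1`; conjugation by `u_s`
    -- turns `h_1` into `h_s`. The right factor is chosen so that the product is `h_s w u_t`.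
    have h2 := hS' (f (α.act s (∑ r ∈ F, h r), s)) (f (α.act s⁻¹ w, s⁻¹ * t))
    have h3 : (∑ r ∈ F, h r) * h 1 = h 1 := by
      rw [← E.root_mul_root, ← mul_assoc, E.sum_mul_root]
    rwa [E.corner_mul_corner hf, hf.mul, ← map_mul, h3, E.act, mul_one, hf.mul, α.act_act,
      mul_inv_cancel, α.act_one_apply, mul_inv_cancel_left] at h2
  exact E.generates.mem_of_mul_mem E.family.star_eq hT
    (fun s => mem_closure_mul (h s) hT fun w => h1 s w) (fun s w _ => h1 s w) a

/-- The image of an injective homomorphism which maps generators to the coefficients of the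
projection is the corner. -/
theorem range_eq_corner (hgen : Generates f) {P : Type u} [NonUnitalCStarAlgebra P] {p : Γ → P}
    (hp : Generates p) (φ : P →⋆ₙₐ[ℂ] C) (hφ : Function.Injective φ)
    (hφp : ∀ s, φ (p s) = f (b * α.act s b, s)) :
    Set.range φ = closure (Set.range fun x => f (b, 1) * x * f (b, 1)) := by
  have hcl := φ.isClosed_range_of_injective hφ
  apply Set.Subset.antisymm
  · let S : NonUnitalStarSubalgebra ℂ C :=
      { (LinearMap.range ((ContinuousLinearMap.mul ℂ C (f (b, 1))).comp
          ((ContinuousLinearMap.mul ℂ C).flip (f (b, 1)))).toLinearMap) with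
        mul_mem' := by
          rintro _ _ ⟨x, rfl⟩ ⟨y, rfl⟩
          refine ⟨x * f (b, 1) * (f (b, 1) * y), ?_⟩
          change f (b, 1) * (x * f (b, 1) * (f (b, 1) * y) * f (b, 1)) =
            f (b, 1) * (x * f (b, 1)) * (f (b, 1) * (y * f (b, 1)))
          simp only [mul_assoc]
        star_mem' := by
          rintro _ ⟨x, rfl⟩
          refine ⟨star x, ?_⟩
          change f (b, 1) * (star x * f (b, 1)) = star (f (b, 1) * (x * f (b, 1)))
          rw [star_mul, star_mul, E.star_corner hf, mul_assoc] }
    have hS : (S : Set C) = Set.range fun x => f (b, 1) * x * f (b, 1) := by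
      simp only [mul_assoc]
      rfl
    rintro _ ⟨a, rfl⟩
    have h1 := hp.mem (S.topologicalClosure.comap φ)
      ((NonUnitalStarSubalgebra.isClosed_topologicalClosure S).preimage (map_continuous φ))
      (fun s => by
        change φ (p s) ∈ S.topologicalClosure
        rw [hφp, E.projection_eq hf]
        refine NonUnitalStarSubalgebra.le_topologicalClosure S ?_
        change _ ∈ (S : Set C)
        rw [hS]
        exact ⟨_, rfl⟩) a
    rw [← hS]
    exact h1
  · refine closure_minimal ?_ hcl
    rintro _ ⟨c, rfl⟩
    let R : Submodule ℂ C := LinearMap.range φ.toCLM.toLinearMap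
    have hR : IsClosed (R : Set C) := hcl
    have hRmul {x y : C} (hx : x ∈ R) (hy : y ∈ R) : x * y ∈ R := by
      obtain ⟨x, rfl⟩ := hx
      obtain ⟨y, rfl⟩ := hy
      exact ⟨x * y, map_mul φ x y⟩
    have hRp (s : Γ) : f (b * α.act s b, s) ∈ R := ⟨p s, hφp s⟩
    let L (r t : Γ) : A →L[ℂ] C := (hf.toCLM t).comp ((ContinuousLinearMap.mul ℂ A b).comp
      (((ContinuousLinearMap.mul ℂ A).flip (α.act t b)).comp (α.act r).toCLM))
    have hL (r t : Γ) (a : A) : L r t a = f (b * (α.act r a * α.act t b), t) := rfl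
    -- It is to be shown that `b a (t·b) u_t` lies in the range for all `a`. The induction over
    -- words in the `h_s` requires all translates of `a` at once: splitting off the coefficient at
    -- `r s` from `b (r·(h_s x)) (t·b) u_t` leaves the same expression for `x`, translated by `(r
    -- s)⁻¹ r`.
    let T : Submodule ℂ A := ⨅ r, ⨅ t, R.comap (L r t).toLinearMap
    have hmemT (a : A) : a ∈ T ↔ ∀ r t, f (b * (α.act r a * α.act t b), t) ∈ R := by
      simp only [T, Submodule.mem_iInf]
      rfl
    have hT : IsClosed (T : Set A) := by
      simp only [T, Submodule.coe_iInf]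
      exact isClosed_iInter fun r => isClosed_iInter fun t => hR.preimage (L r t).continuous
    have h1 (r s t : Γ) (x : A) : f (b * (α.act r (h s * x) * α.act t b), t) =
        f (b * α.act (r * s) b, r * s) *
          f (α.act (r * s)⁻¹ (α.act (r * s) b * (α.act r x * α.act t b)), (r * s)⁻¹ * t) := by
      rw [hf.mul, α.act_act, mul_inv_cancel, α.act_one_apply, mul_inv_cancel_left, map_mul, E.act,
        ← E.act_mul_act]
      simp only [mul_assoc]
    have h2 (a : A) : a ∈ T := by
      refine E.generates.mem_of_mul_mem E.family.star_eq hT (fun s => ?_) (fun s x hx => ?_) a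
      · rw [hmemT]
        intro r t
        have h3 : f (b * (α.act r (h s) * α.act t b), t) =
            f (b * α.act (r * s) b, r * s) *
              f (b * α.act ((r * s)⁻¹ * t) b, (r * s)⁻¹ * t) := by
          rw [hf.mul, map_mul, α.act_act, mul_inv_cancel_left, E.act, ← E.act_mul_act]
          simp only [mul_assoc]
        rw [h3]
        exact hRmul (hRp _) (hRp _)
      · rw [hmemT] at hx ⊢
        intro r t
        rw [h1]
        refine hRmul (hRp _) ?_
        have h4 := hx ((r * s)⁻¹ * r) ((r * s)⁻¹ * t)
        rwa [map_mul, map_mul, α.act_act, α.act_act, α.act_act, inv_mul_cancel, α.act_one_apply]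
    refine hf.mem_of_mem hgen
      (S := R.comap ((ContinuousLinearMap.mul ℂ C).flip (f (b, 1)) ∘L
        (ContinuousLinearMap.mul ℂ C (f (b, 1)))).toLinearMap)
      (hR.preimage ((ContinuousLinearMap.mul ℂ C).flip (f (b, 1)) ∘L
        (ContinuousLinearMap.mul ℂ C (f (b, 1)))).continuous) (fun a s => ?_) c
    change f (b, 1) * f (a, s) * f (b, 1) ∈ R
    rw [corner_mul_mul_corner hf, mul_assoc]
    have h5 := (hmemT a).mp (h2 a) 1 s
    rwa [α.act_one_apply] at h5

/-- The Morita equivalence given by the projection in the crossed product. -/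
theorem dualMoritaEquivalent (hgen : Generates f) {δ : DualAction Γ C}
    (hδ : ∀ x, IsHomogeneous δ.δ x.2 (f x)) {P : Type u} [NonUnitalCStarAlgebra P]
    {δP : DualAction Γ P} {p : Γ → P} (hp : Generates p) (hδP : ∀ s, IsHomogeneous δP.δ s (p s))
    (φ : P →⋆ₙₐ[ℂ] C) (hφ : Function.Injective φ)
    (hφp : ∀ s, φ (p s) = f (b * α.act s b, s)) : DualMoritaEquivalent δP δ :=
  dualMoritaEquivalent_of_corner hp hδP hgen hδ (E.star_corner hf) (hδ (b, 1))
    (E.mem_of_corner_mem hf hgen) φ hφ (E.range_eq_corner hf hgen hp φ hφ hφp) fun s => by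
      rw [hφp]
      exact hδ (_, s)

end EquivariantComplex

/-! ### Dilations of projections -/

/-- Compressions of the same operators have the same norm. -/
theorem norm_eval_compression {X : Type u} {A : Type v} [NonUnitalCStarAlgebra A] {w c : A}
    (hw : star w = w) (hwc : w * w = c * star c) (z : X → A) (q : StarTerm X) :
    ‖q.eval fun x => w * z x * w‖ = ‖q.eval fun x => star c * z x * c‖ := by
  -- One and the same `Z` serves for both compressions, because the inner factor created by a
  -- product is `w w` on one side and `c c*` on the other, and these agree.
  obtain ⟨Z, h1, h2⟩ : ∃ Z : A, (q.eval fun x => w * z x * w) = w * Z * w ∧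
      (q.eval fun x => star c * z x * c) = star c * Z * c := by
    induction q with
    | zero => exact ⟨0, by simp [StarTerm.eval], by simp [StarTerm.eval]⟩
    | gen x => exact ⟨z x, rfl, rfl⟩
    | add p q hp hq =>
      obtain ⟨Z, h1, h2⟩ := hp
      obtain ⟨Z', h3, h4⟩ := hq
      exact ⟨Z + Z', by rw [StarTerm.eval, h1, h3, mul_add, add_mul],
        by rw [StarTerm.eval, h2, h4, mul_add, add_mul]⟩
    | smul a p hp =>
      obtain ⟨Z, h1, h2⟩ := hp
      exact ⟨a • Z, by rw [StarTerm.eval, h1, mul_smul_comm, smul_mul_assoc],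
        by rw [StarTerm.eval, h2, mul_smul_comm, smul_mul_assoc]⟩
    | mul p q hp hq =>
      obtain ⟨Z, h1, h2⟩ := hp
      obtain ⟨Z', h3, h4⟩ := hq
      refine ⟨Z * (w * w) * Z', ?_, ?_⟩
      · rw [StarTerm.eval, h1, h3]
        simp only [mul_assoc]
      · rw [StarTerm.eval, h2, h4, hwc]
        simp only [mul_assoc]
    | star p hp =>
      obtain ⟨Z, h1, h2⟩ := hp
      refine ⟨star Z, ?_, ?_⟩
      · rw [StarTerm.eval, h1]
        simp only [star_mul, hw, mul_assoc]
      · rw [StarTerm.eval, h2]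
        simp only [star_mul, star_star, mul_assoc]
  -- Both norms squared equal the norm of `Y* w² Y = Y* c c* Y`. Used on the left and, after taking
  -- adjoints, on the right, this replaces a polar decomposition of `c`.
  have key (Y : A) : ‖star c * Y‖ = ‖w * Y‖ := by
    rw [← sq_eq_sq₀ (norm_nonneg _) (norm_nonneg _), sq, sq, ← CStarRing.norm_star_mul_self,
      ← CStarRing.norm_star_mul_self, star_mul, star_mul, star_star, hw, mul_assoc, mul_assoc,
      ← mul_assoc c, ← mul_assoc w, hwc]
  rw [h1, h2, mul_assoc, mul_assoc, key, ← norm_star, ← norm_star (w * (Z * c)), star_mul, star_mul,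
    star_mul, star_mul, hw, mul_assoc, mul_assoc, key]

/-- A unitary representation `l` of `Γ` and an operator `c` such that the operators `c* l_s c` are the
coefficients of a projection. -/
structure ProjDilation {Γ : Type u} [Group Γ] (F : Finset Γ) {K : Type u} [NormedAddCommGroup K]
    [InnerProductSpace ℂ K] [CompleteSpace K] (l : Γ → K →L[ℂ] K) (c : K →L[ℂ] K) : Prop where
  one : l 1 = 1
  mul : ∀ s t, l s * l t = l (s * t)
  star_eq : ∀ s, star (l s) = l s⁻¹
  zero : ∀ s, s ∉ F → star c * l s * c = 0
  sum : ∑ f ∈ F, l f⁻¹ * c * (star c * l f * c) = c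

namespace ProjDilation

variable {Γ : Type u} [Group Γ] {F : Finset Γ} {K : Type u} [NormedAddCommGroup K]
  [InnerProductSpace ℂ K] [CompleteSpace K] {l : Γ → K →L[ℂ] K} {c : K →L[ℂ] K}
  (D : ProjDilation F l c)

include D

theorem inv_mul (s : Γ) : l s⁻¹ * l s = 1 := by rw [D.mul, inv_mul_cancel, D.one]

theorem mul_inv (s : Γ) : l s * l s⁻¹ = 1 := by rw [D.mul, mul_inv_cancel, D.one]

theorem mul_mul (s t : Γ) (x : K →L[ℂ] K) : l s * (l t * x) = l (s * t) * x := by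
  rw [← mul_assoc, D.mul]

/-- The element `h_s` is `(l_s c)(l_s c)*`, and in `h_s h_t` the inner factors form the coefficient
`c* l_{s⁻¹t} c`. Its vanishing outside `F` gives orthogonality, and the reproducing formula for `c`,
conjugated by `l_t`, gives the sum relation. -/
theorem isComplexFamily : IsComplexFamily F fun s => l s * c * star c * l s⁻¹ where
  pos s := ⟨star c * l s⁻¹, by
    rw [star_mul, star_star, D.star_eq, inv_inv]
    simp only [mul_assoc]⟩
  orth s t hst := by
    have h1 := D.zero _ hst
    rw [← D.mul] at h1
    calc l s * c * star c * l s⁻¹ * (l t * c * star c * l t⁻¹)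
        = l s * c * (star c * (l s⁻¹ * l t) * c) * (star c * l t⁻¹) := by simp only [mul_assoc]
      _ = 0 := by rw [h1, mul_zero, zero_mul]
  sum t := by
    have h1 (f : Γ) : l (t * f⁻¹) * c * star c * l (t * f⁻¹)⁻¹ * (l t * c * star c * l t⁻¹) =
        l t * (l f⁻¹ * c * (star c * l f * c)) * (star c * l t⁻¹) := by
      rw [mul_inv_rev, inv_inv]
      calc l (t * f⁻¹) * c * star c * l (f * t⁻¹) * (l t * c * star c * l t⁻¹)
          = l (t * f⁻¹) * c * star c * (l (f * t⁻¹) * (l t * (c * star c * l t⁻¹))) := by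
            simp only [mul_assoc]
        _ = l t * l f⁻¹ * c * star c * (l f * (c * star c * l t⁻¹)) := by
            rw [D.mul_mul, inv_mul_cancel_right, D.mul]
        _ = _ := by simp only [mul_assoc]
    simp only [h1]
    rw [← Finset.sum_mul, ← Finset.mul_sum, D.sum]
    simp only [mul_assoc]

omit [Group Γ] D in
theorem _root_.mul_foldl_mul {A : Type v} [NonUnitalCStarAlgebra A] {X : Type*} (p : X → A)
    (x z : A) (m : List X) :
    x * m.foldl (fun x a => x * p a) z = m.foldl (fun x a => x * p a) (x * z) := by
  induction m generalizing z with
  | nil => rfl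
  | cons a m ih => rw [List.foldl_cons, ih, List.foldl_cons, mul_assoc]

/-- Regrouping `c* l_s⁻¹ h_{a₁} ⋯ h_{aₙ} h_t` at the factors `c` gives a word in the coefficients,
at the successive quotients of `s, a₁, …, aₙ, t`. The product telescopes to `s⁻¹t`, so vanishing
words give the strong relations. -/
theorem exists_foldr_eq (t : Γ) (m : List Γ) (s : Γ) : ∃ (r : Γ) (L : List Γ),
    r * L.prod = s⁻¹ * t ∧
    star c * l s⁻¹ * m.foldr (fun a x => l a * c * star c * l a⁻¹ * x) (l t * c * star c * l t⁻¹) =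
      L.foldl (fun x a => x * (star c * l a * c)) (star c * l r * c) * (star c * l t⁻¹) := by
  induction m generalizing s with
  | nil =>
    refine ⟨s⁻¹ * t, [], by simp, ?_⟩
    rw [List.foldr_nil, List.foldl_nil, ← D.mul]
    simp only [mul_assoc]
  | cons a m ih =>
    obtain ⟨r, L, h1, h2⟩ := ih a
    refine ⟨s⁻¹ * a, r :: L, by rw [List.prod_cons, h1]; group, ?_⟩
    rw [List.foldr_cons, List.foldl_cons, ← mul_foldl_mul, mul_assoc _ _ (star c * l t⁻¹), ← h2,
      ← D.mul]
    simp only [mul_assoc]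

theorem isStrongComplexFamily (hs : IsStrongProjFamily F fun s => star c * l s * c) :
    IsStrongComplexFamily F fun s => l s * c * star c * l s⁻¹ where
  toIsComplexFamily := D.isComplexFamily
  prod s t hst m := by
    obtain ⟨r, L, h1, h2⟩ := D.exists_foldr_eq t m s
    rw [mul_assoc _ (star c), mul_assoc, h2, hs.prod r L (h1 ▸ hst), zero_mul, mul_zero]

variable {A : Type u} [NonUnitalCStarAlgebra A] {α : CStarAction Γ A} {h : Γ → A} {b : A}
  (E : EquivariantComplex F α h b) (ρ : A →⋆ₙₐ[ℂ] (K →L[ℂ] K))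
  (hρ : ∀ s, ρ (h s) = l s * c * star c * l s⁻¹)

include E hρ

/-- Conjugation by `l_g` sends `ρ(h_s)` to `ρ(h_{gs})`. As the `h_s` generate, `(ρ, l)` is a
covariant pair. -/
theorem map_act (g : Γ) (a : A) : ρ (α.act g a) = l g * ρ a * l g⁻¹ := by
  let ψ : (K →L[ℂ] K) →⋆ₙₐ[ℂ] (K →L[ℂ] K) :=
    { toFun := fun x => l g * x * l g⁻¹
      map_smul' := fun c x => by simp only [mul_smul_comm, smul_mul_assoc, MonoidHom.id_apply]
      map_zero' := by simp
      map_add' := fun x y => by rw [mul_add, add_mul]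
      map_mul' := fun x y => by
        calc l g * (x * y) * l g⁻¹ = l g * x * (l g⁻¹ * l g) * y * l g⁻¹ := by
              rw [D.inv_mul, mul_one]
              simp only [mul_assoc]
          _ = _ := by simp only [mul_assoc]
      map_star' := fun x => by
        rw [star_mul, star_mul, D.star_eq, D.star_eq, inv_inv, mul_assoc] }
  refine DFunLike.congr_fun (E.generates.hom_ext (φ := ρ.comp (α.act g)) (ψ := ψ.comp ρ)
    fun s => ?_) a
  change ρ (α.act g (h s)) = l g * ρ (h s) * l g⁻¹
  rw [E.act, hρ, hρ, ← D.mul, mul_inv_rev, ← D.mul]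
  simp only [mul_assoc]

theorem isCrossedFamily : IsCrossedFamily α fun x => ρ x.1 * l x.2 where
  add a b s := by rw [map_add, add_mul]
  smul k a s := by rw [map_smul, smul_mul_assoc]
  mul a b s t := by
    rw [map_mul, D.map_act E ρ hρ]
    calc ρ a * l s * (ρ b * l t) = ρ a * l s * ρ b * (l s⁻¹ * (l s * l t)) := by
          rw [D.mul_mul, inv_mul_cancel, D.one, one_mul]
          simp only [mul_assoc]
      _ = _ := by
          rw [D.mul]
          simp only [mul_assoc]
  adj a s := by
    rw [star_mul, D.map_act E ρ hρ, D.star_eq, map_star, inv_inv, mul_assoc, D.mul_inv, mul_one]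

theorem rho_root : star (ρ b) = ρ b ∧ ρ b * ρ b = c * star c := by
  constructor
  · rw [← map_star, E.star_root]
  · rw [← map_mul, E.root_mul_root, hρ, D.one, inv_one, D.one, one_mul, mul_one]

theorem rho_projection (s : Γ) : ρ (b * α.act s b) * l s = ρ b * l s * ρ b := by
  rw [map_mul, D.map_act E ρ hρ, mul_assoc, mul_assoc _ (l s⁻¹), D.inv_mul, mul_one]
  simp only [mul_assoc]

theorem norm_eval_eq (q : StarTerm Γ) :
    ‖q.eval fun s => ρ (b * α.act s b) * l s‖ = ‖q.eval fun s => star c * l s * c‖ := by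
  simp only [D.rho_projection E ρ hρ]
  exact norm_eval_compression (D.rho_root E ρ hρ).1 (D.rho_root E ρ hρ).2 l q

/-- The covariant pair integrates to the full crossed product and sends `b u_s b` to `ρ(b) l_s
ρ(b)`. Since `ρ(b)² = c c*`, polynomials in these operators have the same norms as those in the `c*
l_s c`. -/
theorem norm_eval_le_full (q : StarTerm Γ) : ‖q.eval fun s => star c * l s * c‖ ≤
    ‖q.eval fun s => FullCrossed.mk α (b * α.act s b) s‖ := by
  obtain ⟨Θ, hΘ⟩ := CStarGen.exists_hom_of_relations
    (rel := fun f => IsCrossedFamily α f) (bound := fun x => ⟨‖x.1‖, fun _ _ _ hf => hf.norm_le x⟩)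
    _ (D.isCrossedFamily E ρ hρ)
  have h1 := NonUnitalStarAlgHom.norm_apply_le Θ
    (q.eval fun s => FullCrossed.mk α (b * α.act s b) s)
  rw [StarTerm.map_eval] at h1
  have h2 : (fun s => Θ (FullCrossed.mk α (b * α.act s b) s)) =
      fun s => ρ (b * α.act s b) * l s := funext fun s => hΘ (_, s)
  rw [h2, D.norm_eval_eq E ρ hρ] at h1
  exact h1

end ProjDilation

/-! ### Dilations and the reduced crossed product -/

namespace ProjDilation

variable {Γ : Type u} [Group Γ] {F : Finset Γ} {K : Type u} [NormedAddCommGroup K]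
  [InnerProductSpace ℂ K] [CompleteSpace K] {l : Γ → K →L[ℂ] K} {c : K →L[ℂ] K}
  (D : ProjDilation F l c)

include D

theorem norm_apply (s : Γ) (ξ : K) : ‖l s ξ‖ = ‖ξ‖ :=
  ((l s).norm_map_iff_adjoint_comp_self.mpr (by
    rw [← ContinuousLinearMap.star_eq_adjoint, D.star_eq]
    exact D.inv_mul s)) ξ

/-- The isometry `(U ξ)(t) = l_t* ξ(t)`. -/
def twist : lp (fun _ : Γ => K) 2 →ₗᵢ[ℂ] lp (fun _ : Γ => K) 2 where
  toLinearMap := (diagTranslate (fun t => l t⁻¹) 1 (fun t =>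
    (l t⁻¹).opNorm_le_bound zero_le_one fun ξ => by rw [D.norm_apply, one_mul]) 1).toLinearMap
  norm_map' ξ := by
    rw [← sq_eq_sq₀ (norm_nonneg _) (norm_nonneg _), lp.norm_sq_eq, lp.norm_sq_eq]
    refine tsum_congr fun t => ?_
    change ‖l t⁻¹ (ξ (1⁻¹ * t))‖ ^ 2 = _
    rw [D.norm_apply, inv_one, one_mul]

theorem twist_apply (ξ : lp (fun _ : Γ => K) 2) (t : Γ) : D.twist ξ t = l t⁻¹ (ξ t) := by
  change l t⁻¹ (ξ (1⁻¹ * t)) = _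
  rw [inv_one, one_mul]

variable {A : Type u} [NonUnitalCStarAlgebra A] {α : CStarAction Γ A} {h : Γ → A} {b : A}
  (E : EquivariantComplex F α h b) (ρ : A →⋆ₙₐ[ℂ] (K →L[ℂ] K))
  (hρ : ∀ s, ρ (h s) = l s * c * star c * l s⁻¹)

include E hρ

/-- Covariance turns the entry `ρ(t⁻¹·a)` of the regular representation into `l_t⁻¹ ρ(a) l_t`. The
diagonal unitary `l_t⁻¹` undoes this conjugation and leaves the constant entry `ρ(a) l_s`, that is
`ρ(a) l_s ⊗ λ_s`. -/
theorem regularFamily_twist (x : A × Γ) (ξ : lp (fun _ : Γ => K) 2) :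
    regularFamily α ρ x (D.twist ξ) = D.twist (tensorTranslate (ρ x.1 * l x.2) x.2 ξ) := by
  ext t
  rw [twist_apply, regularFamily_apply, twist_apply, diagTranslate_apply, D.map_act E ρ hρ,
    ← mul_apply_eq_comp, ← mul_apply_eq_comp, inv_inv, mul_assoc, D.mul, mul_inv_rev, inv_inv,
    mul_inv_cancel_left, mul_assoc]

theorem star_regularFamily_twist (x : A × Γ) (ξ : lp (fun _ : Γ => K) 2) :
    star (regularFamily α ρ x) (D.twist ξ) =
      D.twist (star (tensorTranslate (ρ x.1 * l x.2) x.2) ξ) := by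
  have h1 := (D.isCrossedFamily E ρ hρ).adj x.1 x.2
  have h2 := D.regularFamily_twist E ρ hρ (α.act x.2⁻¹ (star x.1), x.2⁻¹) ξ
  rw [← (isCrossedFamily_regularFamily ρ).adj] at h2
  rw [h2, star_diagTranslate]
  simp only [h1]
  rfl

omit D E hρ in
theorem _root_.amplify_mul_tensorTranslate_mul (u z v : K →L[ℂ] K)
    (s : Γ) : amplify Γ K u * tensorTranslate z s * amplify Γ K v =
      tensorTranslate (u * z * v) s := by
  ext ξ t
  simp [amplify, diagTranslate_apply]

/-- The compression argument is applied to `l_s ⊗ λ_s` with `ρ(b) ⊗ 1` and `c ⊗ 1`. The twist then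
places the result in the regular representation induced by `ρ`, which the reduced crossed product
controls. -/
theorem norm_eval_le_red (q : StarTerm Γ) :
    ‖q.eval fun s => tensorTranslate (star c * l s * c) s‖ ≤
      ‖q.eval fun s => RedCrossed.mk α (b * α.act s b) s‖ := by
  have hw := D.rho_root E ρ hρ
  have h1 := norm_eval_compression (w := amplify Γ K (ρ b)) (c := amplify Γ K c)
    (by rw [← map_star, hw.1]) (by rw [← map_star, ← map_mul (amplify Γ K), hw.2, map_mul])
    (fun s => tensorTranslate (l s) s) q
  simp only [← map_star, amplify_mul_tensorTranslate_mul, ← D.rho_projection E ρ hρ] at h1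
  rw [← h1]
  refine (norm_eval_le_of_intertwine D.twist
    (T := fun s => regularFamily α ρ (b * α.act s b, s))
    (fun s ξ => D.regularFamily_twist E ρ hρ (b * α.act s b, s) ξ)
    (fun s ξ => D.star_regularFamily_twist E ρ hρ (b * α.act s b, s) ξ) q).trans ?_
  have h2 := NonUnitalStarAlgHom.norm_apply_le (RedCrossed.rep α ⟨K, ρ⟩).hom
    (q.eval fun s => RedCrossed.mk α (b * α.act s b) s)
  rw [StarTerm.map_eval] at h2
  simp only [RedCrossed.rep_mk] at h2
  exact h2

end ProjDilation

/-! ### The dilation of a projection on `ℓ²(Γ, H)` -/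

section Dilation

variable {Γ : Type u} [Group Γ] {H : Type u} [NormedAddCommGroup H] [InnerProductSpace ℂ H]
  [CompleteSpace H]

open Classical in
/-- The embedding of the operators on `H` as operators on the summand `H` of `ℓ²(Γ, H)` at `1`. -/
def cornerEmbedding (Γ : Type u) [Group Γ] (H : Type u) [NormedAddCommGroup H]
    [InnerProductSpace ℂ H] [CompleteSpace H] :
    (H →L[ℂ] H) →⋆ₙₐ[ℂ] (lp (fun _ : Γ => H) 2 →L[ℂ] lp (fun _ : Γ => H) 2) where
  toFun x := (lp.singleContinuousLinearMap ℂ (fun _ : Γ => H) 2 1).comp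
    (x.comp (lp.evalCLM ℂ (fun _ : Γ => H) 2 1))
  map_smul' c x := by
    ext ξ : 1
    exact map_smul (lp.singleContinuousLinearMap ℂ (fun _ : Γ => H) 2 1) c (x (ξ 1))
  map_zero' := by
    ext ξ : 1
    exact map_zero (lp.singleContinuousLinearMap ℂ (fun _ : Γ => H) 2 1)
  map_add' x y := by
    ext ξ : 1
    exact map_add (lp.singleContinuousLinearMap ℂ (fun _ : Γ => H) 2 1) (x (ξ 1)) (y (ξ 1))
  map_mul' x y := by
    ext ξ : 1
    change (lp.single 2 1 (x (y (ξ 1))) : lp (fun _ : Γ => H) 2) =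
      lp.single 2 1 (x ((lp.single 2 1 (y (ξ 1)) : lp (fun _ : Γ => H) 2) 1))
    rw [lp.single_apply_self]
  map_star' x := by
    rw [ContinuousLinearMap.star_eq_adjoint (ContinuousLinearMap.comp _ _)]
    rw [ContinuousLinearMap.eq_adjoint_iff]
    intro ξ η
    change inner ℂ (lp.single 2 1 (star x (ξ 1)) : lp (fun _ : Γ => H) 2) η =
      inner ℂ ξ (lp.single 2 1 (x (η 1)) : lp (fun _ : Γ => H) 2)
    rw [lp.inner_single_left, lp.inner_single_right, ContinuousLinearMap.star_eq_adjoint,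
      ContinuousLinearMap.adjoint_inner_left]

open Classical in
theorem cornerEmbedding_apply (x : H →L[ℂ] H) (ξ : lp (fun _ : Γ => H) 2) :
    cornerEmbedding Γ H x ξ = lp.single 2 1 (x (ξ 1)) := rfl

theorem cornerEmbedding_injective : Function.Injective (cornerEmbedding Γ H) := fun x y h => by
  classical
  ext ξ
  have h1 := congrArg (fun T : lp (fun _ : Γ => H) 2 →L[ℂ] lp (fun _ : Γ => H) 2 =>
    T (lp.single 2 1 ξ) 1) h
  simpa only [cornerEmbedding_apply, lp.single_apply_self] using h1

variable {F : Finset Γ} {π : Γ → H →L[ℂ] H}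

open Classical in
/-- The operator `(c ξ)(t) = π_{t⁻¹} ξ(1)`. -/
def dilationOp (F : Finset Γ) (π : Γ → H →L[ℂ] H) :
    lp (fun _ : Γ => H) 2 →L[ℂ] lp (fun _ : Γ => H) 2 :=
  ∑ r ∈ F, (lp.singleContinuousLinearMap ℂ (fun _ : Γ => H) 2 r).comp
    ((π r⁻¹).comp (lp.evalCLM ℂ (fun _ : Γ => H) 2 1))

theorem dilationOp_apply (hπ : IsProjFamily F π) (ξ : lp (fun _ : Γ => H) 2) (t : Γ) :
    dilationOp F π ξ t = π t⁻¹ (ξ 1) := by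
  classical
  have h1 : dilationOp F π ξ = ∑ r ∈ F, lp.single 2 r (π r⁻¹ (ξ 1)) := by
    rw [dilationOp, sum_apply]
    rfl
  rw [h1, lp.coeFn_sum, Finset.sum_apply]
  by_cases ht : t ∈ F
  · rw [Finset.sum_eq_single_of_mem t ht fun r _ hr => lp.single_apply_ne _ _ _ hr.symm,
      lp.single_apply_self]
  · rw [← hπ.adj, hπ.zero t ht, star_zero, zero_apply]
    refine Finset.sum_eq_zero fun r hr => lp.single_apply_ne _ _ _ ?_
    rintro rfl
    exact ht hr

/-- The matrix coefficient is `∑_t π_{t⁻¹}* π_{t⁻¹g} = ∑_t π_t π_{t⁻¹g}`, which is `π_g` by the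
projection relation. Thus the dilation recovers `π` on the summand at `1`. -/
theorem star_dilationOp_mul (hπ : IsProjFamily F π) (g : Γ) :
    star (dilationOp F π) * tensorTranslate 1 g * dilationOp F π = cornerEmbedding Γ H (π g) := by
  classical
  ext1 ξ
  refine ext_inner_left ℂ fun η => ?_
  rw [mul_assoc, mul_apply_eq_comp, ContinuousLinearMap.star_eq_adjoint,
    ContinuousLinearMap.adjoint_inner_right, cornerEmbedding_apply, lp.inner_single_right,
    lp.inner_eq_tsum, hπ.mul g, sum_apply, inner_sum, tsum_eq_sum (s := F)]
  · refine Finset.sum_congr rfl fun t _ => ?_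
    rw [mul_apply_eq_comp, diagTranslate_apply, dilationOp_apply hπ, dilationOp_apply hπ, ← hπ.adj,
      ContinuousLinearMap.star_eq_adjoint, ContinuousLinearMap.adjoint_inner_left, mul_inv_rev,
      inv_inv]
    rfl
  · intro t ht
    rw [dilationOp_apply hπ, ← hπ.adj, hπ.zero t ht, star_zero, zero_apply, inner_zero_left]

theorem projDilation (hF : ∀ s ∈ F, s⁻¹ ∈ F) (hπ : IsProjFamily F π) :
    ProjDilation F (fun s : Γ => tensorTranslate (1 : H →L[ℂ] H) s) (dilationOp F π) where
  one := by
    ext ξ t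
    simp [diagTranslate_apply]
  mul s t := by
    ext ξ r
    simp [diagTranslate_apply, mul_assoc]
  star_eq s := by
    rw [star_diagTranslate]
    simp only [star_one]
  zero s hs := by rw [star_dilationOp_mul hπ, hπ.zero s hs, map_zero]
  sum := by
    classical
    ext ξ t
    rw [sum_apply, lp.coeFn_sum, Finset.sum_apply, dilationOp_apply hπ]
    have h1 (f : Γ) : ((tensorTranslate (1 : H →L[ℂ] H) f⁻¹ * dilationOp F π *
        (star (dilationOp F π) * tensorTranslate 1 f * dilationOp F π) :
          lp (fun _ : Γ => H) 2 →L[ℂ] lp (fun _ : Γ => H) 2) ξ) t =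
        (π (t⁻¹ * f⁻¹) * π f) (ξ 1) := by
      rw [star_dilationOp_mul hπ, mul_apply_eq_comp, mul_apply_eq_comp, diagTranslate_apply,
        dilationOp_apply hπ, cornerEmbedding_apply, lp.single_apply_self, inv_inv, mul_inv_rev]
      rfl
    simp only [h1]
    rw [← sum_apply]
    refine congrArg (fun T : H →L[ℂ] H => T (ξ 1)) ?_
    -- The reproducing formula for `c` is the adjoint of the projection relation, with the summation
    -- index inverted; here `F = F⁻¹` is needed.
    have h2 := congrArg star (hπ.mul t)
    rw [star_sum, hπ.adj] at h2
    rw [h2]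
    have h3 (s : Γ) : star (π s * π (s⁻¹ * t)) = π (t⁻¹ * s) * π s⁻¹ := by
      rw [star_mul, hπ.adj, hπ.adj, mul_inv_rev, inv_inv]
    simp only [h3]
    refine Finset.sum_nbij' (·⁻¹) (·⁻¹) hF hF ?_ ?_ ?_ <;> simp

end Dilation

/-! ### Relations in universal C*-algebras -/

/-- Positivity can be checked in jointly injective families of homomorphisms. -/
theorem exists_eq_star_mul_self {A : Type v} [NonUnitalCStarAlgebra A] {J : Type*}
    {B : J → Type w} [∀ j, NonUnitalCStarAlgebra (B j)] (φ : ∀ j, A →⋆ₙₐ[ℂ] B j)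
    (hφ : ∀ a, (∀ j, φ j a = 0) → a = 0) {a : A} (h : ∀ j, ∃ b, φ j a = star b * b) :
    ∃ b, a = star b * b := by
  let _ := spectralOrder A
  have _ := spectralOrderedRing A
  have ha : IsSelfAdjoint a := sub_eq_zero.mp <| hφ _ fun j => by
    obtain ⟨b, hb⟩ := h j
    rw [map_sub, map_star, hb, star_mul, star_star, sub_self]
  -- Positivity is not a polynomial identity, so it is expressed by the vanishing of the negative
  -- part, and homomorphisms commute with functional calculus.
  have h1 : a⁻ = 0 := hφ _ fun j => by
    let _ := spectralOrder (B j)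
    have _ := spectralOrderedRing (B j)
    obtain ⟨b, hb⟩ := h j
    have h2 : 0 ≤ φ j a := hb ▸ star_mul_self_nonneg b
    rw [CFC.negPart_def, NonUnitalStarAlgHom.map_cfcₙ (S := ℂ) (φ j) _ a
      (hφ := map_continuous (φ j)) (ha := ha) (hφa := IsSelfAdjoint.of_nonneg h2),
      ← CFC.negPart_def]
    exact (CFC.negPart_eq_zero_iff _ (IsSelfAdjoint.of_nonneg h2)).mpr h2
  have h3 : 0 ≤ a := (CFC.negPart_eq_zero_iff a ha).mp h1
  exact ⟨CFC.sqrt a, by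
    rw [(IsSelfAdjoint.of_nonneg (CFC.sqrt_nonneg a)).star_eq, CFC.sqrt_mul_sqrt_self a h3]⟩

section Families

variable {A : Type u} {B : Type u} [NonUnitalCStarAlgebra A] [NonUnitalCStarAlgebra B]
  (φ : A →⋆ₙₐ[ℂ] B)

theorem map_foldl_mul {X : Type*} (p : X → A) (m : List X) (z : A) :
    φ (m.foldl (fun x a => x * p a) z) = m.foldl (fun x a => x * φ (p a)) (φ z) := by
  induction m generalizing z with
  | nil => rfl
  | cons a m ih => rw [List.foldl_cons, List.foldl_cons, ih, map_mul]

theorem map_foldr_mul {X : Type*} (p : X → A) (m : List X) (z : A) :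
    φ (m.foldr (fun a x => p a * x) z) = m.foldr (fun a x => φ (p a) * x) (φ z) := by
  induction m generalizing z with
  | nil => rfl
  | cons a m ih => rw [List.foldr_cons, List.foldr_cons, map_mul, ih]

variable {Γ : Type u} [Group Γ] {F : Finset Γ}

theorem IsProjFamily.map {p : Γ → A} (hp : IsProjFamily F p) : IsProjFamily F fun s => φ (p s) where
  zero s hs := by rw [hp.zero s hs, map_zero]
  adj s := by rw [← map_star, hp.adj]
  mul t := by
    simp only [← map_mul, ← map_sum]
    rw [← hp.mul]

theorem IsStrongProjFamily.map {p : Γ → A} (hp : IsStrongProjFamily F p) :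
    IsStrongProjFamily F fun s => φ (p s) where
  toIsProjFamily := hp.toIsProjFamily.map φ
  prod s m hm := by rw [← map_foldl_mul, hp.prod s m hm, map_zero]

variable {R : RepClass.{u} Γ}

theorem isProjFamily_gen (h : ∀ i, IsProjFamily F (R.val i)) :
    IsProjFamily F (CStarGen.gen R) where
  zero s hs := CStarGen.eq_zero_of_evalHom _ fun i => by rw [CStarGen.evalHom_gen, (h i).zero s hs]
  adj s := CStarGen.ext_evalHom fun i => by
    rw [map_star, CStarGen.evalHom_gen, CStarGen.evalHom_gen, (h i).adj]
  mul t := CStarGen.ext_evalHom fun i => by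
    simp only [map_sum, map_mul, CStarGen.evalHom_gen]
    exact (h i).mul t

theorem isStrongProjFamily_gen (h : ∀ i, IsStrongProjFamily F (R.val i)) :
    IsStrongProjFamily F (CStarGen.gen R) where
  toIsProjFamily := isProjFamily_gen fun i => (h i).toIsProjFamily
  prod s m hm := CStarGen.eq_zero_of_evalHom _ fun i => by
    rw [map_foldl_mul]
    simp only [CStarGen.evalHom_gen]
    exact (h i).prod s m hm

theorem isComplexFamily_gen (h : ∀ i, IsComplexFamily F (R.val i)) :
    IsComplexFamily F (CStarGen.gen R) where
  pos s := exists_eq_star_mul_self (CStarGen.evalHom R)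
    (fun _ ha => CStarGen.eq_zero_of_evalHom R ha) fun i => by
      rw [CStarGen.evalHom_gen]
      exact (h i).pos s
  orth s t hst := CStarGen.eq_zero_of_evalHom _ fun i => by
    rw [map_mul, CStarGen.evalHom_gen, CStarGen.evalHom_gen, (h i).orth s t hst]
  sum t := CStarGen.ext_evalHom fun i => by
    simp only [map_sum, map_mul, CStarGen.evalHom_gen]
    exact (h i).sum t

theorem isStrongComplexFamily_gen (h : ∀ i, IsStrongComplexFamily F (R.val i)) :
    IsStrongComplexFamily F (CStarGen.gen R) where
  toIsComplexFamily := isComplexFamily_gen fun i => (h i).toIsComplexFamily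
  prod s t hst m := CStarGen.eq_zero_of_evalHom _ fun i => by
    rw [map_mul, map_foldr_mul]
    simp only [CStarGen.evalHom_gen]
    exact (h i).prod s t hst m

end Families

/-! ### The defining relations hold in the universal algebras -/

section Universal

variable {Γ : Type u} [Group Γ] (F : Finset Γ)

theorem ProjAlg.isProjFamily : IsProjFamily F (ProjAlg.p F) :=
  isProjFamily_gen fun i => RelFamily.prop i

theorem ProjAlg.generates : Generates (ProjAlg.p F) := CStarGen.generates_gen _

theorem StrongProjAlg.isStrongProjFamily : IsStrongProjFamily F (StrongProjAlg.p F) :=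
  isStrongProjFamily_gen fun i => RelFamily.prop i

theorem StrongProjAlg.generates : Generates (StrongProjAlg.p F) := CStarGen.generates_gen _

variable {F}

theorem ComplexAlg.exists_equivariantComplex (hF : ∀ s ∈ F, s⁻¹ ∈ F) :
    ∃ b, EquivariantComplex F (ComplexAlg.action F)
      (CStarGen.gen (RepClass.ofRelations (X := Γ) (fun h => IsComplexFamily F h)
        fun s => ⟨1, fun _ _ _ hh => hh.norm_le s⟩)) b := by
  have h1 : IsComplexFamily F (CStarGen.gen (RepClass.ofRelations (X := Γ)
      (fun h => IsComplexFamily F h) fun s => ⟨1, fun _ _ _ hh => hh.norm_le s⟩)) :=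
    isComplexFamily_gen fun i => RelFamily.prop i
  obtain ⟨b, hb, hb'⟩ := exists_selfAdjoint_mul_self_eq (h1.pos 1)
  exact ⟨b, h1, CStarGen.generates_gen _, fun g s =>
    CStarGen.relabelRelations_gen (g * ·) (fun _ _ _ hf => hf.translate g) s, hF, hb,
    hb'⟩

theorem StrongComplexAlg.exists_equivariantComplex (hF : ∀ s ∈ F, s⁻¹ ∈ F) :
    ∃ b, EquivariantComplex F (StrongComplexAlg.action F)
      (CStarGen.gen (RepClass.ofRelations (X := Γ) (fun h => IsStrongComplexFamily F h)
        fun s => ⟨1, fun _ _ _ hh => hh.norm_le s⟩)) b := by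
  have h1 : IsStrongComplexFamily F (CStarGen.gen (RepClass.ofRelations (X := Γ)
      (fun h => IsStrongComplexFamily F h) fun s => ⟨1, fun _ _ _ hh => hh.norm_le s⟩)) :=
    isStrongComplexFamily_gen fun i => RelFamily.prop i
  obtain ⟨b, hb, hb'⟩ := exists_selfAdjoint_mul_self_eq (h1.pos 1)
  exact ⟨b, h1.toIsComplexFamily, CStarGen.generates_gen _,
    fun g s => CStarGen.relabelRelations_gen (g * ·) (fun _ _ _ hf => hf.translate g) s, hF, hb, hb'⟩

end Universal

/-! ### Norm estimates from dilations -/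

/-- The representation `π` on the direct summand at `1` of `ℓ²(Γ, H)`. -/
def dilatedRep (Γ : Type u) [Group Γ] {P : Type u} [NonUnitalCStarAlgebra P] (π : HilbRep P) :
    HilbRep P where
  space := lp (fun _ : Γ => π.space) 2
  hom := (cornerEmbedding Γ π.space).comp π.hom

theorem eq_zero_of_dilatedRep (Γ : Type u) [Group Γ] {P : Type u} [NonUnitalCStarAlgebra P] {a : P}
    (h : ∀ π : HilbRep P, (dilatedRep Γ π).hom a = 0) : a = 0 :=
  HilbRep.jointly_injective fun π =>
    cornerEmbedding_injective ((h π).trans (map_zero (cornerEmbedding Γ π.space)).symm)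

/-- The elements `h_s` act on the dilations of all representations of the coefficients `p_s`. -/
def ActsOnDilations {Γ : Type u} [Group Γ] (F : Finset Γ) {P A : Type u} [NonUnitalCStarAlgebra P]
    [NonUnitalCStarAlgebra A] (p : Γ → P) (h : Γ → A) : Prop :=
  ∀ π : HilbRep P, ∃ ρ : A →⋆ₙₐ[ℂ]
      (lp (fun _ : Γ => π.space) 2 →L[ℂ] lp (fun _ : Γ => π.space) 2),
    ∀ s, ρ (h s) = tensorTranslate 1 s * dilationOp F (fun s => π.hom (p s)) *
      star (dilationOp F fun s => π.hom (p s)) * tensorTranslate 1 s⁻¹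

section Estimates

variable {Γ : Type u} [Group Γ] {F : Finset Γ} {P A : Type u} [NonUnitalCStarAlgebra P]
  [NonUnitalCStarAlgebra A] {p : Γ → P} {α : CStarAction Γ A} {h : Γ → A} {b : A}

theorem cornerEmbedding_eq (hpp : IsProjFamily F p) (π : HilbRep P) :
    (fun s => cornerEmbedding Γ π.space (π.hom (p s))) = fun s =>
      star (dilationOp F fun s => π.hom (p s)) * tensorTranslate 1 s *
        dilationOp F (fun s => π.hom (p s)) :=
  funext fun s => (star_dilationOp_mul (hpp.map π.hom) s).symm

/-- Every representation of `P` reappears as the coefficients `c* l_s c` of its dilation, so the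
norm of `P` is bounded by that of the crossed product acting on these dilations. -/
theorem ActsOnDilations.norm_eval_le_full (hA : ActsOnDilations F p h) (hpp : IsProjFamily F p)
    (E : EquivariantComplex F α h b) (q : StarTerm Γ) :
    ‖q.eval p‖ ≤ ‖q.eval fun s => FullCrossed.mk α (b * α.act s b) s‖ :=
  norm_le_of_jointly_injective
    (B := fun π : HilbRep P => lp (fun _ : Γ => π.space) 2 →L[ℂ] lp (fun _ : Γ => π.space) 2)
    (fun π => (cornerEmbedding Γ π.space).comp π.hom)
    (fun _ ha => eq_zero_of_dilatedRep Γ ha) (norm_nonneg _) fun π => by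
      obtain ⟨ρ, hρ⟩ := hA π
      have h1 := StarTerm.map_eval ((cornerEmbedding Γ π.space).comp π.hom) p q
      refine le_trans (le_of_eq (congrArg norm h1)) ?_
      have h2 := (projDilation E.inv (hpp.map π.hom)).norm_eval_le_full E ρ hρ q
      rw [← cornerEmbedding_eq hpp π] at h2
      exact h2

/-- The same argument after tensoring with `λ`: the dilated representations still separate points,
hence their tensor products with `λ` compute the norm of `p_s ⊗ λ_s`. -/
theorem ActsOnDilations.norm_eval_tmul_le_red (hA : ActsOnDilations F p h)
    (hpp : IsProjFamily F p) (E : EquivariantComplex F α h b) (q : StarTerm Γ) :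
    ‖q.eval fun s => (MinTensor.tmul (p s) (.unit s) : MinTensor P (RedGroupCStar Γ))‖ ≤
      ‖q.eval fun s => RedCrossed.mk α (b * α.act s b) s‖ :=
  norm_eval_tmul_unit_le (fun π : HilbRep P => dilatedRep Γ π)
    (fun _ ha => eq_zero_of_dilatedRep Γ ha) p (fun s => s) q (norm_nonneg _) fun π => by
      obtain ⟨ρ, hρ⟩ := hA π
      have h1 : (fun s => tensorTranslate (cornerEmbedding Γ π.space (π.hom (p s))) s) =
          fun s => tensorTranslate (star (dilationOp F fun s => π.hom (p s)) *
            tensorTranslate 1 s * dilationOp F (fun s => π.hom (p s))) s :=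
        funext fun s => congrArg (fun x => tensorTranslate x s)
          (congrFun (cornerEmbedding_eq hpp π) s)
      have h2 := (projDilation E.inv (hpp.map π.hom)).norm_eval_le_red E ρ hρ q
      rw [← h1] at h2
      exact h2

theorem ComplexAlg.actsOnDilations (hF : ∀ s ∈ F, s⁻¹ ∈ F) (hpp : IsProjFamily F p) :
    ActsOnDilations F p (CStarGen.gen (RepClass.ofRelations (X := Γ) (fun h => IsComplexFamily F h)
        fun s => ⟨1, fun _ _ _ hh => hh.norm_le s⟩)) := fun π =>
  CStarGen.exists_hom_of_relations _ (projDilation hF (hpp.map π.hom)).isComplexFamily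

theorem StrongComplexAlg.actsOnDilations (hF : ∀ s ∈ F, s⁻¹ ∈ F) (hpp : IsStrongProjFamily F p) :
    ActsOnDilations F p (CStarGen.gen (RepClass.ofRelations (X := Γ)
      (fun h => IsStrongComplexFamily F h) fun s => ⟨1, fun _ _ _ hh => hh.norm_le s⟩)) := fun π =>
  CStarGen.exists_hom_of_relations _ <|
    (projDilation hF (hpp.toIsProjFamily.map π.hom)).isStrongComplexFamily <| by
      have h1 := hpp.map ((cornerEmbedding Γ π.space).comp π.hom)
      simp only [NonUnitalStarAlgHom.comp_apply] at h1
      rw [cornerEmbedding_eq hpp.toIsProjFamily π] at h1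
      exact h1

/-- The coefficients of the projection in the reduced crossed product are dominated by the elements
`p_s ⊗ λ_s`. -/
theorem norm_eval_red_le_tmul (E : EquivariantComplex F α h b) (q : StarTerm Γ) :
    ‖q.eval fun s => RedCrossed.mk α (b * α.act s b) s‖ ≤
      ‖q.eval fun s => (MinTensor.tmul (ProjAlg.p F s) (.unit s) :
        MinTensor (ProjAlg F) (RedGroupCStar Γ))‖ :=
  RedCrossed.norm_eval_mk_le _ _ q (norm_nonneg _) fun π => by
    -- In a regular representation the elements `b u_s b` satisfy the projection relations and so
    -- define a representation `τ` of `ProjAlg F`. Then `τ ⊗ λ` sends `p_s ⊗ λ_s` to `(b u_s b) ⊗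
    -- λ_s`, whose restriction to the diagonal is `b u_s b` itself.
    obtain ⟨τ, hτ⟩ := CStarGen.exists_hom_of_relations (X := Γ)
      (rel := fun p => IsProjFamily F p) (bound := fun s => ⟨1, fun _ _ _ hp => hp.norm_le s⟩)
      (fun s => regularFamily α π.hom (b * α.act s b, s))
      (E.isProjFamily (isCrossedFamily_regularFamily π.hom))
    let σ : HilbRep (ProjAlg F) := ⟨lp (fun _ : Γ => π.space) 2, τ⟩
    have h1 := NonUnitalStarAlgHom.norm_apply_le (dualRep Γ σ).hom
      (q.eval fun s => (MinTensor.tmul (ProjAlg.p F s) (.unit s) :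
        MinTensor (ProjAlg F) (RedGroupCStar Γ)))
    rw [StarTerm.map_eval] at h1
    have h2 : (fun s => (dualRep Γ σ).hom (MinTensor.tmul (ProjAlg.p F s) (.unit s))) = fun s =>
        (tensorTranslate (regularFamily α π.hom (b * α.act s b, s)) s :
          (dualRep Γ σ).space →L[ℂ] (dualRep Γ σ).space) :=
      funext fun s => by
        rw [dualRep_tmul]
        exact congrArg (fun x => tensorTranslate x s) (hτ s)
    rw [h2] at h1
    refine le_trans ?_ h1
    exact norm_eval_diagTranslate_le _ _ _ _ _ (fun _ _ => le_rfl) q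

end Estimates

/-! ### Injectivity of the action in the strong case -/

section Words

variable {Γ : Type u} [Group Γ] {F : Finset Γ} {P : Type u} [NonUnitalCStarAlgebra P] {p : Γ → P}

/-- The product of a nonempty word in the elements `p_s`. -/
def wordProd (p : Γ → P) (s : Γ) (l : List Γ) : P := l.foldl (fun x a => x * p a) (p s)

omit [Group Γ] in
theorem wordProd_mul (s t : Γ) (l m : List Γ) :
    wordProd p s l * wordProd p t m = wordProd p s (l ++ t :: m) := by
  rw [wordProd, wordProd, wordProd, mul_foldl_mul, List.foldl_append, List.foldl_cons]

theorem exists_star_wordProd (hpp : IsProjFamily F p) (s : Γ) (l : List Γ) :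
    ∃ t m, star (wordProd p s l) = wordProd p t m := by
  induction l generalizing s with
  | nil => exact ⟨s⁻¹, [], hpp.adj s⟩
  | cons a l ih =>
    obtain ⟨t, m, h⟩ := ih a
    have h1 := wordProd_mul (p := p) s a [] l
    rw [List.nil_append] at h1
    refine ⟨t, m ++ s⁻¹ :: [], ?_⟩
    rw [← h1, star_mul, h, ← wordProd_mul]
    exact congrArg _ (hpp.adj s)

theorem isHomogeneous_wordProd {δ : P →⋆ₙₐ[ℂ] MinTensor P (RedGroupCStar Γ)}
    (hδ : ∀ s, IsHomogeneous δ s (p s)) (s : Γ) (l : List Γ) :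
    IsHomogeneous δ (s * l.prod) (wordProd p s l) := by
  induction l generalizing s with
  | nil => simpa [wordProd] using hδ s
  | cons a l ih =>
    have h1 := wordProd_mul (p := p) s a [] l
    rw [List.nil_append] at h1
    rw [← h1, List.prod_cons]
    exact (hδ s).mul (ih a)

/-- The representation `dualRep` as a homomorphism to the operators on `ℓ²(Γ, H)`. -/
def dualHom (Γ : Type u) [Group Γ] (π : HilbRep P) : MinTensor P (RedGroupCStar Γ) →⋆ₙₐ[ℂ]
    (lp (fun _ : Γ => π.space) 2 →L[ℂ] lp (fun _ : Γ => π.space) 2) :=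
  (dualRep Γ π).hom

theorem dualHom_tmul (π : HilbRep P) (a : P) (s : Γ) :
    dualHom Γ π (MinTensor.tmul a (.unit s)) = tensorTranslate (π.hom a) s :=
  dualRep_tmul π a s

/-- If all products of the coefficients with support outside `F` vanish, then every representation
of `P` can be recovered from the representation `dualHom` composed with the action. -/
theorem IsStrongProjFamily.sum_dualHom (hpp : IsStrongProjFamily F p) (hp : Generates p)
    {δ : P →⋆ₙₐ[ℂ] MinTensor P (RedGroupCStar Γ)} (hδ : ∀ s, IsHomogeneous δ s (p s))
    (π : HilbRep P) (ξ : π.space) (a : P) [DecidableEq Γ] :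
    ∑ s ∈ F, dualHom Γ π (δ a) (lp.single 2 1 ξ) s = π.hom a ξ := by
  let L : P →L[ℂ] π.space := ∑ s ∈ F, (lp.evalCLM ℂ (fun _ : Γ => π.space) 2 s).comp
    ((ContinuousLinearMap.apply ℂ _ (lp.single 2 1 ξ : lp (fun _ : Γ => π.space) 2)).comp
      ((dualHom Γ π).comp δ).toCLM)
  let R : P →L[ℂ] π.space := (ContinuousLinearMap.apply ℂ _ ξ).comp π.hom.toCLM
  have hL (a : P) : L a = ∑ s ∈ F, dualHom Γ π (δ a) (lp.single 2 1 ξ) s := by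
    simp only [L, sum_apply]
    rfl
  rw [← hL]
  change L a = R a
  refine hp.mem_of_mul_star (T := {y | ∃ s l, y = wordProd p s l})
    (S := LinearMap.eqLocus L.toLinearMap R.toLinearMap) (fun s => ⟨s, [], rfl⟩) ?_ ?_
    (isClosed_eq L.continuous R.continuous) ?_ a
  · rintro _ ⟨s, l, rfl⟩ _ ⟨t, m, rfl⟩
    exact ⟨_, _, wordProd_mul s t l m⟩
  · rintro _ ⟨s, l, rfl⟩
    exact exists_star_wordProd hpp.toIsProjFamily s l
  · rintro _ ⟨s, l, rfl⟩
    change L (wordProd p s l) = R (wordProd p s l)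
    -- A word of degree `g` moves `ξ` from the coordinate `1` to the coordinate `g`. The finite sum
    -- sees this coordinate if `g ∈ F`, and otherwise the word vanishes. Finiteness of `F` keeps the
    -- sum continuous in `a`, so words suffice.
    by_cases hg : s * l.prod ∈ F
    · rw [hL, isHomogeneous_wordProd hδ, dualHom_tmul]
      simp only [diagTranslate_apply]
      rw [Finset.sum_eq_single_of_mem _ hg]
      · rw [inv_mul_cancel, lp.single_apply_self]
        rfl
      · intro t _ ht
        rw [lp.single_apply_ne, map_zero]
        exact fun h => ht (inv_mul_eq_one.mp h).symm
    · rw [show wordProd p s l = 0 from hpp.prod s l hg, map_zero, map_zero]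

theorem IsStrongProjFamily.injective_of_isHomogeneous (hpp : IsStrongProjFamily F p)
    (hp : Generates p) {δ : P →⋆ₙₐ[ℂ] MinTensor P (RedGroupCStar Γ)}
    (hδ : ∀ s, IsHomogeneous δ s (p s)) : Function.Injective δ := by
  classical
  refine (injective_iff_map_eq_zero δ).mpr fun a ha => HilbRep.jointly_injective fun π => ?_
  ext ξ
  rw [← hpp.sum_dualHom hp hδ π ξ a, ha, map_zero]
  simp

end Words

/-! ### The Morita equivalences -/

section Main

variable {Γ : Type u} [Group Γ] {F : Finset Γ} {A : Type u} [NonUnitalCStarAlgebra A]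
  {α : CStarAction Γ A} {h : Γ → A} {b : A} {C P : Type u} [NonUnitalCStarAlgebra C]
  [NonUnitalCStarAlgebra P] {p : Γ → P} {f : A × Γ → C}

namespace EquivariantComplex

variable (E : EquivariantComplex F α h b)

include E

theorem exists_dualMoritaEquivalent (hf : IsCrossedFamily α f) (hgen : Generates f)
    {δ : DualAction Γ C} (hδ : ∀ x, IsHomogeneous δ.δ x.2 (f x)) (hp : Generates p)
    (φ : P →⋆ₙₐ[ℂ] C) (hφ : Function.Injective φ) (hφp : ∀ s, φ (p s) = f (b * α.act s b, s)) :
    ∃ δP : DualAction Γ P, (∀ s, IsHomogeneous δP.δ s (p s)) ∧ DualMoritaEquivalent δP δ := by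
  obtain ⟨δP, hδP⟩ := exists_dualAction_of_injective φ hφ hp (fun s => s)
    fun s => (hφp s).symm ▸ hδ (b * α.act s b, s)
  exact ⟨δP, hδP, E.dualMoritaEquivalent hf hgen hδ hp hδP φ hφ hφp⟩

/-- A homomorphism between C*-algebras generated by crossed families is injective if it is injective on
the image of an algebra generated by the coefficients of the projection. -/
theorem injective_of_injective_comp (hf : IsCrossedFamily α f) (hgen : Generates f)
    (hp : Generates p) (φ : P →⋆ₙₐ[ℂ] C) (hφ : Function.Injective φ)
    (hφp : ∀ s, φ (p s) = f (b * α.act s b, s)) {D : Type u} [NonUnitalCStarAlgebra D]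
    (κ : C →⋆ₙₐ[ℂ] D) (hκ : Function.Injective (κ.comp φ)) : Function.Injective κ := by
  refine (injective_iff_map_eq_zero κ).mpr fun z hz => ?_
  -- The kernel of `κ` meets the corner trivially, because the corner is the image of `φ` and `κ` is
  -- injective there.
  have h1 (x : C) (hx : κ x = 0) : f (b, 1) * x * f (b, 1) = 0 := by
    have h2 : f (b, 1) * x * f (b, 1) ∈ Set.range φ := by
      rw [E.range_eq_corner hf hgen hp φ hφ hφp]
      exact subset_closure ⟨x, rfl⟩
    obtain ⟨y, hy⟩ := h2
    have h3 : κ.comp φ y = 0 := by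
      rw [NonUnitalStarAlgHom.comp_apply, hy, map_mul, map_mul, hx, mul_zero, zero_mul]
    rw [← hy, hκ (h3.trans (map_zero (κ.comp φ)).symm), map_zero]
  -- Fullness, used first to the left of `z` and then to its right, spreads the vanishing from the
  -- corner to all products `c z d`.
  have h4 (c d : C) : c * (z * d * f (b, 1)) = 0 := by
    refine E.mem_of_corner_mem hf hgen
      (LinearMap.ker ((ContinuousLinearMap.mul ℂ C).flip (z * d * f (b, 1))).toLinearMap)
      (ContinuousLinearMap.isClosed_ker _) (fun x y => ?_) c
    change x * (f (b, 1) * f (b, 1)) * y * (z * d * f (b, 1)) = 0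
    have h5 := h1 (y * z * d) (by rw [map_mul, map_mul, hz, mul_zero, zero_mul])
    simp only [mul_assoc] at h5 ⊢
    rw [h5, mul_zero, mul_zero]
  refine eq_zero_of_forall_mul_mul fun c d => ?_
  refine E.mem_of_corner_mem hf hgen
    (LinearMap.ker (ContinuousLinearMap.mul ℂ C (c * z)).toLinearMap)
    (ContinuousLinearMap.isClosed_ker _) (fun x y => ?_) d
  change c * z * (x * (f (b, 1) * f (b, 1)) * y) = 0
  have h5 := h4 c x
  calc c * z * (x * (f (b, 1) * f (b, 1)) * y)
      = c * (z * x * f (b, 1)) * (f (b, 1) * y) := by simp only [mul_assoc]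
    _ = 0 := by rw [h5, zero_mul]

end EquivariantComplex

end Main

/-! ### The embeddings of the three projection algebras -/

section Final

variable {Γ : Type u} [Group Γ] {F : Finset Γ}

theorem RedProjAlg.generates (F : Finset Γ) : Generates (RedProjAlg.p F) :=
  Generates.subtype fun s : Γ => (MinTensor.tmul (ProjAlg.p F s) (.unit s) :
    MinTensor (ProjAlg F) (RedGroupCStar Γ))

theorem RedProjAlg.norm_eval (q : StarTerm Γ) : ‖q.eval (RedProjAlg.p F)‖ =
    ‖q.eval fun s => (MinTensor.tmul (ProjAlg.p F s) (.unit s) :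
      MinTensor (ProjAlg F) (RedGroupCStar Γ))‖ :=
  congrArg norm (StarTerm.map_eval (NonUnitalStarSubalgebraClass.subtype (cstarAdjoin
    (Set.range fun s : Γ => (MinTensor.tmul (ProjAlg.p F s) (.unit s) :
      MinTensor (ProjAlg F) (RedGroupCStar Γ))))) (RedProjAlg.p F) q)

theorem ProjAlg.exists_dualMoritaEquivalent (hF : ∀ s ∈ F, s⁻¹ ∈ F) :
    ∃ (δP : DualAction Γ (ProjAlg F)) (δE : DualAction Γ (FullCrossed (ComplexAlg.action F))),
      (∀ s, δP.δ (ProjAlg.p F s) = .tmul (ProjAlg.p F s) (.unit s)) ∧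
      (∀ a s, δE.δ (FullCrossed.mk _ a s) = .tmul (FullCrossed.mk _ a s) (.unit s)) ∧
      DualMoritaEquivalent δP δE := by
  obtain ⟨b, E⟩ := ComplexAlg.exists_equivariantComplex hF
  have hf := FullCrossed.isCrossedFamily (ComplexAlg.action F)
  obtain ⟨δE, hδE⟩ := FullCrossed.exists_dualAction (ComplexAlg.action F)
  obtain ⟨φ, hφ⟩ : ∃ φ : ProjAlg F →⋆ₙₐ[ℂ] FullCrossed (ComplexAlg.action F), ∀ s,
      φ (ProjAlg.p F s) = FullCrossed.mk _ (b * (ComplexAlg.action F).act s b) s :=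
    CStarGen.exists_hom_of_relations _ (E.isProjFamily hf)
  have hinj : Function.Injective φ :=
    (ProjAlg.generates F).injective_of_norm_eval φ fun q => by
      rw [funext hφ]
      exact (ComplexAlg.actsOnDilations hF (ProjAlg.isProjFamily F)).norm_eval_le_full
        (ProjAlg.isProjFamily F) E q
  obtain ⟨δP, hδP, hM⟩ := E.exists_dualMoritaEquivalent hf (FullCrossed.generates _) hδE
    (ProjAlg.generates F) φ hinj hφ
  exact ⟨δP, δE, hδP, fun a s => hδE (a, s), hM⟩

/-- No universal property is available for the reduced algebra. The diagonal estimate gives the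
homomorphism into the reduced crossed product, and the dilation estimate gives its injectivity. -/
theorem RedProjAlg.exists_dualMoritaEquivalent (hF : ∀ s ∈ F, s⁻¹ ∈ F) :
    ∃ (δP : DualAction Γ (RedProjAlg F)) (δE : DualAction Γ (RedCrossed (ComplexAlg.action F))),
      (∀ s, δP.δ (RedProjAlg.p F s) = .tmul (RedProjAlg.p F s) (.unit s)) ∧
      (∀ a s, δE.δ (RedCrossed.mk _ a s) = .tmul (RedCrossed.mk _ a s) (.unit s)) ∧
      DualMoritaEquivalent δP δE := by
  obtain ⟨b, E⟩ := ComplexAlg.exists_equivariantComplex hF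
  have hf := RedCrossed.isCrossedFamily (ComplexAlg.action F)
  obtain ⟨δE, hδE⟩ := RedCrossed.exists_dualAction (ComplexAlg.action F)
  obtain ⟨φ, hφ⟩ := (RedProjAlg.generates F).exists_hom
    (fun s => RedCrossed.mk (ComplexAlg.action F) (b * (ComplexAlg.action F).act s b) s)
    fun q => by
      rw [RedProjAlg.norm_eval]
      exact norm_eval_red_le_tmul E q
  have hinj : Function.Injective φ :=
    (RedProjAlg.generates F).injective_of_norm_eval φ fun q => by
      rw [funext hφ, RedProjAlg.norm_eval]
      exact (ComplexAlg.actsOnDilations hF (ProjAlg.isProjFamily F)).norm_eval_tmul_le_red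
        (ProjAlg.isProjFamily F) E q
  obtain ⟨δP, hδP, hM⟩ := E.exists_dualMoritaEquivalent hf (RedCrossed.generates _) hδE
    (RedProjAlg.generates F) φ hinj hφ
  exact ⟨δP, δE, hδP, fun a s => hδE (a, s), hM⟩

theorem StrongProjAlg.exists_dualMoritaEquivalent (hF : ∀ s ∈ F, s⁻¹ ∈ F) :
    ∃ (δP : DualAction Γ (StrongProjAlg F))
        (δE : DualAction Γ (FullCrossed (StrongComplexAlg.action F)))
        (δR : DualAction Γ (RedCrossed (StrongComplexAlg.action F)))
        (Φ : FullCrossed (StrongComplexAlg.action F) ≃⋆ₐ[ℂ]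
          RedCrossed (StrongComplexAlg.action F)),
      (∀ s, δP.δ (StrongProjAlg.p F s) = .tmul (StrongProjAlg.p F s) (.unit s)) ∧
      (∀ a s, δE.δ (FullCrossed.mk _ a s) = .tmul (FullCrossed.mk _ a s) (.unit s)) ∧
      (∀ a s, δR.δ (RedCrossed.mk _ a s) = .tmul (RedCrossed.mk _ a s) (.unit s)) ∧
      (∀ a s, Φ (FullCrossed.mk _ a s) = RedCrossed.mk _ a s) ∧
      DualMoritaEquivalent δP δE ∧ DualMoritaEquivalent δP δR := by
  obtain ⟨b, E⟩ := StrongComplexAlg.exists_equivariantComplex hF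
  have hp := StrongProjAlg.generates F
  have hpp := StrongProjAlg.isStrongProjFamily F
  have hA := StrongComplexAlg.actsOnDilations hF hpp
  have hf := FullCrossed.isCrossedFamily (StrongComplexAlg.action F)
  have hr := RedCrossed.isCrossedFamily (StrongComplexAlg.action F)
  have hfg := FullCrossed.generates (StrongComplexAlg.action F)
  have hrg := RedCrossed.generates (StrongComplexAlg.action F)
  obtain ⟨δE, hδE⟩ := FullCrossed.exists_dualAction (StrongComplexAlg.action F)
  obtain ⟨δR, hδR⟩ := RedCrossed.exists_dualAction (StrongComplexAlg.action F)
  obtain ⟨φ, hφ⟩ : ∃ φ : StrongProjAlg F →⋆ₙₐ[ℂ] FullCrossed (StrongComplexAlg.action F), ∀ s,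
      φ (StrongProjAlg.p F s) = FullCrossed.mk _ (b * (StrongComplexAlg.action F).act s b) s :=
    CStarGen.exists_hom_of_relations _ (E.isStrongProjFamily hf
      (isStrongComplexFamily_gen fun i => RelFamily.prop i))
  have hinj : Function.Injective φ := hp.injective_of_norm_eval φ fun q => by
    rw [funext hφ]
    exact hA.norm_eval_le_full hpp.toIsProjFamily E q
  obtain ⟨δP, hδP, hM⟩ := E.exists_dualMoritaEquivalent hf hfg hδE hp φ hinj hφ
  obtain ⟨κ, hκ⟩ : ∃ κ : FullCrossed (StrongComplexAlg.action F) →⋆ₙₐ[ℂ]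
      RedCrossed (StrongComplexAlg.action F), ∀ x : StrongComplexAlg F × Γ,
      κ (FullCrossed.mk _ x.1 x.2) = RedCrossed.mk _ x.1 x.2 :=
    CStarGen.exists_hom_of_relations _ hr
  have hκφ (s : Γ) : κ.comp φ (StrongProjAlg.p F s) =
      RedCrossed.mk _ (b * (StrongComplexAlg.action F).act s b) s := by
    rw [NonUnitalStarAlgHom.comp_apply, hφ]
    exact hκ (_, s)
  have hδinj : Function.Injective δP.δ := hpp.injective_of_isHomogeneous hp hδP
  -- The dilation estimate bounds only the norm of `p_s ⊗ λ_s` by the reduced crossed product.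
  -- Injectivity of `δP` identifies this norm with that of `p_s`, so the corner survives in the
  -- reduced crossed product.
  have hκinj : Function.Injective (κ.comp φ) := hp.injective_of_norm_eval _ fun q => by
    rw [funext hκφ]
    refine le_trans (le_of_eq ?_) (hA.norm_eval_tmul_le_red hpp.toIsProjFamily E q)
    rw [← NonUnitalStarAlgHom.norm_map δP.δ hδinj, StarTerm.map_eval]
    exact congrArg (fun g => ‖q.eval g‖) (funext hδP)
  have hi : Function.Injective κ := E.injective_of_injective_comp hf hfg hp φ hinj hφ κ hκinj
  have hs : Function.Surjective κ := by
    refine Set.range_eq_univ.mp ?_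
    rw [hfg.range_eq κ hi, funext hκ, hrg.cstarAdjoin_eq_top]
    rfl
  exact ⟨δP, δE, δR, StarAlgEquiv.ofBijective κ ⟨hi, hs⟩, hδP, fun a s => hδE (a, s),
    fun a s => hδR (a, s), fun a s => hκ (a, s), hM,
    E.dualMoritaEquivalent hr hrg hδR hp hδP (κ.comp φ) hκinj hκφ⟩

end Final

end

theorem theorem4p7 {Γ : Type u} [Group Γ] (F : Finset Γ) (hinv : ∀ s ∈ F, s⁻¹ ∈ F)
    (hone : (1 : Γ) ∈ F) :
    (∃ (δP : DualAction Γ (ProjAlg F)) (δE : DualAction Γ (FullCrossed (ComplexAlg.action F))),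
      (∀ s, δP.δ (ProjAlg.p F s) = .tmul (ProjAlg.p F s) (.unit s)) ∧
      (∀ a s, δE.δ (FullCrossed.mk _ a s) = .tmul (FullCrossed.mk _ a s) (.unit s)) ∧
      DualMoritaEquivalent δP δE) ∧
    (∃ (δP : DualAction Γ (RedProjAlg F)) (δE : DualAction Γ (RedCrossed (ComplexAlg.action F))),
      (∀ s, δP.δ (RedProjAlg.p F s) = .tmul (RedProjAlg.p F s) (.unit s)) ∧
      (∀ a s, δE.δ (RedCrossed.mk _ a s) = .tmul (RedCrossed.mk _ a s) (.unit s)) ∧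
      DualMoritaEquivalent δP δE) ∧
    (∃ (δP : DualAction Γ (StrongProjAlg F))
        (δE : DualAction Γ (FullCrossed (StrongComplexAlg.action F)))
        (δR : DualAction Γ (RedCrossed (StrongComplexAlg.action F)))
        (Φ : FullCrossed (StrongComplexAlg.action F) ≃⋆ₐ[ℂ]
          RedCrossed (StrongComplexAlg.action F)),
      (∀ s, δP.δ (StrongProjAlg.p F s) = .tmul (StrongProjAlg.p F s) (.unit s)) ∧
      (∀ a s, δE.δ (FullCrossed.mk _ a s) = .tmul (FullCrossed.mk _ a s) (.unit s)) ∧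
      (∀ a s, δR.δ (RedCrossed.mk _ a s) = .tmul (RedCrossed.mk _ a s) (.unit s)) ∧
      (∀ a s, Φ (FullCrossed.mk _ a s) = RedCrossed.mk _ a s) ∧
      DualMoritaEquivalent δP δE ∧ DualMoritaEquivalent δP δR) :=
  ⟨ProjAlg.exists_dualMoritaEquivalent hinv, RedProjAlg.exists_dualMoritaEquivalent hinv,
    StrongProjAlg.exists_dualMoritaEquivalent hinv⟩
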